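/- **Notation.** For a Young diagram (partition) $\lambda$ of size $|\lambda|$, with $d$ cells on its first diagonal and conjugate $\lambda'$, let $a_i=\lambda_i-i+\tfrac12$, $b_i=\lambda'_i-i+\tfrac12$ ($1\le i\le d$) and $p_k(\lambda)=\sum_{i=1}^d a_i^k+(-1)^{k-1}\sum_{i=1}^d b_i^k$ for $k\ge 1$. The algebra of *observables* $\mathscr O$ is the algebra of complex functions on the set of all Young diagrams that is (freely) generated over $\mathbb C$ by the $p_k$, and $\deg$ is the degree on $\mathscr O$ for which $\deg p_k=k$ (with the convention $\deg 0=0$). Let $\chi^\lambda=\zeta^\lambda/\dim\lambda$ be the normalized irreducible character of $\mathfrak S_{|\lambda|}$ with label $\lambda$. For a partition $\mu$ of any size, set $\Sigma_\mu(\lambda)=n(n-1)\cdots(n-|\mu|+1)\,\chi^\lambda(\mu\sqcup 1^{n-|\mu|})$ if $n=|\lambda|\ge|\mu|$, and $\Sigma_\mu(\lambda)=0$ otherwise. The functions $\Sigma_\mu$ form a linear basis of $\mathscr O$, and the *disjoint product* $\bullet$ is the bilinear product on $\mathscr O$ with $\Sigma_\mu\bullet\Sigma_\nu=\Sigma_{\mu\sqcup\nu}$.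 The Thoma simplex $\Omega$ is the set of pairs $\omega=(\alpha,\beta)$ of non-increasing sequences of non-negative reals with $\sum_i\alpha_i+\sum_i\beta_i\le1$. Put $p_1(\omega)=1$ and $p_k(\omega)=\sum_i\alpha_i^k+(-1)^{k-1}\sum_i\beta_i^k$ for $k\ge2$, and let $\chi^\omega(\sigma)=\prod_{c}p_{|c|}(\omega)$, the product running over the cycles $c$ of $\sigma$, with $|c|$ the length of $c$. Let $\mathbb P_{n,\omega}$ be the probability measure on the set $\mathfrak Y_n$ of Young diagrams of size $n$ given by $\chi^\omega|_{\mathfrak S_n}=\sum_{\lambda\in\mathfrak Y_n}\mathbb P_{n,\omega}[\lambda]\,\chi^\lambda$; equivalently, $$\mathbb P_{n,\omega}[\lambda]=\frac{\dim\lambda}{n!}\sum_{\sigma\in\mathfrak S_n}\zeta^\lambda(\sigma)\,\chi^\omega(\sigma).$$ Let $\mathbb E_{n,\omega}$ be the expectation under $\mathbb P_{n,\omega}$. For observables $X_1,\dots,X_r$ set $$k_{n,\omega}(X_1,\dots,X_r)=\sum_{\pi}(-1)^{\ell(\pi)-1}(\ell(\pi)-1)!\prod_{B\in\pi}\mathbb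 E_{n,\omega}\Big[\prod_{j\in B}X_j\Big],$$ the sum running over the set partitions $\pi$ of $\{1,\dots,r\}$, with $\ell(\pi)$ the number of blocks of $\pi$, and let the *disjoint cumulant* $k^{\bullet}_{n,\omega}(X_1,\dots,X_r)$ be given by the same formula with the products $\prod_{j\in B}X_j$ taken for $\bullet$. **Theorem 3.7.** Let $r\ge1$ and let $X_1,\dots,X_r\in\mathscr O$. There is a constant $C$, depending only on $X_1,\dots,X_r$, such that for every $\omega\in\Omega$ and every integer $n\ge1$, $$\big|k^{\bullet}_{n,\omega}(X_1,\dots,X_r)\big|\le C\,n^{\deg X_1+\cdots+\deg X_r-r+1}\quad\text{and}\quad \big|k_{n,\omega}(X_1,\dots,X_r)\big|\le C\,n^{\deg X_1+\cdots+\deg X_r-r+1}.$$ -/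

import Mathlib

open Finset

noncomputable section

namespace Thoma

/-! ### Irreducible characters of the symmetric groups

For a Young diagram `lam` of size `n`, the symmetric group `𝔖_n` is realized as the group of
permutations of the `n` cells of `lam`, acting on the polynomials in `n` variables that are labelled
by these cells. A cell `(i, j)` lies in the row `i` and in the column `j` (both counted from `0`). -/

/-- The cells of a Young diagram, as a type. -/
abbrev Cell (lam : YoungDiagram) : Type := {c : ℕ × ℕ // c ∈ lam.cells}

/-- The product over the columns of `lam` of the Vandermonde polynomials in the variables that are
attached to the cells of the column. -/
def spechtPoly (lam : YoungDiagram) : MvPolynomial (Cell lam) ℂ :=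
  ∏ p ∈ (univ : Finset (Cell lam × Cell lam)) with
      p.1.1.2 = p.2.1.2 ∧ p.1.1.1 < p.2.1.1,
    (MvPolynomial.X p.1 - MvPolynomial.X p.2)

/-- The action of a permutation of the cells on polynomials, by permutation of the variables. -/
def permAction (lam : YoungDiagram) (σ : Equiv.Perm (Cell lam)) :
    MvPolynomial (Cell lam) ℂ →ₗ[ℂ] MvPolynomial (Cell lam) ℂ :=
  (MvPolynomial.rename σ).toLinearMap

/-- The irreducible module `V^lam` (Specht module): the span of the orbit of `spechtPoly lam`. -/
def spechtModule (lam : YoungDiagram) : Submodule ℂ (MvPolynomial (Cell lam) ℂ) :=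
  Submodule.span ℂ (Set.range fun σ : Equiv.Perm (Cell lam) => permAction lam σ (spechtPoly lam))

theorem permAction_mem (lam : YoungDiagram) (σ : Equiv.Perm (Cell lam)) :
    ∀ x ∈ spechtModule lam, permAction lam σ x ∈ spechtModule lam := by
  intro x hx
  induction hx using Submodule.span_induction with
  | mem y hy =>
    obtain ⟨τ, rfl⟩ := hy
    refine Submodule.subset_span ⟨σ * τ, ?_⟩
    simp [permAction, MvPolynomial.rename_rename, Equiv.Perm.coe_mul]
  | zero => simp
  | add y z _ _ hy hz => rw [map_add]; exact add_mem hy hz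
  | smul c y _ hy => rw [map_smul]; exact Submodule.smul_mem _ c hy

/-- The dimension of `V^lam`. -/
def dimension (lam : YoungDiagram) : ℕ := Module.finrank ℂ (spechtModule lam)

/-- The (non-normalized) irreducible character `ζ^lam`: the trace of `σ` acting on `V^lam`. -/
def zeta (lam : YoungDiagram) (σ : Equiv.Perm (Cell lam)) : ℂ :=
  LinearMap.trace ℂ (spechtModule lam) ((permAction lam σ).restrict (permAction_mem lam σ))

open Classical in
/-- The value `χ^lam(ρ)` of the normalized irreducible character `χ^lam = ζ^lam / dim lam` on a
permutation of cycle type `ρ`, where `ρ` is a partition of the size of `lam` given by the multiset of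
its parts (fixed points are parts equal to `1`). -/
def chi (lam : YoungDiagram) (ρ : Multiset ℕ+) : ℂ :=
  if h : ∃ σ : Equiv.Perm (Cell lam), σ.partition.parts = ρ.map (fun k => (k : ℕ)) then
    zeta lam h.choose / (dimension lam : ℂ)
  else 0

/-! ### Observables of diagrams -/

/-- The number `d` of cells of `lam` on the first diagonal. -/
def diagLen (lam : YoungDiagram) : ℕ := #{c ∈ lam.cells | c.1 = c.2}

/-- The Frobenius moment `p_k(lam) = ∑ a_i ^ k + (-1) ^ (k - 1) ∑ b_i ^ k`, where the Frobenius
coordinates are `a_i = lam_i - i + 1/2` and `b_i = lam'_i - i + 1/2` for `1 ≤ i ≤ d`; below, `i` is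
counted from `0`. -/
def frobeniusMoment (k : ℕ+) (lam : YoungDiagram) : ℂ :=
  ∑ i ∈ range (diagLen lam), ((lam.rowLen i : ℂ) - (i : ℂ) - 1 / 2) ^ (k : ℕ)
    + (-1) ^ ((k : ℕ) - 1) *
      ∑ i ∈ range (diagLen lam), ((lam.colLen i : ℂ) - (i : ℂ) - 1 / 2) ^ (k : ℕ)

/-- The algebra of observables of diagrams: the algebra of functions on the set of all Young diagrams
that is generated by the Frobenius moments. -/
def observables : Subalgebra ℂ (YoungDiagram → ℂ) :=
  Algebra.adjoin ℂ (Set.range frobeniusMoment)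

/-- The degree of an observable for the gradation `deg p_k = k`: the (least) weighted degree of a
polynomial in the `p_k` that represents it. The `p_k` being algebraically independent, there is only
one such polynomial. -/
def deg (X : YoungDiagram → ℂ) : ℕ :=
  sInf {d | ∃ F : MvPolynomial ℕ+ ℂ, MvPolynomial.aeval frobeniusMoment F = X ∧
    MvPolynomial.weightedTotalDegree (fun k : ℕ+ => (k : ℕ)) F = d}

/-! ### The symbols `Σ_μ` and the disjoint product

A partition of arbitrary size is the multiset of its (positive) parts; `μ ⊔ ν` is then `μ + ν`. -/

/-- The size `|μ|` of a partition. -/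
def size (μ : Multiset ℕ+) : ℕ := (μ.map (fun k => (k : ℕ))).sum

/-- The symbol `Σ_μ(lam) = n (n - 1) ⋯ (n - |μ| + 1) χ^lam(μ ⊔ 1^{n - |μ|})` if
`n = |lam| ≥ |μ|`, and `0` otherwise. -/
def symbol (μ : Multiset ℕ+) (lam : YoungDiagram) : ℂ :=
  if size μ ≤ lam.card then
    (lam.card.descFactorial (size μ) : ℂ) * chi lam (μ + Multiset.replicate (lam.card - size μ) 1)
  else 0

/-- The observable `∑ c_μ Σ_μ` attached to a formal linear combination `∑ c_μ [μ]` of partitions. -/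
def ofSymbols (f : AddMonoidAlgebra ℂ (Multiset ℕ+)) : YoungDiagram → ℂ :=
  f.coeff.sum fun μ c => c • symbol μ

/-- The expansion of an observable in the linear basis `(Σ_μ)`. -/
def toSymbols (X : YoungDiagram → ℂ) : AddMonoidAlgebra ℂ (Multiset ℕ+) :=
  Function.invFun ofSymbols X

/-- The disjoint product of the observables `X_j`, `j ∈ B`: it is the commutative product that is
multilinear and such that `Σ_μ • Σ_ν = Σ_{μ ⊔ ν}`, that is to say the product of the algebra of the
monoid of partitions (with the operation `⊔`) transported by the linear basis `(Σ_μ)`. -/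
def disjointProd {ι : Type*} (B : Finset ι) (X : ι → YoungDiagram → ℂ) : YoungDiagram → ℂ :=
  ofSymbols (∏ j ∈ B, toSymbols (X j))

/-! ### The Thoma simplex and the coherent measures -/

/-- A point `ω = (α, β)` of the Thoma simplex. -/
structure Simplex where
  α : ℕ → ℝ
  β : ℕ → ℝ
  antitone_α : Antitone α
  antitone_β : Antitone β
  nonneg_α : ∀ i, 0 ≤ α i
  nonneg_β : ∀ i, 0 ≤ β i
  summable_α : Summable α
  summable_β : Summable β
  sum_le_one : ∑' i, α i + ∑' i, β i ≤ 1

/-- The power sum `p_k(ω) = p_k(A - B + γE)`: it is `1` for `k = 1`, and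
`∑ α_i ^ k + (-1) ^ (k - 1) ∑ β_i ^ k` for `k ≥ 2`. -/
def powerSum (ω : Simplex) (k : ℕ) : ℝ :=
  if k = 1 then 1 else ∑' i, ω.α i ^ k + (-1) ^ (k - 1) * ∑' i, ω.β i ^ k

/-- The value `χ^ω(σ) = p_{t(σ)}(ω)` of the extremal character of parameter `ω` of the infinite
symmetric group on a permutation `σ` of cycle type `t(σ)`. -/
def extremalChar (ω : Simplex) {S : Type*} [Fintype S] [DecidableEq S] (σ : Equiv.Perm S) : ℝ :=
  (σ.partition.parts.map (powerSum ω)).prod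

/-- The specialization `s_lam(ω) = s_lam(A - B + γE)` of the Schur function, given by the expansion of
Schur functions in power sums `s_lam = (1 / n!) ∑_{σ ∈ 𝔖_n} ζ^lam(σ) p_{t(σ)}`; in other words, the
Hermitian product of the restriction of `χ^ω` to `𝔖_n` with the (real-valued) irreducible character
`ζ^lam`. -/
def schur (ω : Simplex) (lam : YoungDiagram) : ℂ :=
  (1 / (lam.card.factorial : ℂ)) *
    ∑ σ : Equiv.Perm (Cell lam), zeta lam σ * (extremalChar ω σ : ℂ)

/-- The weight `ℙ_{n,ω}[lam] = (dim lam) s_lam(ω)`, for `n = |lam|`: this is the coefficient of the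
normalized irreducible character `χ^lam` in the expansion of the restriction of `χ^ω` to `𝔖_n`. It is
a non-negative real number, here viewed as a complex number. -/
def weight (ω : Simplex) (lam : YoungDiagram) : ℂ := (dimension lam : ℂ) * schur ω lam

theorem finite_diagrams (n : ℕ) : {lam : YoungDiagram | lam.card = n}.Finite := by
  have hinj : Function.Injective YoungDiagram.cells := fun a b h => YoungDiagram.ext h
  refine (((range n ×ˢ range n).powerset.finite_toSet).preimage hinj.injOn).subset ?_
  rintro lam rfl
  simp only [Set.mem_preimage, Finset.coe_powerset, Set.mem_powerset_iff, Finset.coe_subset]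
  rintro ⟨i, j⟩ h
  have h' : (i, j) ∈ lam := h
  rw [mem_product, Finset.mem_range, Finset.mem_range]
  constructor
  · have h1 := YoungDiagram.mem_iff_lt_colLen.1 h'
    rw [YoungDiagram.colLen_eq_card] at h1
    exact h1.trans_le (card_le_card (Finset.filter_subset _ _))
  · have h1 := YoungDiagram.mem_iff_lt_rowLen.1 h'
    rw [YoungDiagram.rowLen_eq_card] at h1
    exact h1.trans_le (card_le_card (Finset.filter_subset _ _))

/-- The set `𝔜_n` of Young diagrams of size `n`. -/
def diagrams (n : ℕ) : Finset YoungDiagram := (finite_diagrams n).toFinset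

/-- The expectation `𝔼_{n,ω}[X]` of an observable under the coherent measure `ℙ_{n,ω}` on `𝔜_n`. -/
def expectation (n : ℕ) (ω : Simplex) (X : YoungDiagram → ℂ) : ℂ :=
  ∑ lam ∈ diagrams n, weight ω lam * X lam

/-! ### Cumulants -/

/-- The sum `∑_π μ(π) ∏_{B ∈ π} m(B)` over the set partitions `π` of an `r`-element set, where
`μ(π) = (-1) ^ (ℓ - 1) (ℓ - 1)!` if `π` has `ℓ` blocks. -/
def cumulantOf {r : ℕ} (m : Finset (Fin r) → ℂ) : ℂ :=
  ∑ π : Finpartition (univ : Finset (Fin r)),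
    (-1) ^ (#π.parts - 1) * ((#π.parts - 1).factorial : ℂ) * ∏ B ∈ π.parts, m B

/-- The joint cumulant `k_{n,ω}(X_1, …, X_r)`. -/
def cumulant (n : ℕ) (ω : Simplex) {r : ℕ} (X : Fin r → YoungDiagram → ℂ) : ℂ :=
  cumulantOf fun B => expectation n ω (∏ j ∈ B, X j)

/-- The disjoint cumulant `k^•_{n,ω}(X_1, …, X_r)`. -/
def disjointCumulant (n : ℕ) (ω : Simplex) {r : ℕ} (X : Fin r → YoungDiagram → ℂ) : ℂ :=
  cumulantOf fun B => expectation n ω (disjointProd B X)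

end Thoma

end

/-! Everything reduces to the symbols `Σ_μ`. An observable `X` is a combination of symbols of size
at most `deg X` (`mem_symbolSpan_deg`), the symbols are linearly independent
(`linearIndependent_symbol`), and both kinds of cumulants are multilinear. So it suffices to bound
the cumulants of `Σ_{μ_1}, …, Σ_{μ_r}` by a constant times `n ^ (D - r + 1)`, where `D = ∑ |μ_j|`.

Let `g` be a permutation of cycle type `μ`. The sum over all embeddings `a` of its support set into
`Fin n` of the transported permutations is central, so by Schur's lemma it acts on the irreducible
module as the scalar `Σ_μ(lam)` (`sum_spechtRep_push`). Hence a product of symbols is a sum of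
normalized characters over families of embeddings (`prod_symbol_eq`). Taking the expectation
replaces each normalized character by the extremal character (`sum_weight_mul_charN`), which has
modulus at most one and is multiplicative on permutations with disjoint supports. For the disjoint
product, `𝔼[Σ_{⊔μ_j}]` is a sum of the same shape, the weight being the indicator of pairwise
disjoint images times a product of power sums of `ω`.

In both cases the cumulant is a sum over families of `r` embeddings of the cumulant of a bounded
weight, and that weight factorizes whenever the family splits into two groups with disjoint images.
Cumulants of independent families vanish (`setCumulant_eq_zero`), so only connected families
contribute. A connected family covers at most `D - (r - 1)` points (`card_image_add_le`), and there
are `O(n ^ (D - r + 1))` such families (`norm_cumulantOf_sum_le`). No estimate depends on `ω`.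

The filtration of observables rests on Jucys-Murphy elements. The Specht polynomial is a common
eigenvector of these elements, with the contents of the cells as eigenvalues, by the Garnir relation
(`garnir`). Their power sums are central, so power sums of contents are sums of characters over
tuples, that is, combinations of symbols (`contentSum_mem`). Frobenius moments are combinations of
these power sums. The contents also separate the diagrams, which gives orthogonality of the
characters, then their completeness by counting, then the expectation formula and the independence
of the symbols. -/

noncomputable section

namespace Thoma

/-! ### Products of differences -/

/-- The product of the differences `v a - v b` over a set of pairs `(a, b)`. -/
def prodDiff {A R : Type*} [CommRing R] (P : Finset (A × A)) (v : A → R) : R :=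
  ∏ p ∈ P, (v p.1 - v p.2)

/-- Isolates the factors that involve `b`. Every pair having `b` in second position is reversed so
that `b` comes first, which accounts for the sign. -/
theorem prodDiff_split {A R : Type*} [Fintype A] [DecidableEq A] [CommRing R]
    (P : Finset (A × A)) (hP : ∀ x y, (x, y) ∈ P → (y, x) ∉ P) (b : A) (v : A → R) :
    prodDiff P v = prodDiff {p ∈ P | p.1 ≠ b ∧ p.2 ≠ b} v *
      ((-1) ^ #{c | (c, b) ∈ P} * ∏ c with (c, b) ∈ P ∨ (b, c) ∈ P, (v b - v c)) := by
  unfold prodDiff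
  rw [← prod_filter_mul_prod_filter_not P (fun p => p.1 ≠ b ∧ p.2 ≠ b)]
  congr 1
  have h1 : {p ∈ P | ¬ (p.1 ≠ b ∧ p.2 ≠ b)} =
      ({c | (c, b) ∈ P} : Finset A).image (fun c => (c, b)) ∪
      ({c | (b, c) ∈ P} : Finset A).image (fun c => (b, c)) := by
    ext ⟨x, y⟩
    simp only [mem_filter, mem_union, mem_image, mem_univ, true_and, Prod.mk.injEq]
    constructor
    · rintro ⟨h, h'⟩
      by_cases hx : x = b
      · subst hx; exact Or.inr ⟨y, h, rfl, rfl⟩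
      · have hy : y = b := by tauto
        subst hy; exact Or.inl ⟨x, h, rfl, rfl⟩
    · rintro (⟨c, h, rfl, rfl⟩ | ⟨c, h, rfl, rfl⟩)
      · exact ⟨h, by tauto⟩
      · exact ⟨h, by tauto⟩
  rw [h1, prod_union, prod_image (by intro x _ y _ h; simpa using h),
    prod_image (by intro x _ y _ h; simpa using h)]
  · rw [filter_or, prod_union]
    · rw [← mul_assoc]
      congr 1
      rw [← prod_const, ← prod_mul_distrib]
      exact prod_congr rfl fun c _ => by ring
    · rw [disjoint_left]
      intro c hc hc'
      simp only [mem_filter, mem_univ, true_and] at hc hc'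
      exact hP _ _ hc hc'
  · rw [disjoint_left]
    intro p hp hp'
    simp only [mem_image, mem_filter, mem_univ, true_and] at hp hp'
    obtain ⟨c, h, rfl⟩ := hp
    obtain ⟨c', h', h''⟩ := hp'
    obtain ⟨rfl, rfl⟩ := Prod.mk.inj h''
    exact hP _ _ h h

theorem prodDiff_congr {A R : Type*} [CommRing R] {P : Finset (A × A)} {v w : A → R}
    (h : ∀ p ∈ P, v p.1 = w p.1 ∧ v p.2 = w p.2) : prodDiff P v = prodDiff P w :=
  prod_congr rfl fun p hp => by rw [(h p hp).1, (h p hp).2]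

variable {lam : YoungDiagram}

/-- The pairs of cells of a same column, listed from top to bottom. -/
def colPairs (lam : YoungDiagram) : Finset (Cell lam × Cell lam) :=
  {p | p.1.1.2 = p.2.1.2 ∧ p.1.1.1 < p.2.1.1}

/-- The other cells in the column of a cell. -/
def colOthers (b : Cell lam) : Finset (Cell lam) := {c | c.1.2 = b.1.2 ∧ c ≠ b}

theorem cell_ext {a b : Cell lam} (h1 : a.1.1 = b.1.1) (h2 : a.1.2 = b.1.2) : a = b :=
  Subtype.ext (Prod.ext h1 h2)

theorem colPairs_asymm (x y : Cell lam) (h : (x, y) ∈ colPairs lam) : (y, x) ∉ colPairs lam := by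
  simp only [colPairs, mem_filter, mem_univ, true_and] at h ⊢
  omega

theorem mem_colPairs_or (b c : Cell lam) :
    ((c, b) ∈ colPairs lam ∨ (b, c) ∈ colPairs lam) ↔ c.1.2 = b.1.2 ∧ c ≠ b := by
  simp only [colPairs, mem_filter, mem_univ, true_and]
  constructor
  · rintro (⟨h, h'⟩ | ⟨h, h'⟩)
    · exact ⟨h, by rintro rfl; omega⟩
    · exact ⟨h.symm, by rintro rfl; omega⟩
  · rintro ⟨h, h'⟩
    have : c.1.1 ≠ b.1.1 := fun h'' => h' (cell_ext h'' h)
    omega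

/-- Neither `P` nor the sign `ε` depends on `v`, so exchanging the values at `a` and `b` only
affects the two explicit products. Erasing `a` from the second one avoids counting the factor `v a -
v b` twice when both cells lie in one column. -/
theorem prodDiff_colPairs_split {R : Type*} [CommRing R] (a b : Cell lam) (hab : a ≠ b) :
    ∃ P : Finset (Cell lam × Cell lam), (∀ p ∈ P, p.1 ≠ a ∧ p.2 ≠ a ∧ p.1 ≠ b ∧ p.2 ≠ b) ∧
      ∃ ε : R, ∀ v : Cell lam → R, prodDiff (colPairs lam) v = prodDiff P v * ε *
        (∏ c ∈ colOthers a, (v a - v c)) * ∏ c ∈ (colOthers b).erase a, (v b - v c) := by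
  refine ⟨{p ∈ {p ∈ colPairs lam | p.1 ≠ a ∧ p.2 ≠ a} | p.1 ≠ b ∧ p.2 ≠ b}, ?_,
    (-1) ^ #{c | (c, a) ∈ colPairs lam} *
    (-1) ^ #{c | (c, b) ∈ {p ∈ colPairs lam | p.1 ≠ a ∧ p.2 ≠ a}}, ?_⟩
  · intro p hp
    simp only [mem_filter] at hp
    tauto
  · intro v
    rw [prodDiff_split _ colPairs_asymm a v, prodDiff_split _ _ b v]
    · have h1 : ({c | (c, a) ∈ colPairs lam ∨ (a, c) ∈ colPairs lam} : Finset (Cell lam))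
          = colOthers a := by
        ext c; simp only [mem_filter, mem_univ, true_and, mem_colPairs_or, colOthers]
      have h2 : ({c | (c, b) ∈ {p ∈ colPairs lam | p.1 ≠ a ∧ p.2 ≠ a} ∨
          (b, c) ∈ {p ∈ colPairs lam | p.1 ≠ a ∧ p.2 ≠ a}} : Finset (Cell lam))
          = (colOthers b).erase a := by
        ext c
        have := mem_colPairs_or b c
        simp only [mem_filter, mem_univ, true_and, colOthers, mem_erase]
        tauto
      rw [h1, h2]
      ring
    · intro x y h
      simp only [mem_filter, not_and] at h ⊢
      exact fun h' => absurd h' (colPairs_asymm _ _ h.1)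

theorem prodDiff_swap_of_col_eq {R : Type*} [CommRing R] {a b : Cell lam} (hab : a ≠ b)
    (hcol : a.1.2 = b.1.2) (v : Cell lam → R) :
    prodDiff (colPairs lam) (v ∘ Equiv.swap a b) = - prodDiff (colPairs lam) v := by
  obtain ⟨P, hP, ε, h⟩ := prodDiff_colPairs_split (R := R) a b hab
  have hs : colOthers a = insert b ((colOthers b).erase a) := by
    ext c
    simp only [colOthers, mem_filter, mem_univ, true_and, mem_insert, mem_erase, hcol]
    constructor
    · rintro ⟨h, h'⟩; tauto
    · rintro (rfl | h)
      · exact ⟨rfl, hab.symm⟩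
      · tauto
  have hb : b ∉ (colOthers b).erase a := by simp [colOthers]
  have hne : ∀ c ∈ (colOthers b).erase a, Equiv.swap a b c = c := by
    intro c hc
    simp only [colOthers, mem_filter, mem_univ, true_and, mem_erase] at hc
    exact Equiv.swap_apply_of_ne_of_ne hc.1 hc.2.2
  rw [h, h, prodDiff_congr (v := v ∘ Equiv.swap a b) (w := v), hs, prod_insert hb, prod_insert hb,
    prod_congr rfl (g := fun c => v b - v c) fun c hc => by simp [hne c hc],
    prod_congr (s₁ := (colOthers b).erase a) rfl (f := fun c => (v ∘ Equiv.swap a b) b - _)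
      (g := fun c => v a - v c) fun c hc => by simp [hne c hc]]
  · simp only [Function.comp, Equiv.swap_apply_left, Equiv.swap_apply_right]
    ring
  · intro p hp
    obtain ⟨h1, h2, h3, h4⟩ := hP p hp
    simp [Equiv.swap_apply_of_ne_of_ne h1 h3, Equiv.swap_apply_of_ne_of_ne h2 h4]

/-- A division-free form of the ratio between the swapped and the original product; over a field
this ratio turns out to be a term of a Lagrange interpolation formula. -/
theorem prodDiff_swap_of_col_ne {R : Type*} [CommRing R] {a b : Cell lam}
    (hcol : a.1.2 ≠ b.1.2) (v : Cell lam → R) :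
    prodDiff (colPairs lam) (v ∘ Equiv.swap a b) *
        ((∏ c ∈ colOthers a, (v a - v c)) * ∏ c ∈ colOthers b, (v b - v c)) =
      prodDiff (colPairs lam) v *
        ((∏ c ∈ colOthers a, (v b - v c)) * ∏ c ∈ colOthers b, (v a - v c)) := by
  have hab : a ≠ b := by rintro rfl; exact hcol rfl
  obtain ⟨P, hP, ε, h⟩ := prodDiff_colPairs_split (R := R) a b hab
  have he : (colOthers b).erase a = colOthers b := by
    refine erase_eq_of_notMem ?_
    simp [colOthers, hcol]
  have hne : ∀ c, c ∈ colOthers a ∨ c ∈ colOthers b → Equiv.swap a b c = c := by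
    intro c hc
    refine Equiv.swap_apply_of_ne_of_ne ?_ ?_
    · rintro rfl
      simp [colOthers, hcol] at hc
    · rintro rfl
      simp [colOthers, hcol.symm] at hc
  rw [h, h, prodDiff_congr (v := v ∘ Equiv.swap a b) (w := v), he,
    prod_congr rfl (f := fun c => (v ∘ Equiv.swap a b) a - _)
      (g := fun c => v b - v c) fun c hc => by simp [hne c (Or.inl hc)],
    prod_congr rfl (f := fun c => (v ∘ Equiv.swap a b) b - _)
      (g := fun c => v a - v c) fun c hc => by simp [hne c (Or.inr hc)]]
  · ring
  · intro p hp
    obtain ⟨h1, h2, h3, h4⟩ := hP p hp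
    simp [Equiv.swap_apply_of_ne_of_ne h1 h3, Equiv.swap_apply_of_ne_of_ne h2 h4]

/-! ### The Specht polynomial -/

theorem spechtPoly_eq : spechtPoly lam = prodDiff (colPairs lam) MvPolynomial.X := rfl

theorem permAction_spechtPoly (σ : Equiv.Perm (Cell lam)) :
    permAction lam σ (spechtPoly lam) =
      prodDiff (colPairs lam) (MvPolynomial.X ∘ σ) := by
  simp [permAction, spechtPoly_eq, prodDiff, map_prod]

theorem permAction_one (p : MvPolynomial (Cell lam) ℂ) : permAction lam 1 p = p := by
  simp [permAction]

theorem permAction_mul (σ τ : Equiv.Perm (Cell lam)) (p : MvPolynomial (Cell lam) ℂ) :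
    permAction lam (σ * τ) p = permAction lam σ (permAction lam τ p) := by
  simp [permAction, MvPolynomial.rename_rename, Equiv.Perm.coe_mul]

theorem permAction_swap_of_col_eq {a b : Cell lam} (hab : a ≠ b) (hcol : a.1.2 = b.1.2) :
    permAction lam (Equiv.swap a b) (spechtPoly lam) = - spechtPoly lam := by
  rw [permAction_spechtPoly, prodDiff_swap_of_col_eq hab hcol, spechtPoly_eq]

theorem X_sub_X_ne_zero {A : Type*} {a b : A} (h : a ≠ b) :
    (MvPolynomial.X a - MvPolynomial.X b : MvPolynomial A ℂ) ≠ 0 := by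
  rw [sub_ne_zero]
  exact fun h' => h (MvPolynomial.X_injective h')

theorem spechtPoly_ne_zero (lam : YoungDiagram) : spechtPoly lam ≠ 0 := by
  rw [spechtPoly_eq, prodDiff, prod_ne_zero_iff]
  intro p hp
  refine X_sub_X_ne_zero fun h => ?_
  simp only [colPairs, mem_filter, mem_univ, true_and, h] at hp
  omega

theorem card_col (lam : YoungDiagram) (j : ℕ) :
    #{c : Cell lam | c.1.2 = j} = lam.colLen j := by
  rw [YoungDiagram.colLen_eq_card]
  refine card_bij (fun c _ => c.1) ?_ ?_ ?_
  · rintro c hc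
    rw [mem_filter] at hc
    exact YoungDiagram.mem_col_iff.2 ⟨c.2, hc.2⟩
  · exact fun _ _ _ _ h => Subtype.ext h
  · intro c hc
    obtain ⟨h, h'⟩ := YoungDiagram.mem_col_iff.1 hc
    exact ⟨⟨c, h⟩, by simpa using h', rfl⟩

theorem colOthers_eq (b : Cell lam) : colOthers b = ({c | c.1.2 = b.1.2} : Finset _).erase b := by
  ext c; simp [colOthers, and_comm]

/-- This is Lagrange interpolation, at the nodes `v a` with `a` in column `j`, of `P(x) = ∏ (x - v
c)` over the other cells `c` of the column of `b`, evaluated at `v b`. The degree of `P` is the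
length of that column minus one, which is less than the number of nodes since column lengths do not
increase to the right. -/
theorem sum_prodDiff_swap {K : Type*} [Field K] (b : Cell lam) (j : ℕ) (hj : j < b.1.2)
    {v : Cell lam → K} (hv : Function.Injective v) :
    ∑ a : Cell lam with a.1.2 = j, prodDiff (colPairs lam) (v ∘ Equiv.swap a b)
      = prodDiff (colPairs lam) v := by
  let P : Polynomial K := ∏ c ∈ colOthers b, (Polynomial.X - Polynomial.C (v c))
  have hPe : ∀ y, P.eval y = ∏ c ∈ colOthers b, (y - v c) := by
    intro y; simp [P, Polynomial.eval_prod]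
  let s : Finset (Cell lam) := {a | a.1.2 = j}
  have hPdeg : P.degree < #s := by
    have h1 : P.degree = #(colOthers b) := by
      simp [P, Polynomial.degree_prod]
    rw [h1]
    have h2 : #(colOthers b) < #({c | c.1.2 = b.1.2} : Finset (Cell lam)) := by
      rw [colOthers_eq]
      exact card_erase_lt_of_mem (by simp)
    have h3 : #s = lam.colLen j := card_col lam j
    rw [card_col] at h2
    have := lam.colLen_anti _ _ hj.le
    exact_mod_cast (by omega : #(colOthers b) < #s)
  clear_value P
  have hL := congrArg (Polynomial.eval (v b)) (Lagrange.eq_interpolate (hv.injOn (s := s)) hPdeg)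
  rw [Lagrange.interpolate_apply, Polynomial.eval_finsetSum] at hL
  have hPb : P.eval (v b) ≠ 0 := by
    rw [hPe, prod_ne_zero_iff]
    intro c hc
    simp only [colOthers, mem_filter, mem_univ, true_and] at hc
    exact sub_ne_zero.2 fun h => hc.2 (hv h).symm
  refine mul_right_cancel₀ hPb ?_
  rw [sum_mul]
  conv_rhs => rw [hL, mul_sum]
  refine sum_congr rfl fun a ha => ?_
  have haj : a.1.2 = j := by simpa [s] using ha
  have hab : a.1.2 ≠ b.1.2 := by omega
  have key := prodDiff_swap_of_col_ne hab v
  have ha0 : (∏ c ∈ colOthers a, (v a - v c)) ≠ 0 := by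
    rw [prod_ne_zero_iff]
    intro c hc
    simp only [colOthers, mem_filter, mem_univ, true_and] at hc
    exact sub_ne_zero.2 fun h => hc.2 (hv h).symm
  have hse : s.erase a = colOthers a := by rw [colOthers_eq, haj]
  rw [Polynomial.eval_mul, Polynomial.eval_C, Lagrange.basis, Polynomial.eval_prod, hse]
  simp only [Lagrange.basisDivisor, Polynomial.eval_mul, Polynomial.eval_C, Polynomial.eval_sub,
    Polynomial.eval_X]
  rw [prod_mul_distrib, prod_inv_distrib, hPe, hPe]
  field_simp
  linear_combination key

/-- The Garnir relation for a column and a cell of a column on its right. -/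
theorem garnir (b : Cell lam) (j : ℕ) (hj : j < b.1.2) :
    ∑ a : Cell lam with a.1.2 = j, permAction lam (Equiv.swap a b) (spechtPoly lam)
      = spechtPoly lam := by
  -- Interpolation divides, so the identity is proved in the fraction field and pulled back by
  -- injectivity.
  let φ := algebraMap (MvPolynomial (Cell lam) ℂ) (FractionRing (MvPolynomial (Cell lam) ℂ))
  have hφ : Function.Injective φ := IsFractionRing.injective _ _
  have hD : ∀ σ : Cell lam → Cell lam, φ (prodDiff (colPairs lam) (MvPolynomial.X ∘ σ)) =
      prodDiff (colPairs lam) ((φ ∘ MvPolynomial.X) ∘ σ) := by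
    intro σ
    simp only [prodDiff, map_prod, map_sub]
    rfl
  apply hφ
  rw [map_sum]
  simp_rw [permAction_spechtPoly, hD, spechtPoly_eq]
  rw [sum_prodDiff_swap b j hj (hφ.comp MvPolynomial.X_injective)]
  exact (hD id).symm

/-! ### The column antisymmetrizer -/

/-- The group that is generated by the transpositions of two cells of a same column. -/
def colGroup (lam : YoungDiagram) : Subgroup (Equiv.Perm (Cell lam)) :=
  Subgroup.closure {σ | ∃ a b : Cell lam, a ≠ b ∧ a.1.2 = b.1.2 ∧ σ = Equiv.swap a b}

theorem permAction_colGroup {σ : Equiv.Perm (Cell lam)} (hσ : σ ∈ colGroup lam) :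
    permAction lam σ (spechtPoly lam) = (Equiv.Perm.sign σ : ℂ) • spechtPoly lam := by
  induction hσ using Subgroup.closure_induction with
  | mem σ h =>
    obtain ⟨a, b, hab, hc, rfl⟩ := h
    simp [permAction_swap_of_col_eq hab hc, Equiv.Perm.sign_swap hab]
  | one => simp [permAction_one]
  | mul σ τ _ _ hσ hτ =>
    rw [permAction_mul, hτ, map_smul, hσ, smul_smul, Equiv.Perm.sign_mul]
    congr 1
    push_cast
    ring
  | inv σ _ hσ =>
    have h : permAction lam σ⁻¹ (permAction lam σ (spechtPoly lam)) = spechtPoly lam := by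
      rw [← permAction_mul, inv_mul_cancel, permAction_one]
    rw [hσ, map_smul] at h
    rw [Equiv.Perm.sign_inv]
    rcases Int.units_eq_one_or (Equiv.Perm.sign σ) with h1 | h1 <;> rw [h1] at h ⊢
    · simpa using h
    · simp only [Units.val_neg, Units.val_one, Int.cast_neg, Int.cast_one, neg_smul, one_smul] at h ⊢
      exact neg_eq_iff_eq_neg.1 h

open Classical in
/-- The signed sum of the elements of the column group. -/
def antisymmetrizer (lam : YoungDiagram) : Module.End ℂ (MvPolynomial (Cell lam) ℂ) :=
  ∑ σ ∈ {σ | σ ∈ colGroup lam}, (Equiv.Perm.sign σ : ℂ) • permAction lam σ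

theorem antisymmetrizer_apply_spechtPoly (lam : YoungDiagram) :
    ∃ c : ℂ, c ≠ 0 ∧ antisymmetrizer lam (spechtPoly lam) = c • spechtPoly lam := by
  classical
  refine ⟨#{σ | σ ∈ colGroup lam}, ?_, ?_⟩
  · rw [Nat.cast_ne_zero, ← Nat.pos_iff_ne_zero, card_pos]
    exact ⟨1, by simp⟩
  · rw [antisymmetrizer, LinearMap.sum_apply, Nat.cast_smul_eq_nsmul, ← sum_const]
    refine sum_congr (by congr) fun σ hσ => ?_
    rw [LinearMap.smul_apply, permAction_colGroup (by simpa using hσ), smul_smul]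
    rcases Int.units_eq_one_or (Equiv.Perm.sign σ) with h1 | h1 <;> simp [h1]

theorem permAction_swap_antisymmetrizer {a b : Cell lam} (hab : a ≠ b) (hcol : a.1.2 = b.1.2)
    (p : MvPolynomial (Cell lam) ℂ) :
    permAction lam (Equiv.swap a b) (antisymmetrizer lam p) = - antisymmetrizer lam p := by
  classical
  have hs : Equiv.swap a b ∈ colGroup lam := Subgroup.subset_closure ⟨a, b, hab, hcol, rfl⟩
  rw [antisymmetrizer, LinearMap.sum_apply, map_sum, ← sum_neg_distrib]
  refine sum_bij (fun σ _ => Equiv.swap a b * σ) ?_ ?_ ?_ ?_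
  · intro σ hσ
    simpa using mul_mem hs (by simpa using hσ)
  · intro _ _ _ _ h
    exact mul_left_cancel h
  · intro σ hσ
    refine ⟨Equiv.swap a b * σ, by simpa using mul_mem hs (by simpa using hσ), ?_⟩
    simp [← mul_assoc]
  · intro σ _
    simp only [LinearMap.smul_apply, map_smul, permAction_mul, Equiv.Perm.sign_mul,
      Equiv.Perm.sign_swap hab]
    simp

/-- In the quotient by the ideal of `X a - X b` the two variables coincide, so replacing one by the
other changes nothing. -/
theorem X_sub_X_dvd_sub {A : Type*} [DecidableEq A] (a b : A) (q : MvPolynomial A ℂ) :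
    (MvPolynomial.X a - MvPolynomial.X b) ∣
      q - MvPolynomial.aeval (fun c => MvPolynomial.X (if c = a then b else c)) q := by
  rw [← Ideal.mem_span_singleton, ← Ideal.Quotient.mk_eq_mk_iff_sub_mem]
  set I := Ideal.span {(MvPolynomial.X a - MvPolynomial.X b : MvPolynomial A ℂ)}
  have : Ideal.Quotient.mkₐ ℂ I = (Ideal.Quotient.mkₐ ℂ I).comp
      (MvPolynomial.aeval (fun c => MvPolynomial.X (if c = a then b else c))) := by
    refine MvPolynomial.algHom_ext fun c => ?_
    simp only [AlgHom.comp_apply, MvPolynomial.aeval_X, Ideal.Quotient.mkₐ_eq_mk]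
    split_ifs with h
    · subst h
      rw [Ideal.Quotient.mk_eq_mk_iff_sub_mem]
      exact Ideal.mem_span_singleton_self _
    · rfl
  exact congrArg (fun φ => φ q) this

/-- The substitution of `X b` for `X a` does not see the transposition, so it takes the same value
on `q` and `-q` and therefore kills `q`. -/
theorem X_sub_X_dvd_of_antisymm {A : Type*} [DecidableEq A] (a b : A) (q : MvPolynomial A ℂ)
    (hq : MvPolynomial.rename (Equiv.swap a b) q = - q) :
    (MvPolynomial.X a - MvPolynomial.X b) ∣ q := by
  have h := X_sub_X_dvd_sub a b q
  have h2 : MvPolynomial.aeval (fun c => MvPolynomial.X (R := ℂ) (if c = a then b else c))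
      (MvPolynomial.rename (Equiv.swap a b) q) =
      MvPolynomial.aeval (fun c => MvPolynomial.X (R := ℂ) (if c = a then b else c)) q := by
    rw [MvPolynomial.aeval_rename]
    congr 2
    ext1 c
    simp only [Function.comp]
    congr 1
    by_cases h1 : c = a
    · rw [h1, Equiv.swap_apply_left, if_pos rfl, ite_eq_right_iff.2 fun _ => rfl]
    · by_cases h2 : c = b
      · rw [h2, Equiv.swap_apply_right, if_pos rfl, ite_eq_right_iff.2 fun _ => rfl]
      · rw [Equiv.swap_apply_of_ne_of_ne h1 h2]
  rw [hq, map_neg] at h2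
  rwa [self_eq_neg.1 h2.symm, sub_zero] at h

theorem irreducible_X_sub_X {A : Type*} {a b : A} (h : a ≠ b) :
    Irreducible (MvPolynomial.X a - MvPolynomial.X b : MvPolynomial A ℂ) := by
  classical
  have hc : MvPolynomial.coeff (Finsupp.single a 1)
      (MvPolynomial.X a - MvPolynomial.X b : MvPolynomial A ℂ) = 1 := by
    rw [MvPolynomial.coeff_sub, MvPolynomial.coeff_X, MvPolynomial.coeff_X, if_pos rfl, if_neg,
      sub_zero]
    rw [Finsupp.single_left_inj one_ne_zero]
    exact h.symm
  refine MvPolynomial.irreducible_of_totalDegree_eq_one ?_ fun x hx => ?_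
  · have hh : (MvPolynomial.X a - MvPolynomial.X b : MvPolynomial A ℂ).IsHomogeneous 1 :=
      (MvPolynomial.isHomogeneous_X _ _).sub (MvPolynomial.isHomogeneous_X _ _)
    exact hh.totalDegree (X_sub_X_ne_zero h)
  · have := hx (Finsupp.single a 1)
    rw [hc] at this
    exact isUnit_of_dvd_one this

theorem spechtPoly_dvd (q : MvPolynomial (Cell lam) ℂ)
    (hq : ∀ a b : Cell lam, a ≠ b → a.1.2 = b.1.2 → permAction lam (Equiv.swap a b) q = - q) :
    spechtPoly lam ∣ q := by
  rw [spechtPoly_eq, prodDiff]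
  have hne : ∀ p ∈ colPairs lam, p.1 ≠ p.2 := by
    intro p hp h
    simp only [colPairs, mem_filter, mem_univ, true_and, h] at hp
    omega
  refine prod_dvd_of_isRelPrime ?_ ?_
  · rintro ⟨a, b⟩ hp ⟨c, d⟩ hp' hne'
    have hab := hne _ hp
    have hcd := hne _ hp'
    refine ((irreducible_X_sub_X hab).isRelPrime_iff_not_dvd).2 ?_
    -- If `X a - X b` divided `X c - X d`, putting `X a = X b` would kill the latter, forcing `{c,
    -- d} = {a, b}`. The pairs being distinct, only the reversed one remains, and it is not listed
    -- from top to bottom.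
    rintro ⟨q, h⟩
    have h' := congrArg (MvPolynomial.aeval
      (fun x => MvPolynomial.X (R := ℂ) (if x = a then b else x))) h
    simp only [map_sub, map_mul, MvPolynomial.aeval_X, if_true, if_neg hab.symm, sub_self,
      zero_mul] at h'
    have h3 := MvPolynomial.X_injective (sub_eq_zero.1 h')
    have := colPairs_asymm a b hp
    simp only at hcd hab
    split_ifs at h3 <;> simp_all
  · intro p hp
    refine X_sub_X_dvd_of_antisymm _ _ _ (hq _ _ (hne p hp) ?_)
    simp only [colPairs, mem_filter, mem_univ, true_and] at hp
    exact hp.1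

theorem spechtPoly_isHomogeneous (lam : YoungDiagram) :
    (spechtPoly lam).IsHomogeneous #(colPairs lam) := by
  rw [spechtPoly_eq, prodDiff, card_eq_sum_ones]
  exact MvPolynomial.IsHomogeneous.prod _ _ _ fun p _ =>
    (MvPolynomial.isHomogeneous_X _ _).sub (MvPolynomial.isHomogeneous_X _ _)

theorem spechtModule_le (lam : YoungDiagram) :
    spechtModule lam ≤ MvPolynomial.homogeneousSubmodule (Cell lam) ℂ #(colPairs lam) := by
  rw [spechtModule, Submodule.span_le]
  rintro _ ⟨σ, rfl⟩
  exact (spechtPoly_isHomogeneous lam).rename_isHomogeneous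

/-- The image is antisymmetric within each column, hence divisible by the Specht polynomial, and it
is homogeneous of the same degree: the quotient is a constant. -/
theorem antisymmetrizer_mem_span {p : MvPolynomial (Cell lam) ℂ} (hp : p ∈ spechtModule lam) :
    ∃ c : ℂ, antisymmetrizer lam p = c • spechtPoly lam := by
  classical
  have hh : (antisymmetrizer lam p).IsHomogeneous #(colPairs lam) := by
    rw [← MvPolynomial.mem_homogeneousSubmodule, antisymmetrizer, LinearMap.sum_apply]
    refine sum_mem fun σ _ => ?_
    rw [LinearMap.smul_apply]
    refine Submodule.smul_mem _ _ ?_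
    exact (show p.IsHomogeneous _ from spechtModule_le lam hp).rename_isHomogeneous
  obtain ⟨q, hq⟩ := spechtPoly_dvd (antisymmetrizer lam p)
    fun a b hab hcol => permAction_swap_antisymmetrizer hab hcol p
  by_cases h0 : antisymmetrizer lam p = 0
  · exact ⟨0, by simpa using h0⟩
  · have hq0 : q ≠ 0 := by rintro rfl; exact h0 (by simpa using hq)
    have h1 := hh.totalDegree h0
    rw [hq, MvPolynomial.totalDegree_mul_of_isDomain (spechtPoly_ne_zero lam) hq0,
      (spechtPoly_isHomogeneous lam).totalDegree (spechtPoly_ne_zero lam)] at h1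
    have h2 := MvPolynomial.totalDegree_eq_zero_iff_eq_C.1 (by omega : q.totalDegree = 0)
    refine ⟨q.coeff 0, ?_⟩
    rw [hq, h2, mul_comm, MvPolynomial.C_mul', MvPolynomial.coeff_C, if_pos rfl]

/-! ### Transport of permutations along embeddings -/

/-- The permutation of `B` that extends a permutation of `A` along an embedding of `A` into `B`. -/
def push {A B : Type*} (ι : A ↪ B) : Equiv.Perm A →* Equiv.Perm B := Equiv.Perm.viaEmbeddingHom ι

section push

variable {A B C : Type*}

theorem push_apply (ι : A ↪ B) (σ : Equiv.Perm A) (x : A) : push ι σ (ι x) = ι (σ x) :=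
  Equiv.Perm.viaEmbedding_apply σ ι x

theorem push_apply_of_notMem (ι : A ↪ B) (σ : Equiv.Perm A) (x : B) (hx : ∀ y, ι y ≠ x) :
    push ι σ x = x :=
  Equiv.Perm.viaEmbedding_apply_of_notMem σ ι x fun ⟨y, hy⟩ => hx y hy

theorem eq_push {ι : A ↪ B} {σ : Equiv.Perm A} {τ : Equiv.Perm B}
    (h1 : ∀ x, τ (ι x) = ι (σ x)) (h2 : ∀ x, (∀ y, ι y ≠ x) → τ x = x) : τ = push ι σ := by
  ext x
  by_cases hx : ∃ y, ι y = x
  · obtain ⟨y, rfl⟩ := hx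
    rw [h1, push_apply]
  · push Not at hx
    rw [h2 x hx, push_apply_of_notMem _ _ _ hx]

theorem push_push (ι : A ↪ B) (κ : B ↪ C) (σ : Equiv.Perm A) :
    push κ (push ι σ) = push (ι.trans κ) σ := by
  refine eq_push (fun x => ?_) fun x hx => ?_
  · simp only [Function.Embedding.trans_apply, push_apply]
  · by_cases h : ∃ y, κ y = x
    · obtain ⟨y, rfl⟩ := h
      rw [push_apply, push_apply_of_notMem]
      rintro z rfl
      exact hx z rfl
    · push Not at h
      exact push_apply_of_notMem _ _ _ h

theorem push_refl (σ : Equiv.Perm A) : push (Function.Embedding.refl A) σ = σ :=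
  (eq_push (fun _ => rfl) fun x hx => absurd rfl (hx x)).symm

theorem push_symm_push (e : A ≃ B) (σ : Equiv.Perm A) :
    push e.symm.toEmbedding (push e.toEmbedding σ) = σ := by
  rw [push_push]
  convert push_refl σ
  ext x
  simp

theorem push_push_symm (e : A ≃ B) (σ : Equiv.Perm B) :
    push e.toEmbedding (push e.symm.toEmbedding σ) = σ := push_symm_push e.symm σ

theorem conj_push (ι : A ↪ B) (σ : Equiv.Perm A) (τ : Equiv.Perm B) :
    τ * push ι σ * τ⁻¹ = push (ι.trans τ.toEmbedding) σ := by
  refine eq_push (fun x => ?_) fun x hx => ?_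
  · simp [push_apply]
  · simp only [Equiv.Perm.mul_apply]
    rw [push_apply_of_notMem]
    · simp
    · rintro y hy
      refine hx y ?_
      simp [hy]

theorem push_swap [DecidableEq A] [DecidableEq B] (ι : A ↪ B) (a b : A) :
    push ι (Equiv.swap a b) = Equiv.swap (ι a) (ι b) := by
  refine (eq_push (fun x => ?_) fun x hx => ?_).symm
  · rw [Function.Injective.swap_apply ι.injective]
  · exact Equiv.swap_apply_of_ne_of_ne (hx a).symm (hx b).symm

variable [Fintype A] [DecidableEq A] [Fintype B] [DecidableEq B]

theorem cycleType_push (ι : A ↪ B) (σ : Equiv.Perm A) :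
    (push ι σ).cycleType = σ.cycleType := by
  classical
  rw [push, Equiv.Perm.viaEmbeddingHom_apply, Equiv.Perm.viaEmbedding]
  convert Equiv.Perm.cycleType_extendDomain (Equiv.ofInjective ι.1 ι.2)

theorem card_support_push (ι : A ↪ B) (σ : Equiv.Perm A) :
    #(push ι σ).support = #σ.support := by
  rw [← Equiv.Perm.sum_cycleType, cycleType_push, Equiv.Perm.sum_cycleType]

theorem parts_push (ι : A ↪ B) (σ : Equiv.Perm A) :
    (push ι σ).partition.parts =
      σ.partition.parts + Multiset.replicate (Fintype.card B - Fintype.card A) 1 := by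
  rw [Equiv.Perm.parts_partition, Equiv.Perm.parts_partition, cycleType_push, card_support_push,
    add_assoc, ← Multiset.replicate_add]
  congr 2
  have h1 := Fintype.card_le_of_embedding ι
  have h2 : #σ.support ≤ Fintype.card A := card_le_univ _
  omega

end push

/-! ### The irreducible representations -/

section Rep

variable {lam : YoungDiagram} {A : Type*}

/-- The irreducible representation of label `lam` of the group of permutations of a set that is
identified with the set of cells of `lam`. -/
def spechtRep (e : Cell lam ≃ A) : Representation ℂ (Equiv.Perm A) (spechtModule lam) where
  toFun σ := (permAction lam (push e.symm.toEmbedding σ)).restrict (permAction_mem lam _)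
  map_one' := by
    ext1 x
    apply Subtype.ext
    simp [permAction_one]
  map_mul' σ τ := by
    ext1 x
    apply Subtype.ext
    simp [permAction_mul]

theorem coe_spechtRep (e : Cell lam ≃ A) (σ : Equiv.Perm A) (x : spechtModule lam) :
    (spechtRep e σ x : MvPolynomial (Cell lam) ℂ) = permAction lam (push e.symm.toEmbedding σ) x :=
  rfl

/-- The generator of the irreducible module. -/
def spechtVec (lam : YoungDiagram) : spechtModule lam :=
  ⟨spechtPoly lam, Submodule.subset_span ⟨1, permAction_one _⟩⟩

theorem spechtVec_ne_zero : spechtVec lam ≠ 0 := fun h =>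
  spechtPoly_ne_zero lam (congrArg Subtype.val h)

instance : FiniteDimensional ℂ (spechtModule lam) :=
  FiniteDimensional.span_of_finite ℂ (Set.finite_range _)

theorem dimension_ne_zero : (dimension lam : ℂ) ≠ 0 := by
  have : Nontrivial (spechtModule lam) := ⟨⟨spechtVec lam, 0, spechtVec_ne_zero⟩⟩
  exact_mod_cast (Module.finrank_pos (R := ℂ) (M := spechtModule lam)).ne'

theorem span_spechtRep (e : Cell lam ≃ A) :
    Submodule.span ℂ (Set.range fun σ => spechtRep e σ (spechtVec lam)) = ⊤ := by
  rw [eq_top_iff]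
  rintro ⟨x, hx⟩ -
  have : (spechtModule lam).subtype ⟨x, hx⟩ ∈ (Submodule.span ℂ (Set.range fun σ =>
      spechtRep e σ (spechtVec lam))).map (spechtModule lam).subtype := by
    rw [Submodule.map_span, ← Set.range_comp]
    refine Submodule.span_mono ?_ hx
    rintro _ ⟨σ, rfl⟩
    refine ⟨push e.toEmbedding σ, ?_⟩
    simp only [Function.comp, Submodule.subtype_apply, coe_spechtRep, push_symm_push]
    rfl
  obtain ⟨y, hy, hxy⟩ := this
  rwa [← (spechtModule lam).injective_subtype hxy]

theorem ext_of_spechtVec (e : Cell lam ≃ A) {M : Type*} [AddCommGroup M] [Module ℂ M]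
    {S T : spechtModule lam →ₗ[ℂ] M}
    (h : ∀ σ, S (spechtRep e σ (spechtVec lam)) = T (spechtRep e σ (spechtVec lam))) : S = T :=
  LinearMap.ext_on_range (span_spechtRep e) h

theorem eq_smul_one_of_apply_spechtVec (e : Cell lam ≃ A) {T : Module.End ℂ (spechtModule lam)}
    (hT : ∀ σ x, T (spechtRep e σ x) = spechtRep e σ (T x)) {c : ℂ}
    (hc : T (spechtVec lam) = c • spechtVec lam) : T = c • 1 := by
  refine ext_of_spechtVec e fun σ => ?_
  rw [hT, hc, map_smul]
  rfl

/-- Schur's lemma, without irreducibility as an input. `T` commutes with the antisymmetrizer, which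
scales the Specht polynomial by a nonzero constant and maps the module into the line it spans. So
the generator is an eigenvector of `T`, and cyclicity does the rest. -/
theorem exists_eq_smul_one (e : Cell lam ≃ A) {T : Module.End ℂ (spechtModule lam)}
    (hT : ∀ σ x, T (spechtRep e σ x) = spechtRep e σ (T x)) : ∃ c : ℂ, T = c • 1 := by
  classical
  have hT' : ∀ (σ : Equiv.Perm (Cell lam)) x, T ((permAction lam σ).restrict (permAction_mem lam σ) x)
      = (permAction lam σ).restrict (permAction_mem lam σ) (T x) := by
    intro σ x
    have := hT (push e.toEmbedding σ) x
    rw [spechtRep] at this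
    simp only [MonoidHom.coe_mk, OneHom.coe_mk, push_symm_push] at this
    exact this
  obtain ⟨d, hd, hd'⟩ := antisymmetrizer_apply_spechtPoly lam
  obtain ⟨c, hc⟩ := antisymmetrizer_mem_span (T (spechtVec lam)).2
  let κ : Module.End ℂ (spechtModule lam) := ∑ σ ∈ {σ | σ ∈ colGroup lam},
    (Equiv.Perm.sign σ : ℂ) • (permAction lam σ).restrict (permAction_mem lam σ)
  have hκ : ∀ x, (κ x : MvPolynomial (Cell lam) ℂ) = antisymmetrizer lam x := by
    intro x
    simp only [κ, antisymmetrizer, LinearMap.sum_apply, LinearMap.smul_apply,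
      AddSubmonoidClass.coe_finsetSum, Submodule.coe_smul, LinearMap.coe_restrict_apply]
  have hκT : κ (T (spechtVec lam)) = T (κ (spechtVec lam)) := by
    simp only [κ, LinearMap.sum_apply, LinearMap.smul_apply, map_sum, map_smul, hT']
  have h1 : κ (spechtVec lam) = d • spechtVec lam := Subtype.ext ((hκ _).trans hd')
  have h2 : κ (T (spechtVec lam)) = c • spechtVec lam := Subtype.ext ((hκ _).trans hc)
  refine ⟨d⁻¹ * c, eq_smul_one_of_apply_spechtVec e hT ?_⟩
  rw [h1, h2, map_smul] at hκT
  rw [mul_smul, hκT, smul_smul, inv_mul_cancel₀ hd, one_smul]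

/-! ### Normalized characters -/

/-- The normalized irreducible character of label `lam` of the group of permutations of a set that is
identified with the set of cells of `lam`. -/
def charN (e : Cell lam ≃ A) (σ : Equiv.Perm A) : ℂ :=
  (spechtRep e).character σ / dimension lam

theorem charN_conj (e : Cell lam ≃ A) (σ τ : Equiv.Perm A) :
    charN e (τ * σ * τ⁻¹) = charN e σ := by
  rw [charN, Representation.char_conj, charN]

theorem charN_eq_of_cycleType [Fintype A] [DecidableEq A] (e : Cell lam ≃ A) {σ τ : Equiv.Perm A}
    (h : σ.cycleType = τ.cycleType) : charN e σ = charN e τ := by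
  obtain ⟨π, rfl⟩ := isConj_iff.1 (Equiv.Perm.isConj_iff_cycleType_eq.2 h)
  rw [charN_conj]

theorem trace_smul_one (c : ℂ) :
    LinearMap.trace ℂ (spechtModule lam) (c • 1) / dimension lam = c := by
  rw [map_smul, LinearMap.trace_one, smul_eq_mul]
  exact mul_div_cancel_right₀ c dimension_ne_zero

theorem sum_charN {X : Type*} (e : Cell lam ≃ A) (s : Finset X) (w : X → ℂ) (Φ : X → Equiv.Perm A) :
    ∑ x ∈ s, w x * charN e (Φ x) =
      LinearMap.trace ℂ (spechtModule lam) (∑ x ∈ s, w x • spechtRep e (Φ x)) / dimension lam := by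
  rw [map_sum, sum_div]
  refine sum_congr rfl fun x _ => ?_
  rw [map_smul, smul_eq_mul, mul_div_assoc]
  rfl

/-- A linear combination of permutations that commutes with the group acts as a scalar. -/
theorem sum_spechtRep_eq {X : Type*} (e : Cell lam ≃ A) (s : Finset X) (w : X → ℂ)
    (Φ : X → Equiv.Perm A)
    (h : ∀ σ, spechtRep e σ * (∑ x ∈ s, w x • spechtRep e (Φ x)) =
      (∑ x ∈ s, w x • spechtRep e (Φ x)) * spechtRep e σ) :
    ∑ x ∈ s, w x • spechtRep e (Φ x) = (∑ x ∈ s, w x * charN e (Φ x)) • 1 := by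
  obtain ⟨c, hc⟩ := exists_eq_smul_one e (T := ∑ x ∈ s, w x • spechtRep e (Φ x))
    fun σ x => (LinearMap.congr_fun (h σ) x).symm
  rw [sum_charN, hc, trace_smul_one]

theorem charN_one (e : Cell lam ≃ A) : charN e 1 = 1 := by
  have := trace_smul_one (lam := lam) 1
  rwa [one_smul, ← map_one (spechtRep e)] at this

variable [Fintype A] [DecidableEq A] {K : Type*} [Fintype K]

theorem map_coe_eq (μ : Multiset ℕ+) : (μ.map (fun k => (k : ℕ))) = μ.map PNat.val := by
  simp

theorem size_eq (μ : Multiset ℕ+) : size μ = (μ.map PNat.val).sum := by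
  rw [size, map_coe_eq]

/-- Makes `chi` independent of the permutation picked by choice and of the numbering of the cells:
characters depend on the cycle type only, which transport preserves. -/
theorem chi_eq (e : Cell lam ≃ A) (σ : Equiv.Perm A) (ρ : Multiset ℕ+)
    (h : σ.partition.parts = ρ.map PNat.val) : chi lam ρ = charN e σ := by
  classical
  have key : ∀ τ : Equiv.Perm (Cell lam), τ.partition.parts = ρ.map PNat.val →
      zeta lam τ / dimension lam = charN e σ := by
    intro τ hτ
    have h1 : zeta lam τ / dimension lam = charN e (push e.toEmbedding τ) := by
      rw [charN, Representation.character, spechtRep]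
      simp only [MonoidHom.coe_mk, OneHom.coe_mk, push_symm_push]
      rfl
    rw [h1]
    refine charN_eq_of_cycleType e ?_
    rw [cycleType_push, ← Equiv.Perm.filter_parts_partition_eq_cycleType,
      ← Equiv.Perm.filter_parts_partition_eq_cycleType, hτ, h]
  have hex : ∃ τ : Equiv.Perm (Cell lam), τ.partition.parts = ρ.map PNat.val := by
    refine ⟨push e.symm.toEmbedding σ, ?_⟩
    rw [parts_push, Fintype.card_congr e, Nat.sub_self, Multiset.replicate_zero, add_zero, h]
  simp only [chi, map_coe_eq]
  rw [dif_pos hex]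
  exact key _ hex.choose_spec

theorem card_cell (lam : YoungDiagram) : Fintype.card (Cell lam) = lam.card :=
  Fintype.card_coe _

theorem size_eq_card [DecidableEq K] {g : Equiv.Perm K} {μ : Multiset ℕ+}
    (hg : g.partition.parts = μ.map PNat.val) : size μ = Fintype.card K := by
  rw [size_eq, ← hg, g.partition.parts_sum]

/-- The falling factorial counts the embeddings, and all transported permutations share one cycle
type. When the diagram is too small there is no embedding, in agreement with the convention `Σ_μ =
0`. -/
theorem symbol_eq [DecidableEq K] (e : Cell lam ≃ A) (g : Equiv.Perm K) (μ : Multiset ℕ+)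
    (hg : g.partition.parts = μ.map PNat.val) :
    symbol μ lam = ∑ a : K ↪ A, charN e (push a g) := by
  have hA : Fintype.card A = lam.card := by rw [← card_cell, Fintype.card_congr e]
  rw [symbol, size_eq_card hg, ← hA]
  split_ifs with h
  · have h1 : ∀ a : K ↪ A, charN e (push a g) =
        chi lam (μ + Multiset.replicate (Fintype.card A - Fintype.card K) 1) := by
      intro a
      rw [chi_eq e (push a g)]
      rw [parts_push, hg, Multiset.map_add, Multiset.map_replicate]
      rfl
    simp only [h1, sum_const, card_univ, nsmul_eq_mul, Fintype.card_embedding_eq]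
  · have : IsEmpty (K ↪ A) := by
      by_contra h'
      rw [not_isEmpty_iff] at h'
      exact h (Fintype.card_le_of_embedding h'.some)
    simp

/-- Conjugation permutes the embeddings, so the sum is central and acts as a scalar, which the
normalized trace identifies. This turns products of symbols into products of operators. -/
theorem sum_spechtRep_push [DecidableEq K] (e : Cell lam ≃ A) (g : Equiv.Perm K) (μ : Multiset ℕ+)
    (hg : g.partition.parts = μ.map PNat.val) :
    ∑ a : K ↪ A, spechtRep e (push a g) = symbol μ lam • 1 := by
  have h := sum_spechtRep_eq e univ (fun _ => 1) (fun a : K ↪ A => push a g) ?_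
  · simpa only [one_smul, one_mul, ← symbol_eq e g μ hg] using h
  · intro σ
    simp only [one_smul]
    rw [mul_sum, sum_mul]
    refine Fintype.sum_equiv (Equiv.embeddingCongr (Equiv.refl K) σ) _ _ fun a => ?_
    rw [← map_mul, ← map_mul]
    congr 1
    have := conj_push a g σ
    rw [mul_inv_eq_iff_eq_mul] at this
    rw [this]
    congr 2

/-- Every partition is the cycle type of a permutation. -/
theorem exists_perm_parts (μ : Multiset ℕ+) :
    ∃ g : Equiv.Perm (Fin (size μ)), g.partition.parts = μ.map PNat.val := by
  classical
  let m := μ.map PNat.val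
  have hle : (m.filter (2 ≤ ·)).sum ≤ m.sum := by
    conv_rhs => rw [← Multiset.filter_add_not (2 ≤ ·) m, Multiset.sum_add]
    exact Nat.le_add_right _ _
  obtain ⟨g, hg⟩ := (Equiv.Perm.exists_with_cycleType_iff (Fin (size μ))
    (m := m.filter (2 ≤ ·))).2 ⟨by rw [Fintype.card_fin, size_eq]; exact hle, fun a ha => by
      simpa using (Multiset.mem_filter.1 ha).2⟩
  refine ⟨g, ?_⟩
  rw [Equiv.Perm.parts_partition, ← Equiv.Perm.sum_cycleType, hg, Fintype.card_fin]
  have h1 : m.filter (fun a => ¬ 2 ≤ a) = Multiset.replicate (size μ - (m.filter (2 ≤ ·)).sum) 1 := by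
    have h2 : ∀ a ∈ m.filter (fun a => ¬ 2 ≤ a), a = 1 := by
      intro a ha
      obtain ⟨h3, h4⟩ := Multiset.mem_filter.1 ha
      obtain ⟨k, -, rfl⟩ := Multiset.mem_map.1 h3
      have := k.pos
      omega
    rw [Multiset.eq_replicate]
    refine ⟨?_, h2⟩
    have h5 : (m.filter (2 ≤ ·)).sum + (m.filter (fun a => ¬ 2 ≤ a)).sum = m.sum := by
      rw [← Multiset.sum_add, Multiset.filter_add_not]
    rw [Multiset.eq_replicate_of_mem h2, Multiset.sum_replicate, smul_eq_mul, mul_one] at h5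
    rw [size_eq]
    change _ = m.sum - _
    omega
  rw [← h1, Multiset.filter_add_not]

end Rep

/-! ### Jucys-Murphy elements -/

section JucysMurphy

variable {E : Type*} [Ring E]

/-- The image of a Jucys-Murphy element by a representation. -/
def jucysMurphy {A : Type*} [LinearOrder A] [Fintype A] (ρ : Equiv.Perm A →* E) (x : A) : E :=
  ∑ j with j < x, ρ (Equiv.swap j x)

section LinearOrder

variable {A : Type*} [LinearOrder A] [Fintype A] (ρ : Equiv.Perm A →* E)

omit [Fintype A] in
theorem map_mul_swap (σ : Equiv.Perm A) (a b : A) :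
    ρ σ * ρ (Equiv.swap a b) = ρ (Equiv.swap (σ a) (σ b)) * ρ σ := by
  rw [← map_mul, ← map_mul, Equiv.mul_swap_eq_swap_mul]

/-- Conjugation by `σ` permutes the transpositions of which the Jucys-Murphy element is the sum. -/
theorem commute_jucysMurphy (σ : Equiv.Perm A) (x : A) (hx : σ x = x) (h : ∀ j, j < x → σ j < x) :
    ρ σ * jucysMurphy ρ x = jucysMurphy ρ x * ρ σ := by
  rw [jucysMurphy, mul_sum, sum_mul]
  have hinj : Set.InjOn σ ({j | j < x} : Finset A) := σ.injective.injOn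
  have himg : ({j | j < x} : Finset A).image σ = ({j | j < x} : Finset A) := by
    refine eq_of_subset_of_card_le ?_ (card_image_of_injective _ σ.injective).ge
    intro j hj
    obtain ⟨i, hi, rfl⟩ := mem_image.1 hj
    simpa using h i (by simpa using hi)
  conv_rhs => rw [← himg, sum_image hinj]
  refine sum_congr rfl fun j _ => ?_
  rw [map_mul_swap, hx]

theorem jucysMurphy_commute {x y : A} (hxy : x < y) :
    jucysMurphy ρ x * jucysMurphy ρ y = jucysMurphy ρ y * jucysMurphy ρ x := by
  conv_lhs => rw [jucysMurphy, sum_mul]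
  conv_rhs => arg 2; rw [jucysMurphy]
  rw [mul_sum]
  refine sum_congr rfl fun j hj => ?_
  have hj : j < x := by simpa using hj
  refine commute_jucysMurphy ρ _ _
    (Equiv.swap_apply_of_ne_of_ne (hj.trans hxy).ne' hxy.ne') fun i hi => ?_
  rw [Equiv.swap_apply_def]
  split_ifs
  · exact hxy
  · exact hj.trans hxy
  · exact hi

variable {a b : A} (hab : a ⋖ b)
include hab

theorem swap_mul_jucysMurphy_left :
    ρ (Equiv.swap a b) * jucysMurphy ρ a = jucysMurphy ρ b * ρ (Equiv.swap a b) - 1 := by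
  have h1 : ({j | j < b} : Finset A) = insert a ({j | j < a} : Finset A) := by
    ext j
    simp only [mem_filter, mem_univ, true_and, mem_insert]
    constructor
    · intro h
      rcases lt_trichotomy j a with h' | h' | h'
      · exact Or.inr h'
      · exact Or.inl h'
      · exact absurd h (hab.2 h')
    · rintro (rfl | h)
      · exact hab.1
      · exact h.trans hab.1
  conv_rhs => rw [jucysMurphy, h1, sum_insert (by simp), add_mul, ← map_mul, Equiv.swap_mul_self,
    map_one, add_sub_cancel_left, sum_mul]
  rw [jucysMurphy, mul_sum]
  refine sum_congr rfl fun j hj => ?_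
  have hj : j < a := by simpa using hj
  rw [map_mul_swap, Equiv.swap_apply_left,
    Equiv.swap_apply_of_ne_of_ne hj.ne (hj.trans hab.1).ne]

theorem swap_mul_jucysMurphy_right :
    ρ (Equiv.swap a b) * jucysMurphy ρ b = jucysMurphy ρ a * ρ (Equiv.swap a b) + 1 := by
  have h := swap_mul_jucysMurphy_left ρ hab
  set S := ρ (Equiv.swap a b) with hS
  have hSS : S * S = 1 := by rw [hS, ← map_mul, Equiv.swap_mul_self, map_one]
  have h2 : jucysMurphy ρ a * S = S * jucysMurphy ρ b - 1 := by
    calc jucysMurphy ρ a * S = (S * S) * jucysMurphy ρ a * S := by rw [hSS, one_mul]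
      _ = S * (S * jucysMurphy ρ a) * S := by noncomm_ring
      _ = S * jucysMurphy ρ b * (S * S) - S * S := by rw [h]; noncomm_ring
      _ = _ := by rw [hSS, mul_one]
  rw [h2, sub_add_cancel]

/-- The elementary symmetric functions `x + y` and `x * y` of the two commuting elements commute
with the transposition, by the two exchange relations, and Newton's recursion expresses `x ^ k + y ^
k` through them. -/
theorem swap_commute_pow_add_pow (k : ℕ) :
    ρ (Equiv.swap a b) * (jucysMurphy ρ a ^ k + jucysMurphy ρ b ^ k) =
      (jucysMurphy ρ a ^ k + jucysMurphy ρ b ^ k) * ρ (Equiv.swap a b) := by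
  have h1 := swap_mul_jucysMurphy_left ρ hab
  have h2 := swap_mul_jucysMurphy_right ρ hab
  have h3 := jucysMurphy_commute ρ hab.1
  set S := ρ (Equiv.swap a b)
  set x := jucysMurphy ρ a
  set y := jucysMurphy ρ b
  have hu : S * (x + y) = (x + y) * S := by
    rw [mul_add, h1, h2]; noncomm_ring
  have hw : S * (x * y) = (x * y) * S := by
    calc S * (x * y) = (S * x) * y := by noncomm_ring
      _ = y * (S * y) - y := by rw [h1]; noncomm_ring
      _ = (y * x) * S := by rw [h2]; noncomm_ring
      _ = _ := by rw [h3]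
  have hrec : ∀ k, x ^ (k + 2) + y ^ (k + 2) =
      (x + y) * (x ^ (k + 1) + y ^ (k + 1)) - (x * y) * (x ^ k + y ^ k) := by
    intro k
    have e1 : x * y ^ (k + 1) = x * y * y ^ k := by rw [pow_succ', mul_assoc]
    have e2 : y * x ^ (k + 1) = x * y * x ^ k := by rw [pow_succ', ← mul_assoc, h3]
    rw [mul_add, add_mul, add_mul, e1, e2, pow_succ' x (k + 1), pow_succ' y (k + 1)]
    noncomm_ring
  induction k using Nat.twoStepInduction with
  | zero => noncomm_ring
  | one => simpa using hu
  | more k ih1 ih2 =>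
    rw [hrec, mul_sub, sub_mul, ← mul_assoc S, ← mul_assoc S, hu, hw, mul_assoc _ S, mul_assoc _ S,
      ih1, ih2]
    noncomm_ring

theorem swap_commute_sum_pow (k : ℕ) :
    ρ (Equiv.swap a b) * ∑ x, jucysMurphy ρ x ^ k =
      (∑ x, jucysMurphy ρ x ^ k) * ρ (Equiv.swap a b) := by
  have hne : b ∈ univ.erase a := by simp [hab.1.ne']
  rw [← add_sum_erase univ _ (mem_univ a), ← add_sum_erase _ _ hne, ← add_assoc, mul_add, add_mul,
    swap_commute_pow_add_pow ρ hab]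
  congr 1
  rw [mul_sum, sum_mul]
  refine sum_congr rfl fun x hx => ?_
  simp only [mem_erase, mem_univ, and_true] at hx
  refine Commute.pow_right ?_ k
  refine commute_jucysMurphy ρ _ _ (Equiv.swap_apply_of_ne_of_ne hx.2 hx.1) fun j hj => ?_
  rw [Equiv.swap_apply_def]
  split_ifs with h1 h2
  · subst h1
    exact lt_of_le_of_ne (hab.ge_of_gt hj) (Ne.symm hx.1)
  · subst h2
    exact hab.1.trans hj
  · exact hj

end LinearOrder

theorem commute_sum_jucysMurphy_pow {n : ℕ} (ρ : Equiv.Perm (Fin n) →* E) (k : ℕ)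
    (σ : Equiv.Perm (Fin n)) :
    ρ σ * ∑ x, jucysMurphy ρ x ^ k = (∑ x, jucysMurphy ρ x ^ k) * ρ σ := by
  cases n with
  | zero => rw [Subsingleton.elim σ 1, map_one, one_mul, mul_one]
  | succ n =>
    have hσ : σ ∈ Submonoid.closure (Set.range fun i : Fin n => Equiv.swap i.castSucc i.succ) := by
      rw [Equiv.Perm.mclosure_swap_castSucc_succ]; trivial
    induction hσ using Submonoid.closure_induction with
    | mem σ h =>
      obtain ⟨i, rfl⟩ := h
      exact swap_commute_sum_pow ρ (Fin.covBy_iff.2 (by simp)) k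
    | one => rw [map_one, one_mul, mul_one]
    | mul σ τ _ _ hσ hτ => rw [map_mul, mul_assoc, hτ, ← mul_assoc, hσ, mul_assoc]

theorem sum_pow_eq_sum_ofFn {A : Type*} [DecidableEq A] (s : Finset A) (f : A → E) (k : ℕ) :
    (∑ j ∈ s, f j) ^ k =
      ∑ w ∈ Fintype.piFinset fun _ : Fin k => s, (List.ofFn fun i => f (w i)).prod := by
  induction k with
  | zero => simp
  | succ k ih =>
    rw [pow_succ', ih, sum_mul_sum, ← sum_product']
    refine sum_bij' (fun p _ => Fin.cons p.1 p.2) (fun w _ => (w 0, Fin.tail w)) ?_ ?_ ?_ ?_ ?_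
    · rintro ⟨x, w⟩ h
      simp only [mem_product, Fintype.mem_piFinset] at h ⊢
      exact Fin.cases h.1 h.2
    · intro w h
      simp only [mem_product, Fintype.mem_piFinset] at h ⊢
      exact ⟨h 0, fun i => h i.succ⟩
    · rintro ⟨x, w⟩ _
      simp
    · intro w _
      exact Fin.cons_self_tail w
    · rintro ⟨x, w⟩ _
      simp [List.ofFn_succ]

end JucysMurphy

/-! ### Power sums of contents -/

variable {lam : YoungDiagram}

/-- The content of a cell. -/
def content (c : ℕ × ℕ) : ℂ := (c.2 : ℂ) - (c.1 : ℂ)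

/-- The reading of the cells column by column, from left to right and from top to bottom. -/
theorem exists_column_reading (lam : YoungDiagram) :
    ∃ e : Cell lam ≃ Fin lam.card, ∀ a b, e a < e b ↔
      (a.1.2 < b.1.2 ∨ a.1.2 = b.1.2 ∧ a.1.1 < b.1.1) := by
  have hinj : Function.Injective fun c : Cell lam => toLex (c.1.2, c.1.1) := by
    intro a b h
    have h' := Prod.mk.inj (toLex.injective h)
    exact cell_ext h'.2 h'.1
  let s : Finset (ℕ ×ₗ ℕ) := univ.image fun c : Cell lam => toLex (c.1.2, c.1.1)
  have hs : #s = lam.card := by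
    rw [card_image_of_injective _ hinj, card_univ, card_cell]
  let f : Cell lam → s := fun c => ⟨toLex (c.1.2, c.1.1), mem_image_of_mem _ (mem_univ c)⟩
  have hf : Function.Bijective f := by
    refine ⟨fun a b h => hinj (congrArg Subtype.val h), ?_⟩
    rintro ⟨x, hx⟩
    obtain ⟨c, -, rfl⟩ := mem_image.1 hx
    exact ⟨c, rfl⟩
  refine ⟨(Equiv.ofBijective f hf).trans (s.orderIsoOfFin hs).symm.toEquiv, fun a b => ?_⟩
  refine Iff.trans ((s.orderIsoOfFin hs).symm.lt_iff_lt (x := f a) (y := f b)) ?_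
  exact Prod.Lex.lt_iff

theorem card_above (b : Cell lam) :
    #{a : Cell lam | a.1.2 = b.1.2 ∧ a.1.1 < b.1.1} = b.1.1 := by
  conv_rhs => rw [← card_range b.1.1]
  refine card_bij (fun a _ => a.1.1) ?_ ?_ ?_
  · intro a ha
    simp only [mem_filter, mem_univ, true_and] at ha
    simpa using ha.2
  · intro a ha a' ha' h
    simp only [mem_filter, mem_univ, true_and] at ha ha'
    exact cell_ext h (ha.1.trans ha'.1.symm)
  · intro i hi
    rw [mem_range] at hi
    have hb : (b.1.1, b.1.2) ∈ lam := b.2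
    exact ⟨⟨(i, b.1.2), lam.up_left_mem hi.le le_rfl hb⟩, by simpa using hi, rfl⟩

/-- Each column to the left of `b` contributes `+1` by the Garnir relation, and each cell above `b`
in its own column contributes `-1` by antisymmetry. -/
theorem sum_swap_spechtPoly (b : Cell lam) :
    ∑ a : Cell lam with a.1.2 < b.1.2 ∨ a.1.2 = b.1.2 ∧ a.1.1 < b.1.1,
      permAction lam (Equiv.swap a b) (spechtPoly lam) = content b • spechtPoly lam := by
  rw [filter_or, sum_union, content, sub_smul, sub_eq_add_neg]
  · congr 1
    · rw [← sum_fiberwise_of_maps_to (t := range b.1.2) (g := fun a => a.1.2) (by simp)]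
      rw [sum_congr rfl (g := fun _ => spechtPoly lam), sum_const, card_range, Nat.cast_smul_eq_nsmul]
      intro j hj
      rw [mem_range] at hj
      rw [filter_filter]
      refine Eq.trans (sum_congr ?_ fun _ _ => rfl) (garnir b j hj)
      ext a
      simp only [mem_filter, mem_univ, true_and]
      omega
    · rw [sum_congr rfl (g := fun _ => - spechtPoly lam), sum_const, card_above, smul_neg,
        Nat.cast_smul_eq_nsmul]
      intro a ha
      simp only [mem_filter, mem_univ, true_and] at ha
      refine permAction_swap_of_col_eq ?_ ha.1
      rintro rfl
      omega
  · rw [disjoint_left]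
    intro a h h'
    simp only [mem_filter, mem_univ, true_and] at h h'
    omega

theorem jucysMurphy_spechtVec (e : Cell lam ≃ Fin lam.card)
    (he : ∀ a b, e a < e b ↔ (a.1.2 < b.1.2 ∨ a.1.2 = b.1.2 ∧ a.1.1 < b.1.1)) (b : Cell lam) :
    jucysMurphy (E := Module.End ℂ (spechtModule lam)) (spechtRep e) (e b) (spechtVec lam) =
      content b • spechtVec lam := by
  apply Subtype.ext
  rw [jucysMurphy, LinearMap.sum_apply, AddSubmonoidClass.coe_finsetSum, Submodule.coe_smul]
  refine Eq.trans ?_ (sum_swap_spechtPoly b)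
  symm
  refine sum_bij (fun a _ => e a) ?_ (fun _ _ _ _ h => e.injective h) ?_ ?_
  · intro a ha
    simpa [he] using ha
  · intro j hj
    refine ⟨e.symm j, ?_, by simp⟩
    simp only [mem_filter, mem_univ, true_and] at hj ⊢
    rw [← he]
    simpa using hj
  · intro a _
    rw [coe_spechtRep, push_swap]
    simp [spechtVec]

theorem jucysMurphy_pow_spechtVec (e : Cell lam ≃ Fin lam.card)
    (he : ∀ a b, e a < e b ↔ (a.1.2 < b.1.2 ∨ a.1.2 = b.1.2 ∧ a.1.1 < b.1.1)) (b : Cell lam) (k : ℕ) :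
    (jucysMurphy (E := Module.End ℂ (spechtModule lam)) (spechtRep e) (e b) ^ k) (spechtVec lam) =
      content b ^ k • spechtVec lam := by
  induction k with
  | zero => simp
  | succ k ih =>
    rw [pow_succ, Module.End.mul_apply, jucysMurphy_spechtVec e he, map_smul, ih, smul_smul,
      pow_succ']

/-- The operator commutes with the group, so its value on the generator determines it, and the
generator is a common eigenvector of the Jucys-Murphy elements. -/
theorem sum_jucysMurphy_pow_eq (e : Cell lam ≃ Fin lam.card)
    (he : ∀ a b, e a < e b ↔ (a.1.2 < b.1.2 ∨ a.1.2 = b.1.2 ∧ a.1.1 < b.1.1)) (k : ℕ) :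
    ∑ x, jucysMurphy (E := Module.End ℂ (spechtModule lam)) (spechtRep e) x ^ k =
      (∑ c ∈ lam.cells, content c ^ k) • 1 := by
  refine eq_smul_one_of_apply_spechtVec e (fun σ x => ?_) ?_
  · have h := commute_sum_jucysMurphy_pow (E := Module.End ℂ (spechtModule lam)) (spechtRep e) k σ
    generalize ∑ x, jucysMurphy (E := Module.End ℂ (spechtModule lam)) (spechtRep e) x ^ k = T at h ⊢
    exact (LinearMap.congr_fun h x).symm
  · have h2 := e.sum_comp fun x =>
      (jucysMurphy (E := Module.End ℂ (spechtModule lam)) (spechtRep e) x ^ k) (spechtVec lam)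
    have h3 := sum_congr (s₁ := univ) rfl fun b _ => jucysMurphy_pow_spechtVec e he b k
    rw [LinearMap.sum_apply, ← h2, h3, sum_smul]
    exact sum_coe_sort lam.cells (fun c => content c ^ k • spechtVec lam)

/-- The product of the transpositions `(y i, y none)`. -/
def starWord {A : Type*} [DecidableEq A] {k : ℕ} (y : Option (Fin k) → A) : Equiv.Perm A :=
  (List.ofFn fun i => Equiv.swap (y (some i)) (y none)).prod

theorem push_starWord {A B : Type*} [DecidableEq A] [DecidableEq B] {k : ℕ} (ι : A ↪ B)
    (y : Option (Fin k) → A) : push ι (starWord y) = starWord (ι ∘ y) := by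
  rw [starWord, starWord, map_list_prod, List.map_ofFn]
  congr 2
  ext1 i
  simp [push_swap]

theorem contentSum_eq (e : Cell lam ≃ Fin lam.card)
    (he : ∀ a b, e a < e b ↔ (a.1.2 < b.1.2 ∨ a.1.2 = b.1.2 ∧ a.1.1 < b.1.1)) (k : ℕ) :
    ∑ c ∈ lam.cells, content c ^ k =
      ∑ y : Option (Fin k) → Fin lam.card with ∀ i, y (some i) < y none, charN e (starWord y) := by
  have h1 : ∑ x, jucysMurphy (E := Module.End ℂ (spechtModule lam)) (spechtRep e) x ^ k =
      ∑ y : Option (Fin k) → Fin lam.card with ∀ i, y (some i) < y none,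
        (1 : ℂ) • spechtRep e (starWord y) := by
    simp_rw [jucysMurphy, sum_pow_eq_sum_ofFn]
    rw [sum_sigma']
    refine sum_bij' (fun p _ o => o.elim p.1 p.2) (fun y _ => ⟨y none, fun i => y (some i)⟩)
      ?_ ?_ ?_ ?_ ?_
    · rintro ⟨x, w⟩ h
      simpa [Fintype.mem_piFinset] using h
    · intro y h
      simpa [Fintype.mem_piFinset] using h
    · rintro ⟨x, w⟩ _
      rfl
    · intro y _
      funext o
      cases o <;> rfl
    · rintro ⟨x, w⟩ _
      rw [one_smul, starWord, map_list_prod, List.map_ofFn]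
      rfl
  have h2 := sum_charN e {y : Option (Fin k) → Fin lam.card | ∀ i, y (some i) < y none}
    (fun _ => 1) starWord
  rw [← h1, sum_jucysMurphy_pow_eq e he, trace_smul_one] at h2
  simpa using h2.symm

/-! ### Averaging over the orders -/

/-- For a random order, each element of `R` is equally likely to be the largest one of `R`, and
exactly one of them is. -/
theorem card_perm_max {n : ℕ} (R : Finset (Fin n)) (x : Fin n) (hx : x ∈ R) :
    #{π : Equiv.Perm (Fin n) | ∀ r ∈ R, r ≠ x → π r < π x} * #R = n.factorial := by
  have h1 : ∀ y ∈ R, #{π : Equiv.Perm (Fin n) | ∀ r ∈ R, r ≠ y → π r < π y} =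
      #{π : Equiv.Perm (Fin n) | ∀ r ∈ R, r ≠ x → π r < π x} := by
    intro y hy
    have hsw : ∀ r ∈ R, Equiv.swap x y r ∈ R := by
      intro r hr
      rw [Equiv.swap_apply_def]
      split_ifs <;> assumption
    refine card_bij' (fun π _ => π * Equiv.swap x y) (fun π _ => π * Equiv.swap x y) ?_ ?_ ?_ ?_
    · intro π hπ
      simp only [mem_filter, mem_univ, true_and, Equiv.Perm.mul_apply, Equiv.swap_apply_left] at hπ ⊢
      intro r hr hrx
      refine hπ _ (hsw r hr) fun h => hrx ?_
      rw [← Equiv.swap_apply_self x y r, h, Equiv.swap_apply_right]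
    · intro π hπ
      simp only [mem_filter, mem_univ, true_and, Equiv.Perm.mul_apply, Equiv.swap_apply_right] at hπ ⊢
      intro r hr hrx
      refine hπ _ (hsw r hr) fun h => hrx ?_
      rw [← Equiv.swap_apply_self x y r, h, Equiv.swap_apply_left]
    · intro π _
      simp [mul_assoc]
    · intro π _
      simp [mul_assoc]
  have h2 : ∑ y ∈ R, #{π : Equiv.Perm (Fin n) | ∀ r ∈ R, r ≠ y → π r < π y} = n.factorial := by
    refine Eq.trans (sum_card_bipartiteAbove_eq_sum_card_bipartiteBelow
      (r := fun y (π : Equiv.Perm (Fin n)) => ∀ r ∈ R, r ≠ y → π r < π y) (t := univ)) ?_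
    rw [sum_congr rfl (g := fun _ => 1)]
    · simp [Fintype.card_perm]
    · intro π _
      rw [card_eq_one]
      obtain ⟨m, hm, hmax⟩ := exists_max_image R π ⟨x, hx⟩
      refine ⟨m, ?_⟩
      ext y
      simp only [mem_filter, mem_singleton, bipartiteBelow]
      constructor
      · rintro ⟨hy, h⟩
        by_contra hne
        exact absurd (hmax y hy) (not_le.2 (h m hm (Ne.symm hne)))
      · rintro rfl
        exact ⟨hm, fun r hr hne => lt_of_le_of_ne (hmax r hr) (π.injective.ne hne)⟩
  rw [sum_congr rfl h1, sum_const, smul_eq_mul, mul_comm] at h2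
  exact h2

/-- The sum over the tuples whose last entry is the largest one, of a function that is invariant by
permutation, as a sum over all tuples. -/
theorem sum_lt_eq_sum_ne {n k : ℕ} (φ : (Option (Fin k) → Fin n) → ℂ)
    (hφ : ∀ (π : Equiv.Perm (Fin n)) y, φ (π ∘ y) = φ y) :
    ∑ y : Option (Fin k) → Fin n with ∀ i, y (some i) < y none, φ y =
      ∑ y : Option (Fin k) → Fin n,
        (if ∀ i, y (some i) ≠ y none then (#(univ.image y) : ℂ)⁻¹ else 0) * φ y := by
  have hn : (n.factorial : ℂ) ≠ 0 := by exact_mod_cast n.factorial_ne_zero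
  refine mul_left_cancel₀ hn ?_
  have h1 : ∀ π : Equiv.Perm (Fin n),
      ∑ y : Option (Fin k) → Fin n with ∀ i, y (some i) < y none, φ y =
        ∑ y : Option (Fin k) → Fin n, if ∀ i, π (y (some i)) < π (y none) then φ y else 0 := by
    intro π
    rw [sum_filter]
    symm
    refine Fintype.sum_equiv (Equiv.arrowCongr (Equiv.refl _) π) _ _ fun y => ?_
    have h3 : Equiv.arrowCongr (Equiv.refl _) π y = π ∘ y := by ext; simp
    rw [h3, hφ]
    rfl
  have h2 : (n.factorial : ℂ) * ∑ y : Option (Fin k) → Fin n with ∀ i, y (some i) < y none, φ y =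
      ∑ π : Equiv.Perm (Fin n), ∑ y : Option (Fin k) → Fin n with ∀ i, y (some i) < y none, φ y := by
    rw [sum_const, card_univ, Fintype.card_perm, Fintype.card_fin, nsmul_eq_mul]
  rw [h2, sum_congr rfl fun π _ => h1 π, sum_comm, mul_sum]
  refine sum_congr rfl fun y _ => ?_
  rw [← sum_filter, sum_const, nsmul_eq_mul, ← mul_assoc]
  congr 1
  -- The tuple `y` is counted once for each `π` that places `y none` above all other entries: there
  -- are `n! / #(image of y)` of them if `y none` differs from the other entries, and none
  -- otherwise.
  split_ifs with hy
  · have hcard : (#(univ.image y) : ℂ) ≠ 0 := by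
      rw [Nat.cast_ne_zero, ← Nat.pos_iff_ne_zero, card_pos]
      exact ⟨y none, by simp⟩
    rw [eq_mul_inv_iff_mul_eq₀ hcard, ← card_perm_max (univ.image y) (y none) (by simp)]
    push_cast
    congr 3
    ext π
    simp only [mem_filter, mem_univ, true_and, mem_image, forall_exists_index,
      forall_apply_eq_imp_iff]
    constructor
    · rintro h (_ | i) hne
      · exact absurd rfl hne
      · exact h i
    · exact fun h i => h (some i) (hy i)
  · push Not at hy
    obtain ⟨i, hi⟩ := hy
    rw [mul_zero, Nat.cast_eq_zero, card_eq_zero, filter_eq_empty_iff]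
    intro π _ h
    exact absurd (h i) (by rw [hi]; exact lt_irrefl _)

theorem contentSum_eq' (lam : YoungDiagram) : ∃ e : Cell lam ≃ Fin lam.card, ∀ k : ℕ,
    ∑ c ∈ lam.cells, content c ^ k =
      ∑ y : Option (Fin k) → Fin lam.card,
        (if ∀ i, y (some i) ≠ y none then (#(univ.image y) : ℂ)⁻¹ else 0) *
          charN e (starWord y) := by
  obtain ⟨e, he⟩ := exists_column_reading lam
  refine ⟨e, fun k => ?_⟩
  rw [contentSum_eq e he, sum_lt_eq_sum_ne]
  intro π y
  rw [show π ∘ y = (Function.Embedding.refl _).trans π.toEmbedding ∘ y from rfl, ← push_starWord,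
    ← conj_push, charN_conj, push_refl]

/-! ### The filtration of the observables by the size of the symbols -/

/-- The span of the symbols `Σ_μ` with `|μ| ≤ d`. -/
def symbolSpan (d : ℕ) : Submodule ℂ (YoungDiagram → ℂ) :=
  Submodule.span ℂ {F | ∃ μ, size μ ≤ d ∧ F = symbol μ}

theorem symbol_mem (μ : Multiset ℕ+) : symbol μ ∈ symbolSpan (size μ) :=
  Submodule.subset_span ⟨μ, le_rfl, rfl⟩

theorem symbolSpan_mono {a b : ℕ} (h : a ≤ b) : symbolSpan a ≤ symbolSpan b :=
  Submodule.span_mono fun _ ⟨μ, h1, h2⟩ => ⟨μ, h1.trans h, h2⟩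

theorem exists_parts {K : Type*} [Fintype K] [DecidableEq K] (g : Equiv.Perm K) :
    ∃ μ : Multiset ℕ+, g.partition.parts = μ.map PNat.val := by
  have h : ∀ i ∈ g.partition.parts, 0 < i := fun i hi => g.partition.parts_pos hi
  obtain ⟨μ, hμ⟩ := CanLift.prf (β := Multiset ℕ+) g.partition.parts h
  exact ⟨μ, hμ.symm⟩

instance {K : Type*} [Finite K] : Finite (Setoid K) :=
  Finite.of_injective (fun r : Setoid K => (r.r : K → K → Prop)) fun _ _ h =>
    Setoid.ext fun a b => iff_of_eq (congrFun (congrFun h a) b)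

/-- A map is an embedding of the quotient by its kernel. -/
theorem bijective_quotient_embedding (K B : Type*) :
    Function.Bijective fun p : (Σ r : Setoid K, Quotient r ↪ B) => p.2 ∘ Quotient.mk p.1 := by
  constructor
  · rintro ⟨r, ι⟩ ⟨s, κ⟩ h
    have h' : ∀ x, ι (Quotient.mk r x) = κ (Quotient.mk s x) := congrFun h
    have hrs : r = s := by
      refine Setoid.ext fun a b => ?_
      rw [← Quotient.eq (r := r), ← Quotient.eq (r := s), ← ι.injective.eq_iff, ← κ.injective.eq_iff,
        h', h']
    subst hrs
    congr 1
    ext x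
    induction x using Quotient.inductionOn with
    | h x => exact h' x
  · intro y
    refine ⟨⟨Setoid.ker y, ⟨Setoid.kerLift y, Setoid.kerLift_injective y⟩⟩, ?_⟩
    rfl

/-- A sum of normalized characters over all the tuples of indices in a natural way is a combination
of symbols. -/
theorem mem_symbolSpan_of_natural {K : Type} [Fintype K] [DecidableEq K] (F : YoungDiagram → ℂ)
    (w : ∀ n, (K → Fin n) → ℂ) (Φ : ∀ n, (K → Fin n) → Equiv.Perm (Fin n))
    (hF : ∀ lam : YoungDiagram, ∃ e : Cell lam ≃ Fin lam.card,
      F lam = ∑ y, w _ y * charN e (Φ _ y))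
    (c : Setoid K → ℂ) (g : ∀ r : Setoid K, Equiv.Perm (Quotient r))
    (hw : ∀ (r : Setoid K) (n : ℕ) (ι : Quotient r ↪ Fin n), w n (ι ∘ Quotient.mk r) = c r)
    (hΦ : ∀ (r : Setoid K) (n : ℕ) (ι : Quotient r ↪ Fin n), Φ n (ι ∘ Quotient.mk r) = push ι (g r)) :
    F ∈ symbolSpan (Fintype.card K) := by
  classical
  have := Fintype.ofFinite (Setoid K)
  choose μ hμ using fun r : Setoid K => exists_parts (g r)
  have hsize : ∀ r, size (μ r) ≤ Fintype.card K := by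
    intro r
    rw [size_eq_card (hμ r)]
    exact Fintype.card_quotient_le r
  have hFe : F = ∑ r, c r • symbol (μ r) := by
    funext lam
    obtain ⟨e, he⟩ := hF lam
    rw [he, ← (bijective_quotient_embedding K (Fin lam.card)).sum_comp, Fintype.sum_sigma,
      Finset.sum_apply]
    refine sum_congr rfl fun r _ => ?_
    rw [Pi.smul_apply, smul_eq_mul, symbol_eq e (g r) (μ r) (hμ r), mul_sum]
    refine sum_congr rfl fun ι _ => ?_
    rw [hw, hΦ]
  rw [hFe]
  exact sum_mem fun r _ => Submodule.smul_mem _ _ (symbolSpan_mono (hsize r) (symbol_mem _))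

theorem contentSum_mem (k : ℕ) :
    (fun lam : YoungDiagram => ∑ c ∈ lam.cells, content c ^ k) ∈ symbolSpan (k + 1) := by
  classical
  have h := mem_symbolSpan_of_natural (K := Option (Fin k))
    (fun lam : YoungDiagram => ∑ c ∈ lam.cells, content c ^ k)
    (fun n y => if ∀ i, y (some i) ≠ y none then (#(univ.image y) : ℂ)⁻¹ else 0)
    (fun n y => starWord y)
    (fun lam => by
      obtain ⟨e, he⟩ := contentSum_eq' lam
      exact ⟨e, he k⟩)
    (fun r => if ∀ i : Fin k, Quotient.mk r (some i) ≠ Quotient.mk r none then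
      (#(univ.image (Quotient.mk r)) : ℂ)⁻¹ else 0)
    (fun r => starWord (Quotient.mk r)) ?_ ?_
  · simpa using h
  · intro r n ι
    simp only [Function.comp_apply, ne_eq, ι.injective.eq_iff]
    rw [← image_image, card_image_of_injective _ ι.injective]
  · intro r n ι
    rw [push_starWord]

/-- The permutation of `B` that extends a permutation of `A` along an injective map (the identity if
the map is not injective). -/
def pushFun {A B : Type*} (y : A → B) (σ : Equiv.Perm A) : Equiv.Perm B :=
  open Classical in if h : Function.Injective y then push ⟨y, h⟩ σ else 1

theorem push_pushFun {A B C : Type*} (ι : B ↪ C) (y : A → B) (σ : Equiv.Perm A) :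
    push ι (pushFun y σ) = pushFun (ι ∘ y) σ := by
  unfold pushFun
  by_cases h : Function.Injective y
  · rw [dif_pos h, dif_pos (ι.injective.comp h), push_push]
    rfl
  · rw [dif_neg h, dif_neg, map_one]
    exact fun h' => h h'.of_comp

open Classical in
theorem sum_embedding_eq {A B : Type*} [Fintype A] [DecidableEq A] [Fintype B] (f : (A → B) → ℂ) :
    ∑ ι : A ↪ B, f ι = ∑ y : A → B, if Function.Injective y then f y else 0 := by
  rw [← sum_filter, ← sum_subtype_eq_sum_filter, subtype_univ]
  exact (Fintype.sum_equiv (Equiv.subtypeInjectiveEquivEmbedding A B) _ _ fun _ => rfl).symm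

theorem symbol_mul_symbol {lam : YoungDiagram} {A : Type*} [Fintype A] [DecidableEq A]
    (e : Cell lam ≃ A) {K L : Type*} [Fintype K] [DecidableEq K] [Fintype L] [DecidableEq L]
    (g : Equiv.Perm K) (h : Equiv.Perm L)
    (μ ν : Multiset ℕ+) (hg : g.partition.parts = μ.map PNat.val)
    (hh : h.partition.parts = ν.map PNat.val) :
    symbol μ lam * symbol ν lam = ∑ a : K ↪ A, ∑ b : L ↪ A, charN e (push a g * push b h) := by
  have h1 := congrArg₂ (· * ·) (sum_spechtRep_push e g μ hg) (sum_spechtRep_push e h ν hh)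
  simp only [smul_mul_smul_comm, one_mul] at h1
  have h2 := trace_smul_one (lam := lam) (symbol μ lam * symbol ν lam)
  rw [← h1, sum_mul_sum, ← sum_product'] at h2
  have h3 := sum_charN e univ (fun _ => 1) (fun p : (K ↪ A) × (L ↪ A) => push p.1 g * push p.2 h)
  simp only [one_smul, map_mul, one_mul, univ_product_univ] at h2 h3
  rw [← h2, ← h3, Fintype.sum_prod_type]

/-- A pair of embeddings is a tuple on the disjoint union of the two sources that is injective on
each half; its kernel records the coincidences between the halves, which can only reduce the size.
-/
theorem symbol_mul_symbol_mem (μ ν : Multiset ℕ+) :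
    symbol μ * symbol ν ∈ symbolSpan (size μ + size ν) := by
  classical
  obtain ⟨g, hg⟩ := exists_perm_parts μ
  obtain ⟨h, hh⟩ := exists_perm_parts ν
  have := mem_symbolSpan_of_natural (K := Fin (size μ) ⊕ Fin (size ν)) (symbol μ * symbol ν)
    (fun n y => if Function.Injective (y ∘ Sum.inl) ∧ Function.Injective (y ∘ Sum.inr) then 1 else 0)
    (fun n y => pushFun (y ∘ Sum.inl) g * pushFun (y ∘ Sum.inr) h) ?_
    (fun r => if Function.Injective (Quotient.mk r ∘ Sum.inl) ∧
      Function.Injective (Quotient.mk r ∘ Sum.inr) then 1 else 0)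
    (fun r => pushFun (Quotient.mk r ∘ Sum.inl) g * pushFun (Quotient.mk r ∘ Sum.inr) h) ?_ ?_
  · simpa using this
  · intro lam
    obtain ⟨e, -⟩ := contentSum_eq' lam
    refine ⟨e, ?_⟩
    have key := sum_embedding_eq (A := Fin (size μ)) (B := Fin lam.card) fun y =>
      ∑ b : Fin (size ν) ↪ Fin lam.card, charN e (pushFun y g * push b h)
    have h0 : ∀ {K : Type} (a : K ↪ Fin lam.card) (σ : Equiv.Perm K), pushFun a σ = push a σ := by
      intro K a σ
      exact dif_pos a.injective
    rw [Pi.mul_apply, symbol_mul_symbol e g h μ ν hg hh]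
    simp only [h0] at key
    rw [key]
    rw [← (Equiv.sumArrowEquivProdArrow _ _ _).symm.sum_comp, Fintype.sum_prod_type]
    refine sum_congr rfl fun y _ => ?_
    have key2 := sum_embedding_eq (A := Fin (size ν)) (B := Fin lam.card) fun z =>
      charN e (pushFun y g * pushFun z h)
    simp only [h0] at key2
    rw [key2]
    have e1 : ∀ z : Fin (size ν) → Fin lam.card,
        (Equiv.sumArrowEquivProdArrow _ _ _).symm (y, z) ∘ Sum.inl = y := fun _ => rfl
    have e2 : ∀ z : Fin (size ν) → Fin lam.card,
        (Equiv.sumArrowEquivProdArrow _ _ _).symm (y, z) ∘ Sum.inr = z := fun _ => rfl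
    simp only [e1, e2]
    by_cases hy : Function.Injective y
    · simp only [hy, true_and, if_true, ite_mul, one_mul, zero_mul]
      exact sum_congr rfl fun z _ => by congr
    · simp [hy]
  · intro r n ι
    simp only [Function.comp_assoc, ι.injective.of_comp_iff]
  · intro r n ι
    rw [map_mul, push_pushFun, push_pushFun]
    rfl

theorem mul_mem_symbolSpan {a b : ℕ} {F G : YoungDiagram → ℂ} (hF : F ∈ symbolSpan a)
    (hG : G ∈ symbolSpan b) : F * G ∈ symbolSpan (a + b) := by
  have h := Submodule.mul_mem_mul hF hG
  rw [symbolSpan, symbolSpan, Submodule.span_mul_span] at h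
  refine Submodule.span_le.2 ?_ h
  rintro _ ⟨_, ⟨μ, hμ, rfl⟩, _, ⟨ν, hν, rfl⟩, rfl⟩
  exact symbolSpan_mono (by omega) (symbol_mul_symbol_mem μ ν)

theorem symbol_zero : symbol 0 = 1 := by
  funext lam
  obtain ⟨e, -⟩ := contentSum_eq' lam
  rw [symbol_eq (K := Fin 0) e 1 0]
  · simp [charN_one]
  · simp [Equiv.Perm.parts_partition]

theorem one_mem_symbolSpan : (1 : YoungDiagram → ℂ) ∈ symbolSpan 0 := by
  rw [← symbol_zero]
  exact symbol_mem 0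

theorem pow_mem_symbolSpan {a : ℕ} {F : YoungDiagram → ℂ} (hF : F ∈ symbolSpan a) (m : ℕ) :
    F ^ m ∈ symbolSpan (m * a) := by
  induction m with
  | zero => simpa using one_mem_symbolSpan
  | succ m ih =>
    rw [pow_succ, Nat.succ_mul]
    exact mul_mem_symbolSpan ih hF

theorem prod_mem_symbolSpan {ι : Type*} (s : Finset ι) (F : ι → YoungDiagram → ℂ) (a : ι → ℕ)
    (hF : ∀ i ∈ s, F i ∈ symbolSpan (a i)) : ∏ i ∈ s, F i ∈ symbolSpan (∑ i ∈ s, a i) := by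
  classical
  induction s using Finset.induction_on with
  | empty => simpa using one_mem_symbolSpan
  | insert i s hi ih =>
    rw [prod_insert hi, sum_insert hi]
    exact mul_mem_symbolSpan (hF i (mem_insert_self _ _))
      (ih fun j hj => hF j (mem_insert_of_mem hj))

/-! ### Frobenius moments -/

theorem lt_diagLen_iff (lam : YoungDiagram) (i : ℕ) : i < diagLen lam ↔ (i, i) ∈ lam := by
  let S : Finset ℕ := {c ∈ lam.cells | c.1 = c.2}.image Prod.fst
  have hS : ∀ j, j ∈ S ↔ (j, j) ∈ lam := by
    intro j
    simp only [S, mem_image, mem_filter, Prod.exists, YoungDiagram.mem_cells]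
    constructor
    · rintro ⟨a, b, ⟨h, rfl⟩, rfl⟩
      exact h
    · exact fun h => ⟨j, j, ⟨h, rfl⟩, rfl⟩
  have hcard : diagLen lam = #S := by
    rw [diagLen, card_image_of_injOn]
    rintro ⟨a, b⟩ h ⟨a', b'⟩ h' hh
    simp only [coe_filter, Set.mem_ofPred_eq] at h h' hh
    ext <;> simp <;> omega
  have hdown : ∀ j j', j ≤ j' → j' ∈ S → j ∈ S := by
    intro j j' hj h
    rw [hS] at h ⊢
    exact lam.up_left_mem hj hj h
  rw [← hS, hcard]
  constructor
  · intro h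
    by_contra hi
    have : S ⊆ range i := by
      intro j hj
      rw [mem_range]
      by_contra hij
      exact hi (hdown i j (by omega) hj)
    have := card_le_card this
    rw [card_range] at this
    omega
  · intro h
    have : range (i + 1) ⊆ S := by
      intro j hj
      rw [mem_range] at hj
      exact hdown j i (by omega) h
    have := card_le_card this
    rw [card_range] at this
    omega

/-- The sum telescopes along the rows for the cells on or above the diagonal, and along the columns
for those below it. The boundary terms `(-1/2) ^ k` of the two parts cancel. -/
theorem frobeniusMoment_eq (k : ℕ+) (lam : YoungDiagram) :
    frobeniusMoment k lam =
      ∑ c ∈ lam.cells, ((content c + 1 / 2) ^ (k : ℕ) - (content c - 1 / 2) ^ (k : ℕ)) := by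
  rw [← sum_filter_add_sum_filter_not lam.cells (fun c => c.1 ≤ c.2)]
  have h1 : ∑ c ∈ lam.cells with c.1 ≤ c.2,
      ((content c + 1 / 2) ^ (k : ℕ) - (content c - 1 / 2) ^ (k : ℕ)) =
      ∑ i ∈ range (diagLen lam),
        (((lam.rowLen i : ℂ) - (i : ℂ) - 1 / 2) ^ (k : ℕ) - (-1 / 2) ^ (k : ℕ)) := by
    have e1 : ∀ i ∈ range (diagLen lam),
        ((lam.rowLen i : ℂ) - (i : ℂ) - 1 / 2) ^ (k : ℕ) - (-1 / 2) ^ (k : ℕ) =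
        ∑ t ∈ range (lam.rowLen i - i),
          (((t : ℂ) + 1 / 2) ^ (k : ℕ) - ((t : ℂ) - 1 / 2) ^ (k : ℕ)) := by
      intro i hi
      rw [mem_range, lt_diagLen_iff, YoungDiagram.mem_iff_lt_rowLen] at hi
      have := sum_range_sub (fun t : ℕ => ((t : ℂ) - 1 / 2) ^ (k : ℕ)) (lam.rowLen i - i)
      rw [Nat.cast_sub hi.le] at this
      refine Eq.trans ?_ (this.symm.trans ?_)
      · simp [neg_div]
      · refine sum_congr rfl fun t _ => ?_
        push_cast
        ring
    rw [sum_congr rfl e1, sum_sigma']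
    symm
    refine sum_bij (fun p _ => (p.1, p.1 + p.2)) ?_ ?_ ?_ ?_
    · rintro ⟨i, t⟩ h
      simp only [mem_sigma, mem_range, mem_filter, YoungDiagram.mem_cells] at h ⊢
      rw [YoungDiagram.mem_iff_lt_rowLen]
      omega
    · rintro ⟨i, t⟩ _ ⟨i', t'⟩ _ h
      simp only [Prod.mk.injEq] at h
      obtain ⟨rfl, h⟩ := h
      have : t = t' := by omega
      subst this; rfl
    · rintro ⟨i, j⟩ h
      simp only [mem_filter, YoungDiagram.mem_cells] at h
      refine ⟨⟨i, j - i⟩, ?_, ?_⟩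
      · simp only [mem_sigma, mem_range]
        rw [lt_diagLen_iff]
        have := YoungDiagram.mem_iff_lt_rowLen.1 h.1
        exact ⟨lam.up_left_mem le_rfl h.2 h.1, by omega⟩
      · ext <;> simp; omega
    · rintro ⟨i, t⟩ _
      simp [content]
  have h2 : ∑ c ∈ lam.cells with ¬ c.1 ≤ c.2,
      ((content c + 1 / 2) ^ (k : ℕ) - (content c - 1 / 2) ^ (k : ℕ)) =
      ∑ i ∈ range (diagLen lam), ((-1 / 2) ^ (k : ℕ) +
        (-1) ^ ((k : ℕ) - 1) * ((lam.colLen i : ℂ) - (i : ℂ) - 1 / 2) ^ (k : ℕ)) := by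
    have e1 : ∀ i ∈ range (diagLen lam),
        ((-1 / 2) ^ (k : ℕ) +
          (-1) ^ ((k : ℕ) - 1) * ((lam.colLen i : ℂ) - (i : ℂ) - 1 / 2) ^ (k : ℕ)) =
        ∑ t ∈ range (lam.colLen i - (i + 1)),
          ((-((t : ℂ) + 1) + 1 / 2) ^ (k : ℕ) - (-((t : ℂ) + 1) - 1 / 2) ^ (k : ℕ)) := by
      intro i hi
      rw [mem_range, lt_diagLen_iff, YoungDiagram.mem_iff_lt_colLen] at hi
      have := sum_range_sub (fun t : ℕ => -(-(t : ℂ) - 1 / 2) ^ (k : ℕ)) (lam.colLen i - (i + 1))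
      rw [Nat.cast_sub hi] at this
      refine Eq.trans ?_ (this.symm.trans ?_)
      · have h3 : (-((lam.colLen i : ℂ) - ((i + 1 : ℕ) : ℂ)) - 1 / 2) =
            -((lam.colLen i : ℂ) - (i : ℂ) - 1 / 2) := by
          push_cast; ring
        have h4 : (-1 : ℂ) ^ (k : ℕ) = - (-1) ^ ((k : ℕ) - 1) := by
          obtain ⟨m, hm⟩ := Nat.exists_eq_succ_of_ne_zero k.pos.ne'
          rw [hm, pow_succ]; simp
        rw [h3, neg_pow ((lam.colLen i : ℂ) - (i : ℂ) - 1 / 2), h4]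
        simp only [Nat.cast_zero, neg_zero, zero_sub, neg_div]
        ring
      · refine sum_congr rfl fun t _ => ?_
        push_cast
        ring
    rw [sum_congr rfl e1, sum_sigma']
    symm
    refine sum_bij (fun p _ => (p.1 + 1 + p.2, p.1)) ?_ ?_ ?_ ?_
    · rintro ⟨i, t⟩ h
      simp only [mem_sigma, mem_range, mem_filter, YoungDiagram.mem_cells] at h ⊢
      rw [YoungDiagram.mem_iff_lt_colLen]
      omega
    · rintro ⟨i, t⟩ _ ⟨i', t'⟩ _ h
      simp only [Prod.mk.injEq] at h
      obtain ⟨h, rfl⟩ := h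
      have : t = t' := by omega
      subst this; rfl
    · rintro ⟨i, j⟩ h
      simp only [mem_filter, YoungDiagram.mem_cells, not_le] at h
      refine ⟨⟨j, i - (j + 1)⟩, ?_, ?_⟩
      · simp only [mem_sigma, mem_range]
        rw [lt_diagLen_iff]
        have := YoungDiagram.mem_iff_lt_colLen.1 h.1
        exact ⟨lam.up_left_mem h.2.le le_rfl h.1, by omega⟩
      · ext <;> simp; omega
    · rintro ⟨i, t⟩ _
      simp only [content]
      push_cast
      congr 2 <;> ring
  rw [h1, h2, ← sum_add_distrib, frobeniusMoment, mul_sum, ← sum_add_distrib]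
  refine sum_congr rfl fun i _ => ?_
  ring

/-- In the binomial expansion of the content formula the terms of degree `k` cancel, so only content
sums of exponent `m < k` remain, each in level `m + 1 ≤ k`. -/
theorem frobeniusMoment_mem (k : ℕ+) : frobeniusMoment k ∈ symbolSpan k := by
  have h : frobeniusMoment k = ∑ m ∈ range (k : ℕ),
      (((k : ℕ).choose m : ℂ) * ((1 / 2) ^ ((k : ℕ) - m) - (-(1 / 2)) ^ ((k : ℕ) - m))) •
        fun lam : YoungDiagram => ∑ c ∈ lam.cells, content c ^ m := by
    funext lam
    rw [frobeniusMoment_eq, Finset.sum_apply]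
    simp only [Pi.smul_apply, smul_eq_mul, mul_sum]
    rw [sum_comm]
    refine sum_congr rfl fun c _ => ?_
    rw [sub_eq_add_neg (content c), add_pow, add_pow, ← sum_sub_distrib, sum_range_succ]
    simp only [Nat.sub_self, pow_zero, sub_self, add_zero]
    exact sum_congr rfl fun m _ => by ring
  rw [h]
  refine sum_mem fun m hm => Submodule.smul_mem _ _ ?_
  exact symbolSpan_mono (mem_range.1 hm) (contentSum_mem m)

theorem aeval_frobeniusMoment_mem (F : MvPolynomial ℕ+ ℂ) :
    MvPolynomial.aeval frobeniusMoment F ∈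
      symbolSpan (MvPolynomial.weightedTotalDegree (fun k : ℕ+ => (k : ℕ)) F) := by
  have h : MvPolynomial.aeval frobeniusMoment F = _ :=
    (congrArg (MvPolynomial.aeval frobeniusMoment) F.as_sum).trans (map_sum _ _ _)
  rw [h]
  refine sum_mem fun m hm => ?_
  rw [MvPolynomial.aeval_monomial, ← Algebra.smul_def]
  refine Submodule.smul_mem _ _ (symbolSpan_mono
    (MvPolynomial.le_weightedTotalDegree (fun k : ℕ+ => (k : ℕ)) hm) ?_)
  rw [Finsupp.weight_apply]
  exact prod_mem_symbolSpan _ _ _ fun k _ => pow_mem_symbolSpan (frobeniusMoment_mem k) _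

/-- An observable of degree `d` is a combination of symbols of size at most `d`. -/
theorem mem_symbolSpan_deg {X : YoungDiagram → ℂ} (hX : X ∈ observables) :
    X ∈ symbolSpan (deg X) := by
  rw [observables, Algebra.adjoin_range_eq_range_aeval] at hX
  obtain ⟨F, hF⟩ := hX
  have hne : {d | ∃ F : MvPolynomial ℕ+ ℂ, MvPolynomial.aeval frobeniusMoment F = X ∧
      MvPolynomial.weightedTotalDegree (fun k : ℕ+ => (k : ℕ)) F = d}.Nonempty := ⟨_, F, hF, rfl⟩
  obtain ⟨G, hG, hd⟩ := Nat.sInf_mem hne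
  have := aeval_frobeniusMoment_mem G
  rw [hG, hd] at this
  exact this

/-! ### The contents determine the diagram -/

theorem content_eq_iff (c d : ℕ × ℕ) : content c = content d ↔ c.2 + d.1 = d.2 + c.1 := by
  rw [content, content, sub_eq_sub_iff_add_eq_add]
  norm_cast

theorem sum_eval_content {lam nu : YoungDiagram}
    (h : ∀ k : ℕ, ∑ c ∈ lam.cells, content c ^ k = ∑ c ∈ nu.cells, content c ^ k)
    (Q : Polynomial ℂ) :
    ∑ c ∈ lam.cells, Q.eval (content c) = ∑ c ∈ nu.cells, Q.eval (content c) := by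
  simp only [Polynomial.eval_eq_sum_range]
  rw [sum_comm, sum_comm (s := nu.cells)]
  refine sum_congr rfl fun k _ => ?_
  rw [← mul_sum, ← mul_sum, h]

/-- Power sums determine multiplicities: test against a polynomial that vanishes at all contents of
both diagrams other than `z`. -/
theorem card_content_eq {lam nu : YoungDiagram}
    (h : ∀ k : ℕ, ∑ c ∈ lam.cells, content c ^ k = ∑ c ∈ nu.cells, content c ^ k) (z : ℂ) :
    #{c ∈ lam.cells | content c = z} = #{c ∈ nu.cells | content c = z} := by
  let S : Finset ℂ := ((lam.cells ∪ nu.cells).image content).erase z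
  let Q : Polynomial ℂ := ∏ y ∈ S, (Polynomial.X - Polynomial.C y)
  have hz : Q.eval z ≠ 0 := by
    simp only [Q, Polynomial.eval_prod, Polynomial.eval_sub, Polynomial.eval_X, Polynomial.eval_C]
    rw [prod_ne_zero_iff]
    intro y hy
    exact sub_ne_zero.2 (mem_erase.1 hy).1.symm
  have h0 : ∀ c ∈ lam.cells ∪ nu.cells, content c ≠ z → Q.eval (content c) = 0 := by
    intro c hc hcz
    simp only [Q, Polynomial.eval_prod, Polynomial.eval_sub, Polynomial.eval_X, Polynomial.eval_C]
    exact prod_eq_zero (mem_erase.2 ⟨hcz, mem_image_of_mem _ hc⟩) (sub_self _)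
  have key : ∀ kap : YoungDiagram, kap.cells ⊆ lam.cells ∪ nu.cells →
      ∑ c ∈ kap.cells, Q.eval (content c) = #{c ∈ kap.cells | content c = z} * Q.eval z := by
    intro kap hk
    rw [← sum_filter_add_sum_filter_not kap.cells (fun c => content c = z),
      sum_eq_zero (s := {c ∈ kap.cells | ¬ content c = z}), add_zero, ← nsmul_eq_mul, ← sum_const]
    · exact sum_congr rfl fun c hc => by rw [(mem_filter.1 hc).2]
    · intro c hc
      exact h0 c (hk (mem_filter.1 hc).1) (mem_filter.1 hc).2
  have := sum_eval_content h Q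
  rw [key lam subset_union_left, key nu subset_union_right] at this
  exact_mod_cast mul_right_cancel₀ hz this

/-- On each diagonal a diagram is an initial segment. If `(i, j)` lies in `lam` and not in `nu`,
then the cells of `nu` on that diagonal all precede it, hence lie in `lam`, and `nu` has fewer of
them. -/
theorem le_of_contentSum_eq {lam nu : YoungDiagram}
    (h : ∀ k : ℕ, ∑ c ∈ lam.cells, content c ^ k = ∑ c ∈ nu.cells, content c ^ k) :
    lam.cells ⊆ nu.cells := by
  rintro ⟨i, j⟩ hij
  by_contra hn
  rw [YoungDiagram.mem_cells] at hij hn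
  have hcard := card_content_eq h (content (i, j))
  have hsub : {c ∈ nu.cells | content c = content (i, j)} ⊆
      {c ∈ lam.cells | content c = content (i, j)}.erase (i, j) := by
    rintro ⟨a, b⟩ hc
    simp only [mem_filter, YoungDiagram.mem_cells, content_eq_iff, mem_erase, Prod.mk.injEq,
      ne_eq] at hc ⊢
    have ha : a < i := by
      by_contra ha
      exact hn (nu.up_left_mem (not_lt.1 ha) (by omega) hc.1)
    exact ⟨by omega, lam.up_left_mem ha.le (by omega) hij, hc.2⟩
  have h1 := card_le_card hsub
  have hmem : (i, j) ∈ ({c ∈ lam.cells | content c = content (i, j)} : Finset (ℕ × ℕ)) :=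
    mem_filter.2 ⟨hij, rfl⟩
  have h2 := card_erase_lt_of_mem hmem
  omega

theorem eq_of_contentSum_eq {lam nu : YoungDiagram}
    (h : ∀ k : ℕ, ∑ c ∈ lam.cells, content c ^ k = ∑ c ∈ nu.cells, content c ^ k) : lam = nu :=
  YoungDiagram.ext ((le_of_contentSum_eq h).antisymm (le_of_contentSum_eq fun k => (h k).symm))

/-! ### Orthogonality of characters -/

theorem charN_eq_charN {lam : YoungDiagram} {A : Type*} [Fintype A] [DecidableEq A]
    (e e' : Cell lam ≃ A) (σ : Equiv.Perm A) : charN e σ = charN e' σ := by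
  obtain ⟨μ, hμ⟩ := exists_parts σ
  rw [← chi_eq e σ μ hμ, ← chi_eq e' σ μ hμ]

/-- The point is that `w` does not depend on the diagram: a single element of the group algebra has
all these content sums as eigenvalues, so it can separate non-isomorphic modules. -/
theorem exists_central_eq_contentSum (n k : ℕ) : ∃ w : (Option (Fin k) → Fin n) → ℂ,
    ∀ (lam : YoungDiagram) (e : Cell lam ≃ Fin n),
      ∑ y, w y • spechtRep e (starWord y) = (∑ c ∈ lam.cells, content c ^ k) • 1 := by
  refine ⟨fun y => if ∀ i, y (some i) ≠ y none then (#(univ.image y) : ℂ)⁻¹ else 0,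
    fun lam e => ?_⟩
  have hn : lam.card = n := by rw [← card_cell, Fintype.card_congr e, Fintype.card_fin]
  subst hn
  rw [sum_spechtRep_eq e]
  · obtain ⟨e', he'⟩ := contentSum_eq' lam
    rw [he' k]
    congr 1
    exact sum_congr rfl fun y _ => by rw [charN_eq_charN e e']
  · intro σ
    rw [mul_sum, sum_mul]
    refine Fintype.sum_equiv (Equiv.arrowCongr (Equiv.refl _) σ) _ _ fun y => ?_
    have h1 : Equiv.arrowCongr (Equiv.refl _) σ y = σ.toEmbedding ∘ y := by ext; simp
    have h2 : starWord (σ.toEmbedding ∘ y) = σ * starWord y * σ⁻¹ := by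
      rw [← push_starWord]
      have := conj_push (Function.Embedding.refl _) (starWord y) σ
      rw [push_refl] at this
      rw [this]
      rfl
    rw [h1, h2, mul_smul_comm, smul_mul_assoc, ← map_mul, ← map_mul, inv_mul_cancel_right,
      ← image_image, card_image_of_injective _ σ.toEmbedding.injective]
    simp

theorem finrank_intertwiningMap_self {lam : YoungDiagram} {A : Type*} (e : Cell lam ≃ A) :
    Module.finrank ℂ (Representation.IntertwiningMap (spechtRep e) (spechtRep e)) = 1 := by
  refine finrank_eq_one (Representation.IntertwiningMap.id (spechtRep e)) ?_ fun f => ?_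
  · intro h
    exact spechtVec_ne_zero (lam := lam)
      (congrArg (fun f : Representation.IntertwiningMap (spechtRep e) (spechtRep e) =>
        f (spechtVec lam)) h)
  · obtain ⟨c, hc⟩ := exists_eq_smul_one e (T := f.toLinearMap) fun σ x => f.isIntertwining _ _ σ x
    exact ⟨c, Representation.IntertwiningMap.ext hc.symm⟩

theorem eq_zero_of_smul_eq_smul {V : Type*} [AddCommGroup V] [Module ℂ V] {a b : ℂ} {u : V}
    (hab : a ≠ b) (h : a • u = b • u) : u = 0 := by
  rw [← sub_eq_zero, ← sub_smul, smul_eq_zero, sub_eq_zero] at h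
  exact h.resolve_left hab

/-- Some central element acts by different scalars on the two modules, which forces every
intertwining map to vanish. -/
theorem finrank_intertwiningMap_of_ne {n : ℕ} {lam nu : YoungDiagram} (hne : lam ≠ nu)
    (e : Cell lam ≃ Fin n) (e' : Cell nu ≃ Fin n) :
    Module.finrank ℂ (Representation.IntertwiningMap (spechtRep e) (spechtRep e')) = 0 := by
  obtain ⟨k, hk⟩ : ∃ k : ℕ, ∑ c ∈ lam.cells, content c ^ k ≠ ∑ c ∈ nu.cells, content c ^ k := by
    by_contra h
    push Not at h
    exact hne (eq_of_contentSum_eq h)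
  obtain ⟨w, hw⟩ := exists_central_eq_contentSum n k
  have h0 : ∀ f : Representation.IntertwiningMap (spechtRep e) (spechtRep e'), f = 0 := by
    intro f
    refine Representation.IntertwiningMap.ext (LinearMap.ext fun v => ?_)
    have h1 : f.toLinearMap ((∑ y, w y • spechtRep e (starWord y)) v) =
        (∑ y, w y • spechtRep e' (starWord y)) (f.toLinearMap v) := by
      simp only [LinearMap.sum_apply, map_sum, LinearMap.smul_apply, map_smul]
      exact sum_congr rfl fun y _ => by
        rw [show f.toLinearMap (spechtRep e (starWord y) v) = _ from f.isIntertwining _ _ _ _]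
        rfl
    rw [hw lam e, hw nu e'] at h1
    simp only [LinearMap.smul_apply, Module.End.one_apply, map_smul] at h1
    exact eq_zero_of_smul_eq_smul hk h1
  have : Subsingleton (Representation.IntertwiningMap (spechtRep e) (spechtRep e')) :=
    ⟨fun f g => (h0 f).trans (h0 g).symm⟩
  exact Module.finrank_zero_of_subsingleton

theorem mem_diagrams {n : ℕ} {lam : YoungDiagram} : lam ∈ diagrams n ↔ lam.card = n := by
  simp [diagrams]

/-- A numbering of the cells of a diagram of size `n`. -/
def cellEquiv {n : ℕ} (lam : diagrams n) : Cell lam.1 ≃ Fin n :=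
  Fintype.equivFinOfCardEq (by rw [card_cell]; exact mem_diagrams.1 lam.2)

/-- The irreducible character of label `lam` of the symmetric group of degree `n`. -/
def irrChar {n : ℕ} (lam : diagrams n) : Equiv.Perm (Fin n) → ℂ :=
  (spechtRep (cellEquiv lam)).character

theorem irrChar_eq_of_cycleType {n : ℕ} (lam : diagrams n) {σ τ : Equiv.Perm (Fin n)}
    (h : σ.cycleType = τ.cycleType) : irrChar lam σ = irrChar lam τ := by
  obtain ⟨π, rfl⟩ := isConj_iff.1 (Equiv.Perm.isConj_iff_cycleType_eq.2 h)
  exact (Representation.char_conj _ _ _).symm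

-- No conjugation is needed, since a permutation and its inverse have the same cycle type.
open Classical in
theorem irrChar_orthonormal {n : ℕ} (lam nu : diagrams n) :
    (n.factorial : ℂ)⁻¹ * ∑ g, irrChar lam g * irrChar nu g = if lam = nu then 1 else 0 := by
  have hcard : (Nat.card (Equiv.Perm (Fin n)) : ℂ) = n.factorial := by
    rw [Nat.card_eq_fintype_card, Fintype.card_perm, Fintype.card_fin]
  let _ : Invertible (Nat.card (Equiv.Perm (Fin n)) : ℂ) :=
    invertibleOfNonzero (by rw [hcard]; exact_mod_cast n.factorial_ne_zero)
  have h := Representation.card_inv_mul_sum_char_mul_char_eq_finrank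
    (spechtRep (cellEquiv nu)) (spechtRep (cellEquiv lam))
  rw [hcard] at h
  have h1 : ∀ g, irrChar nu g = (spechtRep (cellEquiv nu)).character g⁻¹ := fun g =>
    irrChar_eq_of_cycleType nu (Equiv.Perm.cycleType_inv g).symm
  simp only [h1]
  refine h.trans ?_
  split_ifs with hln
  · subst hln
    rw [finrank_intertwiningMap_self, Nat.cast_one]
  · rw [finrank_intertwiningMap_of_ne fun h' => hln (Subtype.ext h'.symm), Nat.cast_zero]

/-! ### Completeness of the irreducible characters -/

theorem sum_rowLens (lam : YoungDiagram) : lam.rowLens.sum = lam.card := by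
  have h1 : lam.rowLens.sum = ∑ i ∈ range (lam.colLen 0), lam.rowLen i := by
    rw [YoungDiagram.rowLens, Finset.sum_range, ← List.sum_ofFn, List.ofFn_eq_map,
      ← List.map_coe_finRange_eq_range, List.map_map]
    rfl
  rw [h1, YoungDiagram.card, card_eq_sum_card_fiberwise (f := Prod.fst) (t := range (lam.colLen 0))]
  · exact sum_congr rfl fun i _ => lam.rowLen_eq_card
  · rintro ⟨i, j⟩ h
    have h' : (i, 0) ∈ lam := lam.up_left_mem le_rfl (Nat.zero_le j) h
    simpa using YoungDiagram.mem_iff_lt_colLen.1 h'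

theorem card_diagrams (n : ℕ) : Fintype.card (diagrams n) = Fintype.card n.Partition := by
  refine Fintype.card_of_bijective (f := fun lam : diagrams n =>
    (⟨(lam.1.rowLens : Multiset ℕ), fun h => lam.1.pos_of_mem_rowLens _ h, by
      rw [Multiset.sum_coe, sum_rowLens, mem_diagrams.1 lam.2]⟩ : n.Partition)) ⟨?_, ?_⟩
  · intro lam nu h
    have h1 : (lam.1.rowLens : Multiset ℕ) = nu.1.rowLens := congrArg Nat.Partition.parts h
    have h2 := (Multiset.coe_eq_coe.1 h1).eq_of_sortedGE lam.1.rowLens_sorted nu.1.rowLens_sorted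
    refine Subtype.ext (YoungDiagram.equivListRowLens.injective (Subtype.ext h2))
  · intro p
    have hs : (p.parts.sort (· ≥ ·)).SortedGE := (Multiset.pairwise_sort p.parts (· ≥ ·)).sortedGE
    have hpos : ∀ x ∈ p.parts.sort (· ≥ ·), 0 < x := fun x hx =>
      p.parts_pos ((Multiset.mem_sort (· ≥ ·)).1 hx)
    have hr := YoungDiagram.rowLens_ofRowLens_eq_self (hw := hs) hpos
    have hc : (YoungDiagram.ofRowLens _ hs).card = n := by
      rw [← sum_rowLens, hr, ← Multiset.sum_coe, Multiset.sort_eq, p.parts_sum]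
    refine ⟨⟨YoungDiagram.ofRowLens _ hs, mem_diagrams.2 hc⟩, ?_⟩
    refine Nat.Partition.ext ?_
    simp only [hr, Multiset.sort_eq]

/-- Every class function is a combination of the irreducible characters. -/
theorem sum_irrChar {n : ℕ} (f : Equiv.Perm (Fin n) → ℂ)
    (hf : ∀ σ τ, σ.cycleType = τ.cycleType → f σ = f τ) (τ : Equiv.Perm (Fin n)) :
    ∑ lam : diagrams n, ((n.factorial : ℂ)⁻¹ * ∑ g, irrChar lam g * f g) * irrChar lam τ = f τ := by
  classical
  let P := (Fintype.card (Fin n)).Partition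
  have hcard : Fintype.card (diagrams n) = Fintype.card P := by
    rw [card_diagrams, Fintype.card_congr (Equiv.cast (congrArg Nat.Partition (Fintype.card_fin n)))]
  let val : (Equiv.Perm (Fin n) → ℂ) → P → ℂ := fun h p =>
    if hp : ∃ σ : Equiv.Perm (Fin n), σ.partition = p then h hp.choose else 0
  have hval : ∀ h : Equiv.Perm (Fin n) → ℂ, (∀ σ τ, σ.cycleType = τ.cycleType → h σ = h τ) →
      ∀ σ : Equiv.Perm (Fin n), val h σ.partition = h σ := by
    intro h hh σ
    have hex : ∃ σ' : Equiv.Perm (Fin n), σ'.partition = σ.partition := ⟨σ, rfl⟩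
    simp only [val, dif_pos hex]
    exact hh _ _ (Equiv.Perm.isConj_iff_cycleType_eq.1
      (Equiv.Perm.partition_eq_of_isConj.2 hex.choose_spec))
  have hfib : ∀ (h k : Equiv.Perm (Fin n) → ℂ), (∀ σ τ, σ.cycleType = τ.cycleType → h σ = h τ) →
      ∑ p : P, val h p * ∑ g with g.partition = p, k g = ∑ g, h g * k g := by
    intro h k hh
    rw [← sum_fiberwise univ (fun g : Equiv.Perm (Fin n) => g.partition)]
    refine sum_congr rfl fun p _ => ?_
    rw [mul_sum]
    refine sum_congr rfl fun g hg => ?_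
    rw [← (mem_filter.1 hg).2, hval h hh]
  let M : Matrix (diagrams n) P ℂ := fun lam p => val (irrChar lam) p
  let N : Matrix P (diagrams n) ℂ := fun p lam =>
    (n.factorial : ℂ)⁻¹ * ∑ g with g.partition = p, irrChar lam g
  have hMN : M * N = 1 := by
    ext lam nu
    rw [Matrix.mul_apply, Matrix.one_apply, ← irrChar_orthonormal,
      ← hfib (irrChar lam) (irrChar nu) (fun _ _ => irrChar_eq_of_cycleType lam), mul_sum]
    exact sum_congr rfl fun p _ => by simp only [M, N]; ring
  -- There are as many diagrams as cycle types, so the character table is square; the one-sided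
  -- inverse given by row orthogonality is two-sided, which yields column orthogonality.
  have hNM : N * M = 1 :=
    (Matrix.mul_eq_one_comm_of_equiv (Fintype.equivOfCardEq hcard)).1 hMN
  have h1 : ∀ lam : diagrams n, ((n.factorial : ℂ)⁻¹ * ∑ g, irrChar lam g * f g) * irrChar lam τ =
      ∑ p, val f p * (N p lam * M lam τ.partition) := by
    intro lam
    simp only [mul_comm (irrChar lam _) (f _)]
    rw [← hfib f (irrChar lam) hf, mul_sum, sum_mul]
    refine sum_congr rfl fun p _ => ?_
    simp only [M, N]
    rw [hval _ (fun _ _ => irrChar_eq_of_cycleType lam)]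
    ring
  rw [sum_congr rfl fun lam _ => h1 lam, sum_comm]
  have h2 : ∀ p, ∑ lam, val f p * (N p lam * M lam τ.partition) =
      val f p * (1 : Matrix P P ℂ) p τ.partition := by
    intro p
    rw [← hNM, Matrix.mul_apply, mul_sum]
  rw [sum_congr rfl fun p _ => h2 p]
  simp only [Matrix.one_apply, mul_ite, mul_one, mul_zero]
  rw [Finset.sum_ite_eq' univ τ.partition (val f), if_pos (mem_univ _), hval f hf]

theorem irrChar_eq_dimension_mul {n : ℕ} (lam : diagrams n) (σ : Equiv.Perm (Fin n)) :
    irrChar lam σ = dimension lam.1 * charN (cellEquiv lam) σ := by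
  rw [charN, irrChar, mul_div_cancel₀ _ dimension_ne_zero]

/-! ### Expectations -/

/-- Fixed points do not matter because `p_1(ω) = 1`. This is what makes the character stable under
transport and multiplicative over disjoint supports. -/
theorem extremalChar_eq (ω : Simplex) {S : Type*} [Fintype S] [DecidableEq S] (σ : Equiv.Perm S) :
    extremalChar ω σ = (σ.cycleType.map (powerSum ω)).prod := by
  rw [extremalChar, Equiv.Perm.parts_partition, Multiset.map_add, Multiset.prod_add,
    Multiset.map_replicate, Multiset.prod_replicate]
  simp [powerSum]

theorem weight_mul_charN {n : ℕ} (ω : Simplex) (lam : diagrams n) (τ : Equiv.Perm (Fin n)) :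
    weight ω lam.1 * charN (cellEquiv lam) τ =
      ((n.factorial : ℂ)⁻¹ * ∑ g, irrChar lam g * (extremalChar ω g : ℂ)) * irrChar lam τ := by
  have h1 : ∑ σ : Equiv.Perm (Cell lam.1), zeta lam.1 σ * (extremalChar ω σ : ℂ) =
      ∑ g, irrChar lam g * (extremalChar ω g : ℂ) := by
    symm
    refine sum_bij' (fun g _ => push (cellEquiv lam).symm.toEmbedding g)
      (fun σ _ => push (cellEquiv lam).toEmbedding σ) (by simp) (by simp)
      (fun g _ => push_push_symm _ _) (fun σ _ => push_symm_push _ _) fun g _ => ?_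
    rw [extremalChar_eq, extremalChar_eq, cycleType_push]
    rfl
  rw [weight, schur, h1, mem_diagrams.1 lam.2, irrChar_eq_dimension_mul lam τ, one_div]
  ring

/-- The weights are the coefficients of the class function `χ^ω` in the normalized irreducible
characters, so completeness reassembles it. -/
theorem sum_weight_mul_charN {n : ℕ} (ω : Simplex) (τ : Equiv.Perm (Fin n)) :
    ∑ lam : diagrams n, weight ω lam.1 * charN (cellEquiv lam) τ = extremalChar ω τ := by
  rw [sum_congr rfl fun lam _ => weight_mul_charN ω lam τ]
  refine sum_irrChar (fun g => (extremalChar ω g : ℂ)) (fun σ τ h => ?_) τ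
  simp only [extremalChar_eq, h]

/-- The expectation of a combination of characters. -/
theorem expectation_eq {n : ℕ} (ω : Simplex) {X : Type*} (s : Finset X) (w : X → ℂ)
    (Φ : X → Equiv.Perm (Fin n)) (F : YoungDiagram → ℂ)
    (hF : ∀ (lam : YoungDiagram) (e : Cell lam ≃ Fin n), F lam = ∑ x ∈ s, w x * charN e (Φ x)) :
    expectation n ω F = ∑ x ∈ s, w x * (extremalChar ω (Φ x) : ℂ) := by
  rw [expectation, ← sum_coe_sort]
  simp only [hF _ (cellEquiv _), mul_sum]
  rw [sum_comm]
  refine sum_congr rfl fun x _ => ?_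
  rw [← sum_weight_mul_charN, mul_sum]
  exact sum_congr rfl fun lam _ => by ring

/-! ### Linear independence of the symbols -/

theorem exists_perm_parts' {n : ℕ} (μ : Multiset ℕ+) (h : size μ = n) :
    ∃ g : Equiv.Perm (Fin n), g.partition.parts = μ.map PNat.val := by
  subst h
  exact exists_perm_parts μ

/-- In a vanishing combination, take `μ` of least size `m` among the partitions with nonzero
coefficient. On diagrams of size `m`, larger symbols vanish and those of size `m` are `m!` times
normalized characters, so completeness of the characters isolates the class of `μ`. -/
theorem linearIndependent_symbol : LinearIndependent ℂ symbol := by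
  classical
  rw [linearIndependent_iff']
  intro s c hsum
  by_contra hne
  push Not at hne
  obtain ⟨μ, ⟨hμs, hμ⟩, hmin⟩ : ∃ μ, (μ ∈ s ∧ c μ ≠ 0) ∧ ∀ ν ∈ s, size ν < size μ → c ν = 0 := by
    obtain ⟨μ₀, hμ₀, hc₀⟩ := hne
    obtain ⟨μ, hμ, hm⟩ := exists_min_image {ν ∈ s | c ν ≠ 0} size ⟨μ₀, mem_filter.2 ⟨hμ₀, hc₀⟩⟩
    refine ⟨μ, mem_filter.1 hμ, fun ν hν hlt => ?_⟩
    by_contra h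
    exact absurd (hm ν (mem_filter.2 ⟨hν, h⟩)) (not_le.2 hlt)
  obtain ⟨m, hm⟩ : ∃ m, m = size μ := ⟨_, rfl⟩
  rw [← hm] at hmin
  obtain ⟨g, hg⟩ := exists_perm_parts' μ hm.symm
  choose! γ hγ using fun (ν : Multiset ℕ+) (h : size ν = m) => exists_perm_parts' ν h
  have h1 : ∀ lam : diagrams m,
      ∑ ν ∈ s with size ν = m, c ν * charN (cellEquiv lam) (γ ν) = 0 := by
    intro lam
    have hcard := mem_diagrams.1 lam.2
    have h2 := congrFun hsum lam.1
    rw [Finset.sum_apply] at h2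
    have h3 : ∀ ν ∈ s, (c ν • symbol ν) lam.1 =
        if size ν = m then (m.factorial : ℂ) * (c ν * charN (cellEquiv lam) (γ ν)) else 0 := by
      intro ν hν
      rw [Pi.smul_apply, smul_eq_mul]
      split_ifs with h
      · rw [symbol, hcard, h, if_pos le_rfl, Nat.descFactorial_self, Nat.sub_self,
          Multiset.replicate_zero, add_zero, chi_eq (cellEquiv lam) (γ ν) ν (hγ ν h)]
        ring
      · rcases lt_or_gt_of_ne h with h' | h'
        · rw [hmin ν hν h', zero_mul]
        · rw [symbol, hcard, if_neg (not_le.2 h'), mul_zero]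
    rw [sum_congr rfl h3, ← sum_filter, ← mul_sum] at h2
    exact (mul_eq_zero.1 h2).resolve_left (by exact_mod_cast m.factorial_ne_zero)
  -- The indicator of the class of `μ`; expanding it in irreducible characters extracts the
  -- coefficient of `μ` from the relations `h1`.
  let f : Equiv.Perm (Fin m) → ℂ := fun σ => if σ.cycleType = g.cycleType then 1 else 0
  have hf := sum_irrChar f fun σ τ h => by simp only [f, h]
  have h4 : ∑ ν ∈ s with size ν = m, c ν * f (γ ν) = 0 := by
    have h5 : ∀ ν, c ν * f (γ ν) = ∑ lam : diagrams m,
        (((m.factorial : ℂ)⁻¹ * ∑ g, irrChar lam g * f g) * dimension lam.1) *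
          (c ν * charN (cellEquiv lam) (γ ν)) := by
      intro ν
      rw [← hf (γ ν), mul_sum]
      refine sum_congr rfl fun lam _ => ?_
      rw [irrChar_eq_dimension_mul lam (γ ν)]
      ring
    rw [sum_congr rfl fun ν _ => h5 ν, sum_comm]
    refine sum_eq_zero fun lam _ => ?_
    rw [← mul_sum, h1, mul_zero]
  have h7 : ∀ ν ∈ ({ν ∈ s | size ν = m} : Finset _), ν ≠ μ → c ν * f (γ ν) = 0 := by
    intro ν hν hne
    have hν' := (mem_filter.1 hν).2
    simp only [f]
    rw [if_neg, mul_zero]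
    intro h
    refine hne (Multiset.map_injective PNat.coe_injective ?_)
    refine (hγ ν hν').symm.trans (Eq.trans ?_ hg)
    rw [Equiv.Perm.partition_eq_of_isConj.1 (Equiv.Perm.isConj_iff_cycleType_eq.2 h)]
  rw [sum_eq_single_of_mem μ (mem_filter.2 ⟨hμs, hm.symm⟩) h7] at h4
  have h8 : (γ μ).cycleType = g.cycleType := by
    rw [← Equiv.Perm.filter_parts_partition_eq_cycleType,
      ← Equiv.Perm.filter_parts_partition_eq_cycleType, hγ μ hm.symm, hg]
  simp only [f, h8, if_true, mul_one] at h4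
  exact hμ h4

theorem ofSymbols_injective : Function.Injective ofSymbols := fun _ _ h =>
  AddMonoidAlgebra.coeff_injective (linearIndependent_symbol h)

theorem toSymbols_ofSymbols (f : AddMonoidAlgebra ℂ (Multiset ℕ+)) : toSymbols (ofSymbols f) = f :=
  Function.leftInverse_invFun ofSymbols_injective f

theorem exists_ofSymbols_eq {d : ℕ} {X : YoungDiagram → ℂ} (hX : X ∈ symbolSpan d) :
    ∃ f : AddMonoidAlgebra ℂ (Multiset ℕ+), ofSymbols f = X ∧ ∀ μ ∈ f.coeff.support, size μ ≤ d := by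
  have h1 : {F | ∃ μ, size μ ≤ d ∧ F = symbol μ} = symbol '' {μ | size μ ≤ d} := by
    ext F
    simp only [Set.mem_image, Set.mem_ofPred_eq]
    exact exists_congr fun μ => and_congr_right fun _ => eq_comm
  rw [symbolSpan, h1, Finsupp.mem_span_image_iff_linearCombination] at hX
  obtain ⟨l, hl, hX⟩ := hX
  exact ⟨.ofCoeff l, hX, fun μ hμ => (Finsupp.mem_supported _ _).1 hl hμ⟩

/-- The expansion of an observable in the basis of symbols. -/
theorem observable_expansion {X : YoungDiagram → ℂ} (hX : X ∈ observables) :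
    ofSymbols (toSymbols X) = X ∧ ∀ μ ∈ (toSymbols X).coeff.support, size μ ≤ deg X := by
  obtain ⟨f, hf, hs⟩ := exists_ofSymbols_eq (mem_symbolSpan_deg hX)
  have h : toSymbols X = f := by rw [← hf, toSymbols_ofSymbols]
  rw [h]
  exact ⟨hf, hs⟩

/-! ### Cumulants of a function on finite sets -/

section Cumulants

variable {ι : Type*} [DecidableEq ι]

/-- The coefficient of the partitions with `l` blocks in the definition of the cumulants. -/
def cumCoeff (l : ℕ) : ℂ := (-1) ^ (l - 1) * ((l - 1).factorial : ℂ)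

/-- The set partitions of a finite set, as sets of blocks. -/
def setPartitions (A : Finset ι) : Finset (Finset (Finset ι)) :=
  univ.image (Finpartition.parts : Finpartition A → Finset (Finset ι))

theorem mem_setPartitions {A : Finset ι} {P : Finset (Finset ι)} :
    P ∈ setPartitions A ↔ ∅ ∉ P ∧ (P : Set (Finset ι)).PairwiseDisjoint id ∧ P.sup id = A := by
  rw [setPartitions, mem_image]
  constructor
  · rintro ⟨π, -, rfl⟩
    exact ⟨π.bot_notMem, π.supIndep.pairwiseDisjoint, π.sup_parts⟩
  · rintro ⟨h1, h2, h3⟩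
    exact ⟨⟨P, supIndep_iff_pairwiseDisjoint.2 h2, h3, h1⟩, mem_univ _, rfl⟩

/-- The cumulant of a finite set. -/
def setCumulant (m : Finset ι → ℂ) (A : Finset ι) : ℂ :=
  ∑ P ∈ setPartitions A, cumCoeff #P * ∏ B ∈ P, m B

theorem cumulantOf_eq {r : ℕ} (m : Finset (Fin r) → ℂ) : cumulantOf m = setCumulant m univ := by
  rw [setCumulant, setPartitions, sum_image]
  · rfl
  · exact fun _ _ _ _ h => Finpartition.ext h

/-- The cancellation that leaves only the one-block partition in the recursion for cumulants. For `l
= 1` the factor `l - 1 = 0` removes the meaningless coefficient of index `0`. -/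
theorem cumCoeff_rec (l : ℕ) (hl : 1 ≤ l) :
    cumCoeff l + ((l - 1 : ℕ) : ℂ) * cumCoeff (l - 1) = if l = 1 then 1 else 0 := by
  obtain ⟨k, rfl⟩ := Nat.exists_eq_add_of_le' hl
  cases k with
  | zero => simp [cumCoeff]
  | succ k =>
    simp only [cumCoeff, Nat.add_sub_cancel, Nat.factorial_succ]
    rw [if_neg (by omega), pow_succ]
    push_cast
    ring

theorem insert_mem_setPartitions {A C : Finset ι} {P : Finset (Finset ι)} (hC : C ⊆ A)
    (hne : C ≠ ∅) (hP : P ∈ setPartitions (A \ C)) : C ∉ P ∧ insert C P ∈ setPartitions A := by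
  rw [mem_setPartitions] at hP ⊢
  obtain ⟨h1, h2, h3⟩ := hP
  have hd : ∀ B ∈ P, Disjoint C B := by
    intro B hB
    have : B ≤ A \ C := h3 ▸ le_sup (f := id) hB
    exact (disjoint_sdiff.mono_right this)
  refine ⟨fun h => hne ?_, ?_, ?_, ?_⟩
  · exact disjoint_self.1 (hd C h)
  · rw [mem_insert, not_or]
    exact ⟨hne.symm, h1⟩
  · rw [coe_insert]
    exact h2.insert fun B hB _ => hd B hB
  · rw [sup_insert, h3]
    exact union_sdiff_of_subset hC

theorem erase_mem_setPartitions {A C : Finset ι} {P : Finset (Finset ι)} (hP : P ∈ setPartitions A)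
    (hC : C ∈ P) : C ⊆ A ∧ C ≠ ∅ ∧ P.erase C ∈ setPartitions (A \ C) := by
  rw [mem_setPartitions] at hP ⊢
  obtain ⟨h1, h2, h3⟩ := hP
  have hCA : C ⊆ A := h3 ▸ le_sup (f := id) hC
  refine ⟨hCA, fun h => h1 (h ▸ hC), fun h => h1 (mem_erase.1 h).2,
    h2.subset (by simp), ?_⟩
  have hd : Disjoint C ((P.erase C).sup id) := by
    rw [Finset.disjoint_sup_right]
    intro B hB
    exact h2 hC (mem_erase.1 hB).2 (mem_erase.1 hB).1.symm
  have h4 : C ∪ (P.erase C).sup id = A := by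
    conv_rhs => rw [← h3, ← insert_erase hC, sup_insert]
    rfl
  rw [← h4, union_sdiff_cancel_left hd]

theorem card_blocks_notMem {A : Finset ι} {P : Finset (Finset ι)} (hP : P ∈ setPartitions A) {a : ι}
    (ha : a ∈ A) : #{C ∈ P | a ∉ C} = #P - 1 ∧ 1 ≤ #P := by
  rw [mem_setPartitions] at hP
  obtain ⟨h1, h2, h3⟩ := hP
  rw [← h3, mem_sup] at ha
  obtain ⟨B, hB, haB⟩ := ha
  have : {C ∈ P | a ∉ C} = P.erase B := by
    ext C
    rw [mem_filter, mem_erase, and_comm]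
    refine and_congr_left fun hC => ⟨?_, fun hne haC => ?_⟩
    · rintro h rfl
      exact h haB
    · exact (disjoint_left.1 (h2 hB hC hne.symm) haB) haC
  rw [this, card_erase_of_mem hB]
  exact ⟨rfl, card_pos.2 ⟨B, hB⟩⟩

/-- The recursive formula for the cumulants. -/
theorem sum_setCumulant_mul {m : Finset ι → ℂ} (hm : m ∅ = 1) {A : Finset ι} {a : ι} (ha : a ∈ A) :
    ∑ C ∈ (A.erase a).powerset, setCumulant m (A \ C) * m C = m A := by
  have h0 : ∅ ∈ (A.erase a).powerset := empty_mem_powerset _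
  rw [← add_sum_erase _ _ h0, sdiff_empty, hm, mul_one]
  -- A nonempty `C` avoiding `a` together with a partition of `A \ C` is a partition of `A` with a
  -- marked block avoiding `a`; a partition with `l` blocks has `l - 1` such marks.
  have h1 : ∑ C ∈ (A.erase a).powerset.erase ∅, setCumulant m (A \ C) * m C =
      ∑ P ∈ setPartitions A, ∑ C ∈ P with a ∉ C, cumCoeff (#P - 1) * ∏ B ∈ P, m B := by
    simp only [setCumulant, sum_mul]
    rw [sum_sigma', sum_sigma']
    refine sum_bij' (fun p _ => ⟨insert p.1 p.2, p.1⟩) (fun p _ => ⟨p.2, p.1.erase p.2⟩) ?_ ?_ ?_ ?_ ?_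
    · rintro ⟨C, P⟩ h
      simp only [mem_sigma, mem_erase, mem_powerset, mem_filter] at h ⊢
      obtain ⟨⟨hne, hsub⟩, hP⟩ := h
      exact ⟨(insert_mem_setPartitions (hsub.trans (erase_subset _ _)) hne hP).2,
        mem_insert_self _ _, fun h => (mem_erase.1 (hsub h)).1 rfl⟩
    · rintro ⟨P, C⟩ h
      simp only [mem_sigma, mem_erase, mem_powerset, mem_filter] at h ⊢
      obtain ⟨hP, hC, haC⟩ := h
      obtain ⟨h1, h2, h3⟩ := erase_mem_setPartitions hP hC
      exact ⟨⟨h2, subset_erase.2 ⟨h1, haC⟩⟩, h3⟩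
    · rintro ⟨C, P⟩ h
      simp only [mem_sigma, mem_erase, mem_powerset] at h
      obtain ⟨⟨hne, hsub⟩, hP⟩ := h
      have := (insert_mem_setPartitions (hsub.trans (erase_subset _ _)) hne hP).1
      simp [erase_insert this]
    · rintro ⟨P, C⟩ h
      simp only [mem_sigma, mem_filter] at h
      simp [insert_erase h.2.1]
    · rintro ⟨C, P⟩ h
      simp only [mem_sigma, mem_erase, mem_powerset] at h
      obtain ⟨⟨hne, hsub⟩, hP⟩ := h
      have := (insert_mem_setPartitions (hsub.trans (erase_subset _ _)) hne hP).1
      simp only [card_insert_of_notMem this, prod_insert this, Nat.add_sub_cancel]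
      ring
  rw [h1, setCumulant, ← sum_add_distrib]
  have h2 : ∀ P ∈ setPartitions A, cumCoeff #P * ∏ B ∈ P, m B +
      ∑ C ∈ P with a ∉ C, cumCoeff (#P - 1) * ∏ B ∈ P, m B =
      if P = {A} then m A else 0 := by
    intro P hP
    obtain ⟨h3, h4⟩ := card_blocks_notMem hP ha
    rw [sum_const, h3, nsmul_eq_mul, ← mul_assoc, ← add_mul, cumCoeff_rec _ h4]
    have hiff : #P = 1 ↔ P = {A} := by
      constructor
      · intro h
        obtain ⟨B, rfl⟩ := card_eq_one.1 h
        have := (mem_setPartitions.1 hP).2.2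
        rw [sup_singleton] at this
        rw [← this]; rfl
      · rintro rfl; simp
    simp only [hiff]
    split_ifs with h
    · rw [h, prod_singleton, one_mul]
    · rw [zero_mul]
  rw [sum_congr rfl h2, sum_ite_eq', if_pos]
  rw [mem_setPartitions]
  refine ⟨?_, by simp, by simp⟩
  rw [mem_singleton]
  rintro rfl
  simp at ha

/-- The cumulants of independent families vanish. -/
theorem setCumulant_eq_zero {m : Finset ι → ℂ} (hm : m ∅ = 1) (S : Finset ι)
    (hS : ∀ B, m B = m (B ∩ S) * m (B \ S)) (A : Finset ι) (h1 : (A ∩ S).Nonempty)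
    (h2 : (A \ S).Nonempty) : setCumulant m A = 0 := by
  induction A using Finset.strongInduction with
  | H A ih =>
    obtain ⟨a, ha⟩ := h1
    have haA := (mem_inter.1 ha).1
    have haS := (mem_inter.1 ha).2
    have hR := sum_setCumulant_mul hm haA
    have hR' := sum_setCumulant_mul hm ha
    rw [← add_sum_erase _ _ (empty_mem_powerset _), sdiff_empty, hm, mul_one] at hR
    -- Compare with the recursion for `A ∩ S`, multiplied by `m (A \ S)`. The terms in which `A \ C`
    -- is not contained in `S` vanish by induction; the others contain `A \ S` and correspond to the
    -- terms for `A ∩ S` through `C ↦ C ∪ (A \ S)`.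
    have h3 : ∑ C ∈ (A.erase a).powerset.erase ∅, setCumulant m (A \ C) * m C = m A := by
      rw [hS A, ← hR', sum_mul]
      symm
      refine sum_bij_ne_zero (fun C _ _ => C ∪ (A \ S)) ?_ ?_ ?_ ?_
      · intro C hC _
        rw [mem_powerset] at hC
        rw [mem_erase, mem_powerset]
        refine ⟨fun h => ?_, ?_⟩
        · rw [union_eq_empty] at h
          exact h2.ne_empty h.2
        · refine union_subset (hC.trans (erase_subset_erase _ inter_subset_left)) ?_
          rw [subset_erase]
          exact ⟨sdiff_subset, fun h => (mem_sdiff.1 h).2 haS⟩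
      · intro C hC _ C' hC' _ h
        have key : ∀ D, D ∈ ((A ∩ S).erase a).powerset → (D ∪ A \ S) ∩ S = D := by
          intro D hD
          rw [mem_powerset] at hD
          ext x
          have := @hD x
          simp only [mem_inter, mem_union, mem_sdiff, mem_erase] at this ⊢
          tauto
        rw [← key C hC, h, key C' hC']
      · intro C hC hne
        rw [mem_erase, mem_powerset] at hC
        have hsub : A \ C ⊆ S := by
          by_contra hns
          refine hne ?_
          rw [ih (A \ C), zero_mul]
          · refine sdiff_ssubset (hC.2.trans (erase_subset _ _)) (nonempty_iff_ne_empty.2 hC.1)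
          · refine ⟨a, mem_inter.2 ⟨mem_sdiff.2 ⟨haA, fun h => ?_⟩, haS⟩⟩
            exact (mem_erase.1 (hC.2 h)).1 rfl
          · exact sdiff_nonempty.2 hns
        have hCe : (C ∩ S) ∪ (A \ S) = C := by
          ext x
          have h4 := @hsub x
          have h5 := @hC.2 x
          simp only [mem_sdiff, mem_inter, mem_union, mem_erase] at h4 h5 ⊢
          tauto
        have hmem : C ∩ S ∈ ((A ∩ S).erase a).powerset := by
          rw [mem_powerset]
          intro x hx
          have h5 := @hC.2 x
          simp only [mem_inter, mem_erase] at h5 hx ⊢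
          tauto
        refine ⟨C ∩ S, hmem, ?_, hCe⟩
        have h6 : (A ∩ S) \ (C ∩ S) = A \ C := by
          ext x
          have h4 := @hsub x
          simp only [mem_sdiff, mem_inter] at h4 ⊢
          tauto
        have h7 : C \ S = A \ S := by
          rw [← hCe]
          ext x
          simp only [mem_sdiff, mem_inter, mem_union]
          tauto
        rw [h6, mul_assoc, ← h7, ← hS]
        exact hne
      · intro C hC _
        rw [mem_powerset] at hC
        have h6 : A \ (C ∪ A \ S) = (A ∩ S) \ C := by
          ext x
          simp only [mem_sdiff, mem_inter, mem_union]
          tauto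
        have h7 : (C ∪ A \ S) ∩ S = C := by
          ext x
          have := @hC x
          simp only [mem_inter, mem_union, mem_sdiff, mem_erase] at this ⊢
          tauto
        have h8 : (C ∪ A \ S) \ S = A \ S := by
          ext x
          have := @hC x
          simp only [mem_inter, mem_union, mem_sdiff, mem_erase] at this ⊢
          tauto
        rw [h6, hS (C ∪ A \ S), h7, h8, mul_assoc]
    rw [h3] at hR
    exact add_eq_right.1 hR

end Cumulants

/-! ### Vanishing, multilinearity and bounds for cumulants of `r` indices -/

section

variable {r : ℕ}

theorem cumulantOf_eq_zero {m : Finset (Fin r) → ℂ} (hm : m ∅ = 1) (S : Finset (Fin r))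
    (hS : ∀ B, m B = m (B ∩ S) * m (B \ S)) (h1 : S.Nonempty) (h2 : S ≠ univ) :
    cumulantOf m = 0 := by
  rw [cumulantOf_eq]
  refine setCumulant_eq_zero hm S hS univ (by simpa using h1) ?_
  rw [sdiff_nonempty]
  exact fun h => h2 (univ_subset_iff.1 h)

theorem cumulantOf_congr {m m' : Finset (Fin r) → ℂ} (h : ∀ B, m B = m' B) :
    cumulantOf m = cumulantOf m' := by rw [funext h]

/-- A cumulant of sums over families is the sum of the cumulants. -/
theorem cumulantOf_sum {Y : Fin r → Type*} [∀ j, Fintype (Y j)]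
    (w : ∀ B : Finset (Fin r), (∀ j : B, Y j) → ℂ) :
    cumulantOf (fun B => ∑ z : ∀ j : B, Y j, w B z) =
      ∑ y : ∀ j, Y j, cumulantOf fun B => w B fun j => y j := by
  unfold cumulantOf
  rw [sum_comm]
  refine sum_congr rfl fun π _ => ?_
  rw [← mul_sum]
  congr 1
  rw [← prod_coe_sort, prod_univ_sum]
  simp only [Fintype.piFinset_univ]
  -- Each index lies in exactly one block, so choosing a family independently on every block is
  -- choosing one global family.
  have hbij : Function.Bijective fun (y : ∀ j, Y j) (t : π.parts) (j : t.1) => y j := by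
    constructor
    · intro y y' h
      funext j
      obtain ⟨t, ht, hj⟩ := π.exists_mem (mem_univ j)
      exact congrFun (congrFun h ⟨t, ht⟩) ⟨j, hj⟩
    · intro p
      refine ⟨fun j => p ⟨π.part j, π.part_mem.2 (mem_univ j)⟩
        ⟨j, π.mem_part (mem_univ j)⟩, ?_⟩
      funext t j
      have h1 : π.part j.1 = t.1 := π.part_eq_of_mem t.2 j.2
      have h2 : ∀ (t' : π.parts) (hj : j.1 ∈ t'.1), t' = t → p t' ⟨j.1, hj⟩ = p t j := by
        rintro t' hj rfl
        rfl
      exact h2 _ _ (Subtype.ext h1)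
  rw [← hbij.sum_comp]
  exact sum_congr rfl fun y _ => prod_coe_sort π.parts fun B => w B fun j => y j

theorem cumulantOf_prod_mul (c : Fin r → ℂ) (m : Finset (Fin r) → ℂ) :
    cumulantOf (fun B => (∏ j ∈ B, c j) * m B) = (∏ j, c j) * cumulantOf m := by
  unfold cumulantOf
  rw [mul_sum]
  refine sum_congr rfl fun π _ => ?_
  have h : ∏ B ∈ π.parts, ∏ j ∈ B, c j = ∏ j, c j := by
    have h1 := prod_biUnion (s := π.parts) (t := id) (f := c) π.supIndep.pairwiseDisjoint
    rw [π.biUnion_parts] at h1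
    exact h1.symm
  rw [prod_mul_distrib, h]
  ring

/-- A bound for the cumulants of the functions that are bounded by one. -/
def cumulantBound (r : ℕ) : ℝ :=
  ∑ π : Finpartition (univ : Finset (Fin r)), ((#π.parts - 1).factorial : ℝ)

theorem norm_cumulantOf_le {m : Finset (Fin r) → ℂ} (h : ∀ B, ‖m B‖ ≤ 1) :
    ‖cumulantOf m‖ ≤ cumulantBound r := by
  refine norm_sum_le_of_le _ fun π _ => ?_
  rw [norm_mul, norm_mul, norm_pow, norm_neg, norm_one, one_pow, one_mul, Complex.norm_natCast,
    norm_prod]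
  exact mul_le_of_le_one_right (by positivity) (prod_le_one (fun _ _ => norm_nonneg _) fun B _ => h B)

theorem cumulantBound_nonneg (r : ℕ) : 0 ≤ cumulantBound r :=
  sum_nonneg fun _ _ => by positivity

end

/-! ### Connected families of embeddings -/

/-- A connected family of embeddings has a small joint image. -/
theorem card_image_add_le {r n : ℕ} (hr : 1 ≤ r) {d : Fin r → ℕ} (y : ∀ j, Fin (d j) ↪ Fin n)
    (hy : ∀ S : Finset (Fin r), S.Nonempty → S ≠ univ → ∃ i ∈ S, ∃ j ∉ S, ∃ a b, y i a = y j b) :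
    #(univ.image fun p : (Σ j, Fin (d j)) => y p.1 p.2) + (r - 1) ≤ ∑ j, d j := by
  let R : Fin r → Finset (Fin n) := fun j => univ.image (y j)
  have hR : ∀ j, #(R j) = d j := fun j => by
    rw [card_image_of_injective _ (y j).injective, card_univ, Fintype.card_fin]
  -- Grow `S` one index at a time: connectedness always provides a new index whose image meets the
  -- union of the previous ones, and each such step loses at least one point.
  have key : ∀ m, m + 1 ≤ r → ∃ S : Finset (Fin r), #S = m + 1 ∧
      #(S.biUnion R) + m ≤ ∑ j ∈ S, d j := by
    intro m
    induction m with
    | zero =>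
      intro _
      refine ⟨{⟨0, hr⟩}, by simp, ?_⟩
      simp [hR]
    | succ m ih =>
      intro hm
      obtain ⟨S, hS, hle⟩ := ih (by omega)
      have hne : S ≠ univ := by
        rintro rfl
        rw [card_univ, Fintype.card_fin] at hS
        omega
      obtain ⟨i, hi, j, hj, a, b, hab⟩ := hy S (card_pos.1 (by omega)) hne
      refine ⟨insert j S, by rw [card_insert_of_notMem hj, hS], ?_⟩
      rw [biUnion_insert, sum_insert hj]
      have h1 := card_union_add_card_inter (R j) (S.biUnion R)
      have h2 : 1 ≤ #(R j ∩ S.biUnion R) := by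
        refine card_pos.2 ⟨y j b, mem_inter.2 ⟨mem_image_of_mem _ (mem_univ b), ?_⟩⟩
        rw [mem_biUnion]
        exact ⟨i, hi, hab ▸ mem_image_of_mem _ (mem_univ a)⟩
      rw [hR] at h1
      omega
  obtain ⟨S, hS, hle⟩ := key (r - 1) (by omega)
  have hSu : S = univ := by
    rw [← card_eq_iff_eq_univ, Fintype.card_fin]
    omega
  subst hSu
  have himg : (univ.image fun p : (Σ j, Fin (d j)) => y p.1 p.2) = univ.biUnion R := by
    ext x
    simp [R]
  rw [himg]
  exact hle

/-- A map with at most `s` values factors through `Fin s`. Positivity of `n` supplies a value for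
the unused labels. -/
theorem card_image_le_card {K : Type*} [Fintype K] [DecidableEq K] {n : ℕ} (hn : 1 ≤ n) (s : ℕ) :
    #{x : K → Fin n | #(univ.image x) ≤ s} ≤ s ^ Fintype.card K * n ^ s := by
  have h1 : ({x : K → Fin n | #(univ.image x) ≤ s} : Finset (K → Fin n)) ⊆
      univ.image fun p : (K → Fin s) × (Fin s → Fin n) => p.2 ∘ p.1 := by
    intro x hx
    rw [mem_filter] at hx
    have : Fintype.card (univ.image x) ≤ Fintype.card (Fin s) := by
      rw [Fintype.card_coe, Fintype.card_fin]
      exact hx.2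
    obtain ⟨f⟩ := Function.Embedding.nonempty_of_card_le this
    have : Nonempty (Fin n) := ⟨⟨0, hn⟩⟩
    let q : K → Fin s := fun k => f ⟨x k, mem_image_of_mem _ (mem_univ k)⟩
    rw [mem_image]
    refine ⟨(q, Function.extend f (fun t => t.1) fun _ => Classical.arbitrary _), mem_univ _, ?_⟩
    funext k
    exact (f.injective.extend_apply (fun t : univ.image x => t.1) (fun _ => Classical.arbitrary _)
      ⟨x k, mem_image_of_mem _ (mem_univ k)⟩ :)
  refine (card_le_card h1).trans (card_image_le.trans ?_)
  rw [card_univ, Fintype.card_prod, Fintype.card_fun, Fintype.card_fun, Fintype.card_fin,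
    Fintype.card_fin]

/-- A cumulant of sums over families of embeddings, of weights that factorize over the families with
disjoint images, has the order of magnitude of the number of connected families. -/
theorem norm_cumulantOf_sum_le {r n : ℕ} (hr : 1 ≤ r) (hn : 1 ≤ n) (d : Fin r → ℕ)
    (w : ∀ B : Finset (Fin r), (∀ j : B, Fin (d j) ↪ Fin n) → ℂ) (hw : ∀ B z, ‖w B z‖ ≤ 1)
    (h0 : ∀ z, w ∅ z = 1)
    (hS : ∀ (y : ∀ j, Fin (d j) ↪ Fin n) (S : Finset (Fin r)),
      (∀ i ∈ S, ∀ j ∉ S, ∀ a b, y i a ≠ y j b) →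
      ∀ B, w B (fun j => y j) = w (B ∩ S) (fun j => y j) * w (B \ S) (fun j => y j)) :
    ‖cumulantOf fun B => ∑ z : ∀ j : B, Fin (d j) ↪ Fin n, w B z‖ ≤
      cumulantBound r * ((∑ j, d j : ℕ) + 1 : ℝ) ^ (∑ j, d j) *
        (n : ℝ) ^ (((∑ j, d j : ℕ) : ℤ) - r + 1) := by
  classical
  set D := ∑ j, d j with hD
  have hn0 : (0 : ℝ) < n := by exact_mod_cast hn
  rw [cumulantOf_sum (Y := fun j => Fin (d j) ↪ Fin n) w]
  let T : Finset (∀ j, Fin (d j) ↪ Fin n) := {y | cumulantOf (fun B => w B fun j => y j) ≠ 0}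
  have hT : ∀ y ∈ T, #(univ.image fun p : (Σ j, Fin (d j)) => y p.1 p.2) + (r - 1) ≤ D := by
    intro y hy
    refine card_image_add_le hr y fun S hne hu => ?_
    by_contra hcon
    push Not at hcon
    exact (mem_filter.1 hy).2 (cumulantOf_eq_zero (h0 _) S (hS y S hcon) hne hu)
  have h1 : ‖∑ y : ∀ j, Fin (d j) ↪ Fin n, cumulantOf fun B => w B fun j => y j‖ ≤
      #T * cumulantBound r := by
    rw [← sum_filter_ne_zero, ← nsmul_eq_mul]
    exact (norm_sum_le _ _).trans (sum_le_card_nsmul _ _ _ fun y _ =>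
      norm_cumulantOf_le fun B => hw B _)
  refine h1.trans ?_
  rw [mul_comm, mul_assoc]
  refine mul_le_mul_of_nonneg_left ?_ (cumulantBound_nonneg r)
  -- The exponent `D - r + 1` may be negative, but a contributing family forces `r - 1 ≤ D`, so in
  -- the nonempty case it is a natural number.
  rcases T.eq_empty_or_nonempty with hTe | ⟨y₀, hy₀⟩
  · rw [hTe, card_empty, Nat.cast_zero]
    positivity
  · have hrD : r - 1 ≤ D := (Nat.le_add_left _ _).trans (hT y₀ hy₀)
    have h2 : #T ≤ #{x : (Σ j, Fin (d j)) → Fin n | #(univ.image x) ≤ D - (r - 1)} := by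
      refine card_le_card_of_injOn (fun y p => y p.1 p.2) (fun y hy => ?_) fun y _ y' _ h => ?_
      · have := hT y hy
        simp only [coe_filter, mem_univ, true_and, Set.mem_ofPred_eq]
        omega
      · funext j
        ext a
        exact congrArg Fin.val (congrFun h ⟨j, a⟩)
    have h3 := h2.trans (card_image_le_card hn _)
    rw [Fintype.card_sigma] at h3
    simp only [Fintype.card_fin, ← hD] at h3
    have h4 : (n : ℝ) ^ ((D : ℤ) - r + 1) = (n : ℝ) ^ (D - (r - 1)) := by
      rw [← zpow_natCast]
      congr 1
      omega
    rw [h4]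
    calc (#T : ℝ) ≤ ((D - (r - 1) : ℕ) : ℝ) ^ D * (n : ℝ) ^ (D - (r - 1)) := by exact_mod_cast h3
      _ ≤ _ := by
        gcongr
        exact_mod_cast (by omega : D - (r - 1) ≤ D + 1)

/-! ### Bounds for the extremal characters -/

/-- The coordinates lie in `[0, 1]`, so their powers are dominated by the coordinates themselves,
whose total is at most one. -/
theorem norm_powerSum_le (ω : Simplex) (k : ℕ) (hk : 1 ≤ k) : |powerSum ω k| ≤ 1 := by
  unfold powerSum
  split_ifs with h
  · simp
  have key : ∀ α : ℕ → ℝ, (∀ i, 0 ≤ α i) → Summable α → ∑' i, α i ≤ 1 →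
      0 ≤ ∑' i, α i ^ k ∧ ∑' i, α i ^ k ≤ ∑' i, α i := by
    intro α h0 hs h1
    have hle : ∀ i, α i ≤ 1 := fun i => (hs.le_tsum i fun j _ => h0 j).trans h1
    have hpow : ∀ i, α i ^ k ≤ α i := fun i => pow_le_of_le_one (h0 i) (hle i) (by omega)
    have hsk : Summable fun i => α i ^ k := hs.of_nonneg_of_le (fun i => pow_nonneg (h0 i) k) hpow
    exact ⟨tsum_nonneg fun i => pow_nonneg (h0 i) k, hsk.tsum_le_tsum hpow hs⟩
  have hα0 : 0 ≤ ∑' i, ω.α i := tsum_nonneg ω.nonneg_α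
  have hβ0 : 0 ≤ ∑' i, ω.β i := tsum_nonneg ω.nonneg_β
  have hsum := ω.sum_le_one
  obtain ⟨h1, h2⟩ := key ω.α ω.nonneg_α ω.summable_α (by linarith)
  obtain ⟨h3, h4⟩ := key ω.β ω.nonneg_β ω.summable_β (by linarith)
  rw [abs_le]
  rcases neg_one_pow_eq_or ℝ (k - 1) with h5 | h5 <;> rw [h5] <;> constructor <;> linarith

theorem norm_prod_powerSum_le (ω : Simplex) (s : Multiset ℕ) (hs : ∀ k ∈ s, 1 ≤ k) :
    ‖(((s.map (powerSum ω)).prod : ℝ) : ℂ)‖ ≤ 1 := by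
  rw [Complex.norm_real]
  induction s using Multiset.induction_on with
  | empty => simp
  | cons k s ih =>
    rw [Multiset.map_cons, Multiset.prod_cons, norm_mul]
    exact mul_le_one₀ (norm_powerSum_le ω k (hs k (Multiset.mem_cons_self _ _))) (norm_nonneg _)
      (ih fun j hj => hs j (Multiset.mem_cons_of_mem hj))

theorem norm_extremalChar_le (ω : Simplex) {n : ℕ} (σ : Equiv.Perm (Fin n)) :
    ‖(extremalChar ω σ : ℂ)‖ ≤ 1 :=
  norm_prod_powerSum_le ω _ fun _ hk => σ.partition.parts_pos hk

theorem extremalChar_mul (ω : Simplex) {n : ℕ} {σ τ : Equiv.Perm (Fin n)}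
    (h : Equiv.Perm.Disjoint σ τ) : extremalChar ω (σ * τ) = extremalChar ω σ * extremalChar ω τ := by
  rw [extremalChar_eq, extremalChar_eq, extremalChar_eq, h.cycleType_mul, Multiset.map_add,
    Multiset.prod_add]

theorem extremalChar_one (ω : Simplex) {n : ℕ} :
    extremalChar ω (1 : Equiv.Perm (Fin n)) = 1 := by
  rw [extremalChar_eq]
  simp

/-! ### Expectations of products of symbols -/

theorem sum_ofFn_prod {E : Type*} [Ring E] {r : ℕ} {Z : Fin r → Type*} [∀ j, Fintype (Z j)]
    (f : ∀ j, Z j → E) :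
    ∑ z : ∀ j, Z j, (List.ofFn fun j => f j (z j)).prod = (List.ofFn fun j => ∑ a, f j a).prod := by
  induction r with
  | zero => simp
  | succ r ih =>
    rw [List.ofFn_succ, List.prod_cons, ← ih fun j => f j.succ, sum_mul_sum, ← sum_product',
      univ_product_univ]
    refine (Fintype.sum_equiv (Fin.consEquiv Z) _ _ ?_).symm
    rintro ⟨a, z⟩
    rw [List.ofFn_succ, List.prod_cons]
    rfl

/-- The ordered product of the permutations `h j`, `j ∈ B`. -/
def permProd {G : Type*} [Group G] {r : ℕ} (h : Fin r → G) : G := (List.ofFn h).prod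

section

variable {r : ℕ} {μ : Fin r → Multiset ℕ+} (g : ∀ j, Equiv.Perm (Fin (size (μ j))))

/-- The permutation attached to a family of embeddings that is indexed by `B`. -/
def familyPerm {n : ℕ} (B : Finset (Fin r)) (z : ∀ j : B, Fin (size (μ j)) ↪ Fin n) :
    Equiv.Perm (Fin n) :=
  permProd fun j => if h : j ∈ B then push (z ⟨j, h⟩) (g j) else 1

/-- Each symbol is the scalar by which a sum of transported permutations acts. Multiply these
operators in the order of the indices, expand by distributivity, and take the normalized trace. -/
theorem prod_symbol_eq {n : ℕ} (hg : ∀ j, (g j).partition.parts = (μ j).map PNat.val)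
    (B : Finset (Fin r)) (lam : YoungDiagram) (e : Cell lam ≃ Fin n) :
    (∏ j ∈ B, symbol (μ j)) lam =
      ∑ z : ∀ j : B, Fin (size (μ j)) ↪ Fin n, charN e (familyPerm g B z) := by
  -- For `j` outside `B` there is exactly one function from the empty proposition `j ∈ B`, so such
  -- an index contributes a single identity factor.
  let f : ∀ j, (j ∈ B → Fin (size (μ j)) ↪ Fin n) → Module.End ℂ (spechtModule lam) :=
    fun j a => if h : j ∈ B then spechtRep e (push (a h) (g j)) else 1
  have h1 : ∀ j, ∑ a, f j a =
      algebraMap ℂ (Module.End ℂ (spechtModule lam)) (if j ∈ B then symbol (μ j) lam else 1) := by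
    intro j
    by_cases h : j ∈ B
    · rw [if_pos h, Algebra.algebraMap_eq_smul_one, ← sum_spechtRep_push e (g j) (μ j) (hg j)]
      refine Fintype.sum_equiv ⟨fun a => a h, fun a _ => a, fun _ => rfl, fun _ => rfl⟩ _ _ fun a => ?_
      simp only [f, dif_pos h]
      rfl
    · rw [if_neg h, map_one]
      have : Unique (j ∈ B → Fin (size (μ j)) ↪ Fin n) :=
        ⟨⟨fun h' => absurd h' h⟩, fun a => funext fun h' => absurd h' h⟩
      rw [Fintype.sum_subsingleton _ this.default]
      simp only [f, dif_neg h]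
  have h2 := sum_ofFn_prod f
  simp only [h1] at h2
  have h3 : (List.ofFn fun j => algebraMap ℂ (Module.End ℂ (spechtModule lam))
      (if j ∈ B then symbol (μ j) lam else 1)).prod =
      (∏ j ∈ B, symbol (μ j)) lam • 1 := by
    have h4 := map_list_prod (algebraMap ℂ (Module.End ℂ (spechtModule lam)))
      (List.ofFn fun j => if j ∈ B then symbol (μ j) lam else 1)
    rw [List.map_ofFn] at h4
    refine h4.symm.trans ?_
    rw [List.prod_ofFn, prod_ite_mem, univ_inter, Algebra.algebraMap_eq_smul_one, Finset.prod_apply]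
  have h5 : ∑ z : ∀ j, j ∈ B → Fin (size (μ j)) ↪ Fin n, (List.ofFn fun j => f j (z j)).prod =
      ∑ z : ∀ j : B, Fin (size (μ j)) ↪ Fin n, (1 : ℂ) • spechtRep e (familyPerm g B z) := by
    let E : (∀ j, j ∈ B → Fin (size (μ j)) ↪ Fin n) ≃ (∀ j : B, Fin (size (μ j)) ↪ Fin n) :=
      ⟨fun z j => z j.1 j.2, fun z j h => z ⟨j, h⟩, fun _ => rfl, fun _ => rfl⟩
    refine Fintype.sum_equiv E _ _ fun z => ?_
    rw [one_smul, familyPerm, permProd, map_list_prod, List.map_ofFn]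
    congr 2
    funext j
    simp only [f, Function.comp]
    split_ifs with h
    · rfl
    · exact (map_one (spechtRep e)).symm
  have h6 := sum_charN e univ (fun _ => 1) (familyPerm (n := n) g B)
  rw [← h5, h2, h3, trace_smul_one] at h6
  simpa using h6.symm

theorem expectation_prod_symbol {n : ℕ} (hg : ∀ j, (g j).partition.parts = (μ j).map PNat.val)
    (ω : Simplex) (B : Finset (Fin r)) :
    expectation n ω (∏ j ∈ B, symbol (μ j)) =
      ∑ z : ∀ j : B, Fin (size (μ j)) ↪ Fin n, (extremalChar ω (familyPerm g B z) : ℂ) := by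
  have := expectation_eq (n := n) ω univ (fun _ => 1) (familyPerm g B) (∏ j ∈ B, symbol (μ j))
    fun lam e => by simpa using prod_symbol_eq g hg B lam e
  simpa using this

end

theorem disjoint_push {K L : Type*} {n : ℕ} (a : K ↪ Fin n) (b : L ↪ Fin n)
    (hab : ∀ i j, a i ≠ b j) (g : Equiv.Perm K) (h : Equiv.Perm L) :
    Equiv.Perm.Disjoint (push a g) (push b h) := by
  intro x
  by_cases hx : ∃ i, a i = x
  · obtain ⟨i, rfl⟩ := hx
    exact Or.inr (push_apply_of_notMem _ _ _ fun j hj => hab i j hj.symm)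
  · push Not at hx
    exact Or.inl (push_apply_of_notMem _ _ _ hx)

theorem disjoint_permProd {r n : ℕ} {x y : Fin r → Equiv.Perm (Fin n)}
    (h : ∀ i j, Equiv.Perm.Disjoint (x i) (y j)) :
    Equiv.Perm.Disjoint (permProd x) (permProd y) := by
  refine Equiv.Perm.disjoint_prod_right _ fun σ hσ => ?_
  obtain ⟨j, rfl⟩ := (List.mem_ofFn' _ _).1 hσ
  refine (Equiv.Perm.disjoint_prod_right _ fun τ hτ => ?_).symm
  obtain ⟨i, rfl⟩ := (List.mem_ofFn' _ _).1 hτ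
  exact (h i j).symm

theorem permProd_mul {G : Type*} [Group G] {r : ℕ} (x y : Fin r → G)
    (h : ∀ i j, Commute (x i) (y j)) : permProd (x * y) = permProd x * permProd y := by
  unfold permProd
  rw [List.ofFn_eq_map, List.ofFn_eq_map, List.ofFn_eq_map]
  generalize List.finRange r = l
  induction l with
  | nil => simp
  | cons i l ih =>
    simp only [List.map_cons, List.prod_cons, ih, Pi.mul_apply]
    have hc : Commute (y i) (l.map x).prod := by
      refine Commute.list_prod_right _ _ fun τ hτ => ?_
      obtain ⟨j, -, rfl⟩ := List.mem_map.1 hτ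
      exact (h j i).symm
    rw [mul_assoc, ← mul_assoc (y i), hc.eq]
    simp only [mul_assoc]

/-- The weights are values of the extremal character. When the images over `S` avoid those over the
complement, the ordered product splits into two permutations with disjoint supports, and the
character is multiplicative on them. -/
theorem norm_cumulantOf_symbols_le {r n : ℕ} (hr : 1 ≤ r) (hn : 1 ≤ n) (ω : Simplex)
    (μ : Fin r → Multiset ℕ+) :
    ‖cumulantOf fun B => expectation n ω (∏ j ∈ B, symbol (μ j))‖ ≤
      cumulantBound r * ((∑ j, size (μ j) : ℕ) + 1 : ℝ) ^ (∑ j, size (μ j)) *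
        (n : ℝ) ^ (((∑ j, size (μ j) : ℕ) : ℤ) - r + 1) := by
  choose g hg using fun j => exists_perm_parts' (μ j) rfl
  rw [cumulantOf_congr fun B => expectation_prod_symbol g hg ω B]
  refine norm_cumulantOf_sum_le hr hn (fun j => size (μ j))
    (fun B z => (extremalChar ω (familyPerm g B z) : ℂ)) (fun B z => norm_extremalChar_le ω _)
    (fun z => ?_) fun y S hy B => ?_
  · have : familyPerm g ∅ z = 1 := by
      simp [familyPerm, permProd]
    rw [this, extremalChar_one, Complex.ofReal_one]
  · let p : Finset (Fin r) → Fin r → Equiv.Perm (Fin n) :=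
      fun B j => if j ∈ B then push (y j) (g j) else 1
    have hp : ∀ B, familyPerm g B (fun j => y j) = permProd (p B) := by
      intro B
      simp only [familyPerm, p]
      rfl
    have hd : ∀ i j, Equiv.Perm.Disjoint (p (B ∩ S) i) (p (B \ S) j) := by
      intro i j
      simp only [p]
      split_ifs with hi hj
      · exact disjoint_push _ _ (fun a b => hy i (mem_inter.1 hi).2 j (mem_sdiff.1 hj).2 a b) _ _
      · exact Equiv.Perm.disjoint_one_right _
      · exact Equiv.Perm.disjoint_one_left _
      · exact Equiv.Perm.disjoint_one_left _
    have hm : p B = p (B ∩ S) * p (B \ S) := by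
      funext j
      simp only [p, Pi.mul_apply, mem_inter, mem_sdiff]
      by_cases hB : j ∈ B <;> by_cases hS : j ∈ S <;> simp [hB, hS]
    simp only [hp]
    rw [hm, permProd_mul _ _ fun i j => (hd i j).commute, extremalChar_mul ω (disjoint_permProd hd),
      Complex.ofReal_mul]

/-! ### Expectations of symbols -/

theorem expectation_symbol {n : ℕ} (ω : Simplex) (μ : Multiset ℕ+) :
    expectation n ω (symbol μ) =
      (n.descFactorial (size μ) : ℂ) * (((μ.map PNat.val).map (powerSum ω)).prod : ℝ) := by
  obtain ⟨g, hg⟩ := exists_perm_parts' μ rfl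
  have h := expectation_eq (n := n) ω univ (fun _ => 1)
    (fun a : Fin (size μ) ↪ Fin n => push a g) (symbol μ)
    fun lam e => by simpa using symbol_eq e g μ hg
  have h2 : ∀ a : Fin (size μ) ↪ Fin n,
      extremalChar ω (push a g) = ((μ.map PNat.val).map (powerSum ω)).prod := by
    intro a
    rw [extremalChar_eq, cycleType_push, ← extremalChar_eq, extremalChar, hg]
  rw [h]
  simp [h2, Fintype.card_embedding_eq]

-- The falling factorial in `𝔼[Σ_{⊔μ_j}]` is thus a count of families with pairwise disjoint images,
-- which brings the disjoint cumulants to the same shape as the ordinary ones.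
open Classical in
theorem card_disjoint_families {r n : ℕ} (d : Fin r → ℕ) (B : Finset (Fin r)) :
    #{z : ∀ j : B, Fin (d j) ↪ Fin n | ∀ i j, i ≠ j → ∀ a b, z i a ≠ z j b} =
      n.descFactorial (∑ j ∈ B, d j) := by
  have h1 : Fintype.card ((Σ j : B, Fin (d j)) ↪ Fin n) = n.descFactorial (∑ j ∈ B, d j) := by
    rw [Fintype.card_embedding_eq, Fintype.card_sigma, Fintype.card_fin]
    simp only [Fintype.card_fin]
    rw [sum_coe_sort B d]
  rw [← h1, ← card_univ]
  symm
  refine card_bij (fun x _ j => (Function.Embedding.sigmaMk j).trans x) ?_ ?_ ?_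
  · intro x _
    simp only [mem_filter, mem_univ, true_and]
    intro i j hij a b h
    exact hij (congrArg Sigma.fst (x.injective h))
  · intro x _ x' _ h
    ext ⟨j, a⟩
    exact congrArg Fin.val (DFunLike.congr_fun (congrFun h j) a)
  · intro z hz
    simp only [mem_filter, mem_univ, true_and] at hz
    refine ⟨⟨fun p => z p.1 p.2, ?_⟩, mem_univ _, rfl⟩
    rintro ⟨i, a⟩ ⟨j, b⟩ h
    by_cases hij : i = j
    · subst hij
      have hab : a = b := (z i).injective h
      rw [hab]
    · exact absurd h (hz i j hij a b)

theorem size_sum {r : ℕ} (μ : Fin r → Multiset ℕ+) (B : Finset (Fin r)) :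
    size (∑ j ∈ B, μ j) = ∑ j ∈ B, size (μ j) := by
  simp only [size_eq]
  exact map_sum ((Multiset.sumAddMonoidHom).comp (Multiset.mapAddMonoidHom PNat.val)) _ _

-- The weight is the indicator of pairwise disjoint images times a product of power sums. Once
-- images over `S` and over its complement are disjoint, the remaining conditions separate, and so
-- does the product.
open Classical in
theorem norm_cumulantOf_symbol_sum_le {r n : ℕ} (hr : 1 ≤ r) (hn : 1 ≤ n) (ω : Simplex)
    (μ : Fin r → Multiset ℕ+) :
    ‖cumulantOf fun B => expectation n ω (symbol (∑ j ∈ B, μ j))‖ ≤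
      cumulantBound r * ((∑ j, size (μ j) : ℕ) + 1 : ℝ) ^ (∑ j, size (μ j)) *
        (n : ℝ) ^ (((∑ j, size (μ j) : ℕ) : ℤ) - r + 1) := by
  let q : Multiset ℕ+ → ℝ := fun ν => ((ν.map PNat.val).map (powerSum ω)).prod
  have hq : ∀ B : Finset (Fin r), q (∑ j ∈ B, μ j) = ∏ j ∈ B, q (μ j) := by
    intro B
    induction B using Finset.induction_on with
    | empty => simp [q]
    | insert j B hj ih =>
      rw [sum_insert hj, prod_insert hj, ← ih]
      simp only [q, Multiset.map_add, Multiset.prod_add]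
  let D : ∀ B : Finset (Fin r), (∀ j : B, Fin (size (μ j)) ↪ Fin n) → Prop :=
    fun B z => ∀ i j, i ≠ j → ∀ a b, z i a ≠ z j b
  have h1 : ∀ B : Finset (Fin r), expectation n ω (symbol (∑ j ∈ B, μ j)) =
      ∑ z : ∀ j : B, Fin (size (μ j)) ↪ Fin n,
        (if D B z then 1 else 0) * ((∏ j ∈ B, q (μ j) : ℝ) : ℂ) := by
    intro B
    rw [expectation_symbol, size_sum, ← card_disjoint_families, ← hq, ← sum_mul, sum_boole]
  rw [cumulantOf_congr h1]
  refine norm_cumulantOf_sum_le hr hn (fun j => size (μ j))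
    (fun B z => (if D B z then 1 else 0) * ((∏ j ∈ B, q (μ j) : ℝ) : ℂ)) (fun B z => ?_)
    (fun z => ?_) fun y S hy B => ?_
  · rw [norm_mul]
    refine mul_le_one₀ (by split_ifs <;> simp) (norm_nonneg _) ?_
    rw [← hq]
    refine norm_prod_powerSum_le ω _ fun k hk => ?_
    obtain ⟨l, -, rfl⟩ := Multiset.mem_map.1 hk
    exact l.pos
  · rw [if_pos]
    · simp
    · intro i
      exact absurd i.2 (notMem_empty _)
  · have hD : D B (fun j => y j) ↔ D (B ∩ S) (fun j => y j) ∧ D (B \ S) (fun j => y j) := by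
      constructor
      · intro h
        refine ⟨fun i j hij => ?_, fun i j hij => ?_⟩
        · exact h ⟨i, (mem_inter.1 i.2).1⟩ ⟨j, (mem_inter.1 j.2).1⟩
            fun hj' => hij (Subtype.ext (Subtype.mk.inj hj'))
        · exact h ⟨i, (mem_sdiff.1 i.2).1⟩ ⟨j, (mem_sdiff.1 j.2).1⟩
            fun hj' => hij (Subtype.ext (Subtype.mk.inj hj'))
      · rintro ⟨h, h'⟩ i j hij a b
        by_cases hi : i.1 ∈ S <;> by_cases hj : j.1 ∈ S
        · exact h ⟨i, mem_inter.2 ⟨i.2, hi⟩⟩ ⟨j, mem_inter.2 ⟨j.2, hj⟩⟩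
            (fun hj' => hij (Subtype.ext (Subtype.mk.inj hj'))) a b
        · exact hy i hi j hj a b
        · exact (hy j hj i hi b a).symm
        · exact h' ⟨i, mem_sdiff.2 ⟨i.2, hi⟩⟩ ⟨j, mem_sdiff.2 ⟨j.2, hj⟩⟩
            (fun hj' => hij (Subtype.ext (Subtype.mk.inj hj'))) a b
    have hprod : ∏ j ∈ B, q (μ j) = (∏ j ∈ B ∩ S, q (μ j)) * ∏ j ∈ B \ S, q (μ j) :=
      (prod_inter_mul_prod_sdiff B S _).symm
    rw [hprod]
    simp only [hD]
    by_cases hA : D (B ∩ S) (fun j => y j) <;> by_cases hA' : D (B \ S) (fun j => y j) <;>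
      simp [hA, hA']

/-! ### Expansion of the cumulants of observables -/

theorem expectation_sum {n : ℕ} (ω : Simplex) {Z : Type*} (s : Finset Z) (c : Z → ℂ)
    (F : Z → YoungDiagram → ℂ) :
    expectation n ω (∑ z ∈ s, c z • F z) = ∑ z ∈ s, c z * expectation n ω (F z) := by
  simp only [expectation, Finset.sum_apply, Pi.smul_apply, smul_eq_mul, mul_sum]
  rw [sum_comm]
  exact sum_congr rfl fun z _ => sum_congr rfl fun lam _ => by ring

theorem ofSymbols_sum_single {Z : Type*} (s : Finset Z) (c : Z → ℂ) (ν : Z → Multiset ℕ+) :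
    ofSymbols (∑ z ∈ s, AddMonoidAlgebra.single (ν z) (c z)) = ∑ z ∈ s, c z • symbol (ν z) := by
  have h : ∀ f : AddMonoidAlgebra ℂ (Multiset ℕ+),
      ofSymbols f = Finsupp.linearCombination ℂ symbol f.coeff := fun _ => rfl
  rw [h, AddMonoidAlgebra.coeff_sum, map_sum]
  refine sum_congr rfl fun z _ => ?_
  rw [AddMonoidAlgebra.coeff_single, Finsupp.linearCombination_single]

theorem eq_sum_single (f : AddMonoidAlgebra ℂ (Multiset ℕ+)) :
    f = ∑ μ : f.coeff.support, AddMonoidAlgebra.single μ.1 (f.coeff μ) := by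
  apply AddMonoidAlgebra.coeff_injective
  rw [AddMonoidAlgebra.coeff_sum]
  simp only [AddMonoidAlgebra.coeff_single]
  rw [sum_coe_sort f.coeff.support (fun μ => Finsupp.single μ (f.coeff μ))]
  exact f.coeff.sum_single.symm

theorem prod_single {ι : Type*} (s : Finset ι) (ν : ι → Multiset ℕ+) (c : ι → ℂ) :
    ∏ j ∈ s, AddMonoidAlgebra.single (ν j) (c j) =
      AddMonoidAlgebra.single (∑ j ∈ s, ν j) (∏ j ∈ s, c j) := by
  classical
  induction s using Finset.induction_on with
  | empty => simp [AddMonoidAlgebra.one_def]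
  | insert j s hj ih =>
    rw [prod_insert hj, sum_insert hj, prod_insert hj, ih, AddMonoidAlgebra.single_mul_single]

/-- A bound for a cumulant of combinations of symbols. -/
theorem norm_cumulantOf_expansion_le {r n : ℕ} (hn : 1 ≤ n)
    (f : Fin r → AddMonoidAlgebra ℂ (Multiset ℕ+))
    (d : Fin r → ℕ) (hd : ∀ j, ∀ μ ∈ (f j).coeff.support, size μ ≤ d j)
    (m : Finset (Fin r) → ℂ) (M : (Fin r → Multiset ℕ+) → Finset (Fin r) → ℂ)
    (M' : ∀ B : Finset (Fin r), (∀ j : B, (f j).coeff.support) → ℂ)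
    (hm : ∀ B, m B = ∑ z : ∀ j : B, (f j).coeff.support,
      (∏ j : B, (f j).coeff (z j)) * M' B z)
    (hM : ∀ (μ : ∀ j, (f j).coeff.support) B, M' B (fun j => μ j) = M (fun j => μ j) B)
    (K : (Fin r → Multiset ℕ+) → ℝ) (hK0 : ∀ μ, 0 ≤ K μ)
    (hK : ∀ μ, ‖cumulantOf (M μ)‖ ≤ K μ * (n : ℝ) ^ (((∑ j, size (μ j) : ℕ) : ℤ) - r + 1)) :
    ‖cumulantOf m‖ ≤ (∑ μ : ∀ j, (f j).coeff.support,
      ‖∏ j, (f j).coeff (μ j)‖ * K fun j => μ j) * (n : ℝ) ^ ((∑ j, (d j : ℤ)) - r + 1) := by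
  rw [cumulantOf_congr hm, cumulantOf_sum (Y := fun j => (f j).coeff.support)
    (fun B z => (∏ j : B, (f j).coeff (z j)) * M' B z), sum_mul]
  refine norm_sum_le_of_le _ fun μ _ => ?_
  have h1 : cumulantOf (fun B => (∏ j : B, (f j).coeff (μ j)) * M' B fun j => μ j) =
      (∏ j, (f j).coeff (μ j)) * cumulantOf (M fun j => μ j) := by
    rw [← cumulantOf_prod_mul]
    refine cumulantOf_congr fun B => ?_
    rw [hM, prod_coe_sort B fun j => (f j).coeff (μ j)]
  rw [h1, norm_mul, mul_assoc]
  refine mul_le_mul_of_nonneg_left ((hK _).trans ?_) (norm_nonneg _)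
  refine mul_le_mul_of_nonneg_left ?_ (hK0 _)
  -- Only here do the sizes of the symbols give way to the degrees: since `n ≥ 1`, smaller symbols
  -- contribute smaller powers of `n`.
  refine zpow_le_zpow_right₀ (by exact_mod_cast hn) ?_
  have : ((∑ j, size (μ j).1 : ℕ) : ℤ) ≤ ∑ j, (d j : ℤ) := by
    push_cast
    exact sum_le_sum fun j _ => by exact_mod_cast hd j _ (μ j).2
  linarith

end Thoma

end

/-! ### Conclusion for general observables -/

theorem theorem3p7 (r : ℕ) (hr : 1 ≤ r) (X : Fin r → YoungDiagram → ℂ)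
    (hX : ∀ i, X i ∈ Thoma.observables) :
    ∃ C : ℝ, ∀ (ω : Thoma.Simplex) (n : ℕ), 1 ≤ n →
      ‖Thoma.disjointCumulant n ω X‖ ≤
          C * (n : ℝ) ^ ((∑ i, (Thoma.deg (X i) : ℤ)) - (r : ℤ) + 1) ∧
        ‖Thoma.cumulant n ω X‖ ≤
          C * (n : ℝ) ^ ((∑ i, (Thoma.deg (X i) : ℤ)) - (r : ℤ) + 1) := by
  let f : Fin r → AddMonoidAlgebra ℂ (Multiset ℕ+) := fun j => Thoma.toSymbols (X j)
  have hf : ∀ j, X j = ∑ μ : (f j).coeff.support, (f j).coeff μ • Thoma.symbol μ := by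
    intro j
    conv_lhs => rw [← (Thoma.observable_expansion (hX j)).1, Thoma.eq_sum_single (Thoma.toSymbols (X j))]
    exact Thoma.ofSymbols_sum_single _ _ _
  have hd : ∀ j, ∀ μ ∈ (f j).coeff.support, Thoma.size μ ≤ Thoma.deg (X j) :=
    fun j => (Thoma.observable_expansion (hX j)).2
  let K : (Fin r → Multiset ℕ+) → ℝ := fun μ =>
    Thoma.cumulantBound r * ((∑ j, Thoma.size (μ j) : ℕ) + 1 : ℝ) ^ (∑ j, Thoma.size (μ j))
  have hK0 : ∀ μ, 0 ≤ K μ := fun μ => mul_nonneg (Thoma.cumulantBound_nonneg r) (by positivity)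
  -- The constant is the finite sum, over all choices of one symbol in each expansion, of the
  -- modulus of the coefficient times the bound for those symbols; it involves neither `ω` nor `n`
  -- and serves for both cumulants.
  refine ⟨∑ μ : ∀ j, (f j).coeff.support, ‖∏ j, (f j).coeff (μ j)‖ * K fun j => μ j,
    fun ω n hn => ⟨?_, ?_⟩⟩
  · refine Thoma.norm_cumulantOf_expansion_le hn f (fun j => Thoma.deg (X j)) hd _
      (fun μ B => Thoma.expectation n ω (Thoma.symbol (∑ j ∈ B, μ j)))
      (fun B z => Thoma.expectation n ω (Thoma.symbol (∑ j, (z j).1))) (fun B => ?_) (fun μ B => ?_) K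
      hK0 fun μ => Thoma.norm_cumulantOf_symbol_sum_le hr hn ω μ
    · rw [← Thoma.expectation_sum, ← Thoma.ofSymbols_sum_single, Thoma.disjointProd, ← prod_coe_sort]
      congr 2
      rw [prod_congr rfl fun (j : B) _ => Thoma.eq_sum_single (Thoma.toSymbols (X j)),
        prod_univ_sum, Fintype.piFinset_univ]
      exact sum_congr rfl fun z _ => Thoma.prod_single _ _ _
    · simp only
      rw [sum_coe_sort B fun j => (μ j).1]
  · refine Thoma.norm_cumulantOf_expansion_le hn f (fun j => Thoma.deg (X j)) hd _
      (fun μ B => Thoma.expectation n ω (∏ j ∈ B, Thoma.symbol (μ j)))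
      (fun B z => Thoma.expectation n ω (∏ j, Thoma.symbol (z j).1)) (fun B => ?_) (fun μ B => ?_) K
      hK0 fun μ => Thoma.norm_cumulantOf_symbols_le hr hn ω μ
    · rw [← Thoma.expectation_sum, ← prod_coe_sort]
      congr 1
      rw [prod_congr rfl fun (j : B) _ => hf j, prod_univ_sum, Fintype.piFinset_univ]
      exact sum_congr rfl fun z _ => prod_smul _ _ _
    · simp only
      rw [prod_coe_sort B fun j => Thoma.symbol (μ j).1]
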